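/- **Setting.** Let $\Xi=\mathbb{R}\times(0,\infty)$, let $\mathrm{D}(O,\rho)$ be the open disk of radius $\rho$ centred at the origin $O$ of $\mathbb{R}^2$, and let $(r,\theta)$ be polar coordinates at $O$. Say that an open set $U$ is partitioned into $U_+,U_-$ with interface $S$ if $U_\pm$ are disjoint open sets, $S=\overline{U_+}\cap\overline{U_-}$ and $U_+\cup U_-=U\setminus S$. *Cavity.* Let $\Omega\subset\mathbb{R}^2$ be a bounded connected open set with Lipschitz boundary, partitioned into $\Omega^0_+,\Omega^0_-$ with interface $\Sigma^0$, a smooth simple regular arc joining $O$ to a point $O'$ and meeting $\partial\Omega$ only at its end points $O,O'$. Near $O'$, $\partial\Omega$ and $\Sigma^0$ are straight and perpendicular (i.e. $\Omega$ is there a half disk and $\Sigma^0$ the radius orthogonal to its diameter). For some $r_0>0$, $\mathrm{D}(O,2r_0)\cap\Xi\subset\Omega$, and in $\mathrm{D}(O,2r_0)$ the set $\Omega^0_-$ coincides with the sector $\{0<\theta<\pi/4\}$ and $\Omega^0_+$ with the sector $\{\pi/4<\theta<\pi\}$. *Rounding.* Let $\Xi$ be partitioned into $\Xi_+,\Xi_-$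 with interface $\Gamma=\{\varphi_\Gamma(t),\,t\ge 0\}$, where $\varphi_\Gamma$ is $\mathscr{C}^\infty$ and injective with nowhere vanishing derivative, $\varphi_\Gamma(0)$ lies on the $x$-axis, $\partial_t\varphi_\Gamma(0)$ is orthogonal to the $x$-axis, $\varphi_\Gamma(t)\in\Xi$ for $t>0$ and $\varphi_\Gamma(t)=(t,t)$ for $t\ge1$. Outside $\mathrm{D}(O,1)$, $\Xi_-$ coincides with $\{0<\theta<\pi/4\}$ and $\Xi_+$ with $\{\pi/4<\theta<\pi\}$. For $0<\delta<2r_0$ let $\Omega^\delta_\pm$ be equal to $\Omega^0_\pm$ outside $\mathrm{D}(O,\delta)$ and to $\delta\,\Xi_\pm$ inside $\mathrm{D}(O,\delta)$. *Operator.* Let $\sigma_+>0$ and $\sigma_-<0$ be constants, let $\sigma^\delta=\sigma_\pm$ in $\Omega^\delta_\pm$, and let $\mathrm{A}^\delta$ be the unbounded operator of $\mathrm{L}^2(\Omega)$ (complex valued functions) given by $$\mathrm{A}^\delta v=-\mathrm{div}(\sigma^\delta\nabla v),\qquad D(\mathrm{A}^\delta)=\{v\in \mathrm{H}^1_0(\Omega)\;|\;\mathrm{div}(\sigma^\delta\nabla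 v)\in \mathrm{L}^2(\Omega)\}.$$ **Proposition 2.2.** Assume that $\kappa_\sigma=\sigma_- /\sigma_+\neq-1$ and $0<\delta<2r_0$. Then the spectrum $\mathfrak{S}(\mathrm{A}^\delta)$ consists of two infinite sequences, one nonnegative and one negative, of real eigenvalues of finite multiplicity: there are real numbers $\lambda^\delta_m$, $m\in\mathbb{Z}$, with $$\dots\le\lambda^\delta_{-m}\le\dots\le\lambda^\delta_{-1}<0\le\lambda^\delta_0\le\lambda^\delta_1\le\dots\le\lambda^\delta_m\le\dots,$$ such that $\mathfrak{S}(\mathrm{A}^\delta)=\{\lambda^\delta_m : m\in\mathbb{Z}\}$, each $\lambda^\delta_m$ is an eigenvalue, and the dimension of its eigenspace is finite and equal to the number of indices $j$ with $\lambda^\delta_j=\lambda^\delta_m$. Moreover $\lambda^\delta_m\to-\infty$ as $m\to-\infty$ and $\lambda^\delta_m\to+\infty$ as $m\to+\infty$; in particular $\inf\mathfrak{S}(\mathrm{A}^\delta)=-\infty$ and $\sup\mathfrak{S}(\mathrm{A}^\delta)=+\infty$. -/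

import Mathlib

open MeasureTheory Set Filter Topology
open scoped ContDiff

/-! ### Function spaces on open sets of the plane -/

/-- The Euclidean plane `ℝ²`. -/
abbrev Plane : Type := EuclideanSpace ℝ (Fin 2)

/-- The complex Hilbert space `L²(Ω)`. -/
abbrev L2 (Ω : Set Plane) : Type := Lp ℂ 2 ((volume : Measure Plane).restrict Ω)

/-- The partial derivative `∂ᵢ φ`, for `φ : ℝ² → ℂ`. -/
noncomputable def pderiv (i : Fin 2) (φ : Plane → ℂ) (x : Plane) : ℂ :=
  fderiv ℝ φ x (EuclideanSpace.single i (1 : ℝ))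

/-- Test functions: `φ ∈ C_c^∞(Ω; ℂ)`. -/
structure IsTest (Ω : Set Plane) (φ : Plane → ℂ) : Prop where
  contDiff : ContDiff ℝ ∞ φ
  hasCompactSupport : HasCompactSupport φ
  tsupport_subset : tsupport φ ⊆ Ω

theorem IsTest.zero (Ω : Set Plane) : IsTest Ω (fun _ => 0) := by
  refine ⟨contDiff_const, HasCompactSupport.zero, ?_⟩
  have h : tsupport (fun _ : Plane => (0 : ℂ)) = ∅ := by
    rw [tsupport_eq_empty_iff]; rfl
  rw [h]; exact empty_subset _

theorem IsTest.add {Ω : Set Plane} {φ ψ : Plane → ℂ} (hφ : IsTest Ω φ) (hψ : IsTest Ω ψ) :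
    IsTest Ω (φ + ψ) :=
  ⟨hφ.contDiff.add hψ.contDiff, hφ.hasCompactSupport.add hψ.hasCompactSupport,
    (tsupport_add φ ψ).trans (union_subset hφ.tsupport_subset hψ.tsupport_subset)⟩

theorem IsTest.smul {Ω : Set Plane} {φ : Plane → ℂ} (c : ℂ) (hφ : IsTest Ω φ) :
    IsTest Ω (c • φ) :=
  ⟨contDiff_const.smul hφ.contDiff, hφ.hasCompactSupport.smul_left (f := fun _ => c),
    (tsupport_smul_subset_right (fun _ => c) φ).trans hφ.tsupport_subset⟩

theorem IsTest.memLp {Ω : Set Plane} {φ : Plane → ℂ} (hφ : IsTest Ω φ) :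
    MemLp φ 2 ((volume : Measure Plane).restrict Ω) :=
  hφ.contDiff.continuous.memLp_of_hasCompactSupport hφ.hasCompactSupport

theorem IsTest.differentiable {Ω : Set Plane} {φ : Plane → ℂ} (hφ : IsTest Ω φ) :
    Differentiable ℝ φ :=
  hφ.contDiff.differentiable (by simp)

theorem IsTest.memLp_pderiv {Ω : Set Plane} {φ : Plane → ℂ} (hφ : IsTest Ω φ) (i : Fin 2) :
    MemLp (pderiv i φ) 2 ((volume : Measure Plane).restrict Ω) := by
  have h1 : Continuous (pderiv i φ) :=
    (hφ.contDiff.continuous_fderiv (by simp)).clm_apply continuous_const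
  have h2 : HasCompactSupport (pderiv i φ) :=
    hφ.hasCompactSupport.fderiv_apply ℝ (EuclideanSpace.single i (1 : ℝ))
  exact h1.memLp_of_hasCompactSupport h2

theorem L2.integrable_mul {Ω : Set Plane} (u : L2 Ω) {φ : Plane → ℂ}
    (hφ : MemLp φ 2 ((volume : Measure Plane).restrict Ω)) :
    Integrable (fun x => u x * φ x) ((volume : Measure Plane).restrict Ω) :=
  MemLp.integrable_mul (Lp.memLp u) hφ

/-- The Sobolev space `H¹(Ω)`, as the space of pairs `(u, ∇u)` with `u ∈ L²(Ω)` and weak gradient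
`∇u = (∂₀u, ∂₁u) ∈ L²(Ω)²`. -/
noncomputable def H1 (Ω : Set Plane) : Submodule ℂ (L2 Ω × (Fin 2 → L2 Ω)) where
  carrier := {p | ∀ φ : Plane → ℂ, IsTest Ω φ → ∀ i : Fin 2,
    ∫ x in Ω, p.1 x * pderiv i φ x = - ∫ x in Ω, p.2 i x * φ x}
  zero_mem' := by
    intro φ hφ i
    have h : ((0 : L2 Ω) : Plane → ℂ) =ᵐ[(volume : Measure Plane).restrict Ω] 0 := Lp.coeFn_zero ..
    have h1 : ∫ x in Ω, (0 : L2 Ω) x * pderiv i φ x = 0 :=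
      integral_eq_zero_of_ae (h.mono fun x hx => by
        simp only [hx, Pi.zero_apply, zero_mul, mul_zero, Finset.sum_const_zero])
    have h2 : ∫ x in Ω, (0 : L2 Ω) x * φ x = 0 :=
      integral_eq_zero_of_ae (h.mono fun x hx => by
        simp only [hx, Pi.zero_apply, zero_mul, mul_zero, Finset.sum_const_zero])
    change ∫ x in Ω, (0 : L2 Ω) x * pderiv i φ x = - ∫ x in Ω, (0 : L2 Ω) x * φ x
    rw [h1, h2, neg_zero]
  add_mem' := by
    intro p q hp hq φ hφ i
    have e1 : ∫ x in Ω, (p + q).1 x * pderiv i φ x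
        = ∫ x in Ω, (p.1 x * pderiv i φ x + q.1 x * pderiv i φ x) :=
      integral_congr_ae ((Lp.coeFn_add p.1 q.1).mono fun x hx => by
        simp only [Prod.fst_add, hx, Pi.add_apply, add_mul])
    have e2 : ∫ x in Ω, (p + q).2 i x * φ x
        = ∫ x in Ω, (p.2 i x * φ x + q.2 i x * φ x) :=
      integral_congr_ae ((Lp.coeFn_add (p.2 i) (q.2 i)).mono fun x hx => by
        simp only [Prod.snd_add, hx, Pi.add_apply, add_mul])
    rw [e1, e2, integral_add (L2.integrable_mul _ (hφ.memLp_pderiv i))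
      (L2.integrable_mul _ (hφ.memLp_pderiv i)), integral_add (L2.integrable_mul _ hφ.memLp)
      (L2.integrable_mul _ hφ.memLp), hp φ hφ i, hq φ hφ i, neg_add]
  smul_mem' := by
    intro c p hp φ hφ i
    have e1 : ∫ x in Ω, (c • p).1 x * pderiv i φ x = ∫ x in Ω, c * (p.1 x * pderiv i φ x) :=
      integral_congr_ae ((Lp.coeFn_smul c p.1).mono fun x hx => by
        simp only [Prod.smul_fst, hx, Pi.smul_apply, smul_eq_mul, mul_assoc])
    have e2 : ∫ x in Ω, (c • p).2 i x * φ x = ∫ x in Ω, c * (p.2 i x * φ x) :=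
      integral_congr_ae ((Lp.coeFn_smul c (p.2 i)).mono fun x hx => by
        simp only [Prod.smul_snd, hx, Pi.smul_apply, smul_eq_mul, mul_assoc])
    rw [e1, e2, integral_const_mul, integral_const_mul, hp φ hφ i, mul_neg]

/-- The pairs `(φ, ∇φ)` with `φ ∈ C_c^∞(Ω)`, in `L²(Ω) × L²(Ω)²`. -/
noncomputable def testPairs (Ω : Set Plane) : Submodule ℂ (L2 Ω × (Fin 2 → L2 Ω)) where
  carrier := {p | ∃ φ : Plane → ℂ, IsTest Ω φ ∧
    p.1 =ᵐ[(volume : Measure Plane).restrict Ω] φ ∧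
    ∀ i : Fin 2, p.2 i =ᵐ[(volume : Measure Plane).restrict Ω] pderiv i φ}
  zero_mem' := by
    refine ⟨fun _ => 0, IsTest.zero Ω, Lp.coeFn_zero .., fun i => ?_⟩
    refine (Lp.coeFn_zero ..).trans (ae_of_all _ fun x => ?_)
    simp [pderiv]
  add_mem' := by
    rintro p q ⟨φ, hφ, h1, h2⟩ ⟨ψ, hψ, k1, k2⟩
    refine ⟨φ + ψ, hφ.add hψ, (Lp.coeFn_add p.1 q.1).trans (h1.add k1), fun i => ?_⟩
    refine ((Lp.coeFn_add (p.2 i) (q.2 i)).trans ((h2 i).add (k2 i))).trans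
      (ae_of_all _ fun x => ?_)
    simp only [pderiv, Pi.add_apply]
    rw [fderiv_add (hφ.differentiable x) (hψ.differentiable x)]
    rfl
  smul_mem' := by
    rintro c p ⟨φ, hφ, h1, h2⟩
    refine ⟨c • φ, hφ.smul c, (Lp.coeFn_smul c p.1).trans (h1.const_smul c), fun i => ?_⟩
    refine ((Lp.coeFn_smul c (p.2 i)).trans ((h2 i).const_smul c)).trans
      (ae_of_all _ fun x => ?_)
    simp only [pderiv, Pi.smul_apply]
    rw [fderiv_const_smul (hφ.differentiable x)]
    rfl

/-- The Sobolev space `H¹₀(Ω)`, as the space of pairs `(u, ∇u)` with `u ∈ H¹(Ω)` in the closure of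
`C_c^∞(Ω)` for the `H¹` norm. -/
noncomputable def H10 (Ω : Set Plane) : Submodule ℂ (L2 Ω × (Fin 2 → L2 Ω)) :=
  H1 Ω ⊓ (testPairs Ω).topologicalClosure

/-! ### The operator `v ↦ -div(σ∇v)` -/

/-- A function in `L²(Ω)`, `Ω` open, that is orthogonal to all test functions is zero. -/
theorem L2.eq_zero_of_forall_test {Ω : Set Plane} (hΩ : IsOpen Ω) (u : L2 Ω)
    (h : ∀ φ : Plane → ℂ, IsTest Ω φ → ∫ x in Ω, u x * φ x = 0) : u = 0 := by
  have hloc : LocallyIntegrableOn (u : Plane → ℂ) Ω (volume : Measure Plane) := by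
    intro x hx
    obtain ⟨ε, hε, hb⟩ := Metric.isOpen_iff.1 hΩ x hx
    refine ⟨Metric.ball x ε, mem_nhdsWithin_of_mem_nhds (Metric.ball_mem_nhds x hε), ?_⟩
    have h1 : MemLp (u : Plane → ℂ) 2 ((volume : Measure Plane).restrict (Metric.ball x ε)) :=
      (Lp.memLp u).mono_measure (Measure.restrict_mono hb le_rfl)
    have : IsFiniteMeasure ((volume : Measure Plane).restrict (Metric.ball x ε)) :=
      ⟨by
        rw [Measure.restrict_apply_univ]
        exact measure_ball_lt_top⟩
    exact h1.integrable (by norm_num)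
  have key := hΩ.ae_eq_zero_of_integral_contDiff_smul_eq_zero hloc (by
    intro g hg hgc hgs
    have ht : IsTest Ω (fun x => (g x : ℂ)) := by
      refine ⟨Complex.ofRealCLM.contDiff.comp hg, ?_, ?_⟩
      · exact hgc.comp_left (g := fun r : ℝ => (r : ℂ)) Complex.ofReal_zero
      · refine (closure_mono ?_).trans hgs
        intro x hx hx0
        exact hx (by simp [hx0])
    have h2 := h _ ht
    rw [setIntegral_eq_integral_of_forall_compl_eq_zero] at h2
    · rw [← h2]
      refine integral_congr_ae (ae_of_all _ fun x => ?_)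
      simp [mul_comm]
    · intro x hx
      have : g x = 0 := image_eq_zero_of_notMem_tsupport fun hx' => hx (hgs hx')
      simp [this])
  refine Lp.ext ?_
  refine Filter.EventuallyEq.trans ?_ (Lp.coeFn_zero ..).symm
  exact (ae_restrict_iff' hΩ.measurableSet).2 key

/-- The graph of `A : v ↦ -div(σ∇v)` with domain `{v ∈ H¹₀(Ω) | div(σ∇v) ∈ L²(Ω)}`: the pairs
`(v, f) ∈ L²(Ω)²` with `v ∈ H¹₀(Ω)` and `-div(σ∇v) = f` in the sense of distributions on `Ω`. -/
noncomputable def divGraph (Ω : Set Plane) (σ : Plane → ℝ) (hσ : Measurable σ)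
    (hb : ∃ C : ℝ, ∀ x, |σ x| ≤ C) : Submodule ℂ (L2 Ω × L2 Ω) where
  carrier := {p | ∃ g : Fin 2 → L2 Ω, (p.1, g) ∈ H10 Ω ∧
    ∀ φ : Plane → ℂ, IsTest Ω φ →
      ∫ x in Ω, (∑ i, (σ x : ℂ) * (g i x * pderiv i φ x)) = ∫ x in Ω, p.2 x * φ x}
  zero_mem' := by
    refine ⟨0, (H10 Ω).zero_mem, fun φ hφ => ?_⟩
    have h : ((0 : L2 Ω) : Plane → ℂ) =ᵐ[(volume : Measure Plane).restrict Ω] 0 := Lp.coeFn_zero ..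
    have h1 : ∫ x in Ω, (∑ i : Fin 2, (σ x : ℂ) * ((0 : L2 Ω) x * pderiv i φ x)) = 0 :=
      integral_eq_zero_of_ae (h.mono fun x hx => by
        simp only [hx, Pi.zero_apply, zero_mul, mul_zero, Finset.sum_const_zero])
    have h2 : ∫ x in Ω, (0 : L2 Ω) x * φ x = 0 :=
      integral_eq_zero_of_ae (h.mono fun x hx => by
        simp only [hx, Pi.zero_apply, zero_mul, mul_zero, Finset.sum_const_zero])
    exact h1.trans h2.symm
  add_mem' := by
    rintro p q ⟨g, hg, hp⟩ ⟨k, hk, hq⟩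
    refine ⟨g + k, (H10 Ω).add_mem hg hk, fun φ hφ => ?_⟩
    obtain ⟨C, hC⟩ := hb
    have hi : ∀ g : Fin 2 → L2 Ω, Integrable
        (fun x => ∑ i, (σ x : ℂ) * (g i x * pderiv i φ x))
        ((volume : Measure Plane).restrict Ω) := fun g =>
      integrable_finsetSum _ fun i _ =>
        (L2.integrable_mul (g i) (hφ.memLp_pderiv i)).bdd_mul (c := C)
          (Complex.measurable_ofReal.comp hσ).aestronglyMeasurable
          (ae_of_all _ fun x => by simpa using hC x)
    have e1 : ∫ x in Ω, (∑ i, (σ x : ℂ) * ((g + k) i x * pderiv i φ x))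
        = ∫ x in Ω, ((∑ i, (σ x : ℂ) * (g i x * pderiv i φ x))
          + ∑ i, (σ x : ℂ) * (k i x * pderiv i φ x)) := by
      refine integral_congr_ae ?_
      filter_upwards [Lp.coeFn_add (g 0) (k 0), Lp.coeFn_add (g 1) (k 1)] with x h0 h1
      simp only [Fin.sum_univ_two, Pi.add_apply, h0, h1]
      ring
    have e2 : ∫ x in Ω, (p + q).2 x * φ x = ∫ x in Ω, (p.2 x * φ x + q.2 x * φ x) :=
      integral_congr_ae ((Lp.coeFn_add p.2 q.2).mono fun x hx => by
        simp only [Prod.snd_add, hx, Pi.add_apply, add_mul])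
    rw [e1, e2, integral_add (hi g) (hi k), integral_add (L2.integrable_mul _ hφ.memLp)
      (L2.integrable_mul _ hφ.memLp), hp φ hφ, hq φ hφ]
  smul_mem' := by
    rintro c p ⟨g, hg, hp⟩
    refine ⟨c • g, (H10 Ω).smul_mem c hg, fun φ hφ => ?_⟩
    have e1 : ∫ x in Ω, (∑ i, (σ x : ℂ) * ((c • g) i x * pderiv i φ x))
        = ∫ x in Ω, c * (∑ i, (σ x : ℂ) * (g i x * pderiv i φ x)) := by
      refine integral_congr_ae ?_
      filter_upwards [Lp.coeFn_smul c (g 0), Lp.coeFn_smul c (g 1)] with x h0 h1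
      simp only [Fin.sum_univ_two, Pi.smul_apply, h0, h1, smul_eq_mul]
      ring
    have e2 : ∫ x in Ω, (c • p).2 x * φ x = ∫ x in Ω, c * (p.2 x * φ x) :=
      integral_congr_ae ((Lp.coeFn_smul c p.2).mono fun x hx => by
        simp only [Prod.smul_snd, hx, Pi.smul_apply, smul_eq_mul, mul_assoc])
    rw [e1, e2, integral_const_mul, integral_const_mul, hp φ hφ]

/-- The unbounded operator `A v = -div(σ∇v)` in `L²(Ω)`, with domain
`D(A) = {v ∈ H¹₀(Ω) | div(σ∇v) ∈ L²(Ω)}`. -/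
noncomputable def divOp (Ω : Set Plane) (σ : Plane → ℝ) (hσ : Measurable σ)
    (hb : ∃ C : ℝ, ∀ x, |σ x| ≤ C) : L2 Ω →ₗ.[ℂ] L2 Ω :=
  (divGraph Ω σ hσ hb).toLinearPMap

/-- For `Ω` open, `divGraph` is single valued ... -/
theorem divGraph_single_valued {Ω : Set Plane} (hΩ : IsOpen Ω) (σ : Plane → ℝ)
    (hσ : Measurable σ) (hb : ∃ C : ℝ, ∀ x, |σ x| ≤ C) (p : L2 Ω × L2 Ω)
    (hp : p ∈ divGraph Ω σ hσ hb) (h0 : p.1 = 0) : p.2 = 0 := by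
  obtain ⟨g, hg, hp⟩ := hp
  have hz : ((0 : L2 Ω) : Plane → ℂ) =ᵐ[(volume : Measure Plane).restrict Ω] 0 := Lp.coeFn_zero ..
  have hg0 : ∀ i, g i = 0 := by
    intro i
    refine L2.eq_zero_of_forall_test hΩ _ fun φ hφ => ?_
    have h1 := hg.1 φ hφ i
    have h2 : ∫ x in Ω, p.1 x * pderiv i φ x = 0 := by
      rw [h0]
      exact integral_eq_zero_of_ae (hz.mono fun x hx => by
        simp only [hx, Pi.zero_apply, zero_mul])
    have h3 : (0 : ℂ) = - ∫ x in Ω, g i x * φ x := h2.symm.trans h1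
    simpa using h3.symm
  refine L2.eq_zero_of_forall_test hΩ _ fun φ hφ => ?_
  rw [← hp φ hφ]
  refine integral_eq_zero_of_ae (hz.mono fun x hx => ?_)
  simp only [hg0, hx, Pi.zero_apply, zero_mul, mul_zero, Finset.sum_const_zero]

/-- ... hence it is the graph of `divOp`. -/
theorem divOp_graph {Ω : Set Plane} (hΩ : IsOpen Ω) (σ : Plane → ℝ)
    (hσ : Measurable σ) (hb : ∃ C : ℝ, ∀ x, |σ x| ≤ C) :
    (divOp Ω σ hσ hb).graph = divGraph Ω σ hσ hb :=
  Submodule.toLinearPMap_graph_eq _ (divGraph_single_valued hΩ σ hσ hb)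

/-! ### Spectrum of an unbounded operator -/

/-- The resolvent set of an unbounded operator `A` of a Hilbert space: the `z ∈ ℂ` for which
`A - z : D(A) → H` has a bounded everywhere defined inverse `R`. -/
def unboundedResolventSet {H : Type*} [NormedAddCommGroup H] [InnerProductSpace ℂ H]
    (A : H →ₗ.[ℂ] H) : Set ℂ :=
  {z | ∃ R : H →L[ℂ] H,
    (∀ f : H, ∃ hf : R f ∈ A.domain, A ⟨R f, hf⟩ - z • R f = f) ∧
    (∀ u : A.domain, R (A u - z • (u : H)) = u)}

/-- The spectrum of an unbounded operator. -/
def unboundedSpectrum {H : Type*} [NormedAddCommGroup H] [InnerProductSpace ℂ H]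
    (A : H →ₗ.[ℂ] H) : Set ℂ :=
  (unboundedResolventSet A)ᶜ

/-- The eigenspace `ker (A - z)`, a subspace of the domain of `A`. -/
def unboundedEigenspace {H : Type*} [NormedAddCommGroup H] [InnerProductSpace ℂ H]
    (A : H →ₗ.[ℂ] H) (z : ℂ) : Submodule ℂ A.domain :=
  LinearMap.ker (A.toFun - z • A.domain.subtype)

/-! ### Geometry -/

/-- `Ω` has a Lipschitz boundary: near each boundary point, in suitable orthonormal coordinates,
`Ω` is the strict epigraph of a Lipschitz function. -/
def HasLipschitzBoundary (Ω : Set Plane) : Prop :=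
  ∀ p ∈ frontier Ω, ∃ (e : Plane ≃ₗᵢ[ℝ] Plane) (h : ℝ → ℝ) (K : NNReal) (ε : ℝ),
    LipschitzWith K h ∧ 0 < ε ∧
      ∀ x ∈ Metric.ball p ε, x ∈ Ω ↔ h (e x 0) < e x 1

/-- The open set `U` is partitioned into the disjoint open sets `Up`, `Um` and the interface
`closure Up ∩ closure Um` (its part inside `U`).  In particular
`closure U = closure Up ∪ closure Um`. -/
structure IsPartition (U Up Um : Set Plane) : Prop where
  isOpen_pos : IsOpen Up
  isOpen_neg : IsOpen Um
  disjoint : Disjoint Up Um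
  union_eq : Up ∪ Um = U \ (closure Up ∩ closure Um)

/-- The upper half plane `Ξ = ℝ × (0, ∞)`. -/
def upperHalf : Set Plane := {x | 0 < x 1}

/-- The sector `0 < θ < π/4`. -/
def sectorNeg : Set Plane := {x | 0 < x 1 ∧ x 1 < x 0}

/-- The sector `π/4 < θ < π`. -/
def sectorPos : Set Plane := {x | 0 < x 1 ∧ x 0 < x 1}

/-- The data of the geometry: the cavity `Ω` with the unrounded interface `Σ⁰` which joins the
corner `O = 0` to `O'`, and the frozen geometry `Ξ = Ξ₊ ∪ Γ ∪ Ξ₋` used to round the corner. -/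
structure RoundedCornerGeometry where
  /-- the cavity -/
  Ω : Set Plane
  isOpen_Ω : IsOpen Ω
  isConnected_Ω : IsConnected Ω
  isBounded_Ω : Bornology.IsBounded Ω
  lipschitz_Ω : HasLipschitzBoundary Ω
  /-- the subdomain `Ω₊⁰` -/
  Ωp : Set Plane
  /-- the subdomain `Ω₋⁰` -/
  Ωm : Set Plane
  partition_Ω : IsPartition Ω Ωp Ωm
  /-- a parametrization over `[0, 1]` of the interface `Σ⁰` -/
  γ : ℝ → Plane
  γ_contDiff : ContDiff ℝ ∞ γ
  γ_injOn : InjOn γ (Icc 0 1)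
  γ_deriv_ne : ∀ t ∈ Icc (0 : ℝ) 1, deriv γ t ≠ 0
  γ_image : γ '' Icc 0 1 = closure Ωp ∩ closure Ωm
  /-- the second end point of the interface -/
  O' : Plane
  γ_zero : γ 0 = 0
  γ_one : γ 1 = O'
  /-- `Σ⁰` meets `∂Ω` at `O` and `O'` only -/
  interface_inter_frontier : closure Ωp ∩ closure Ωm ∩ frontier Ω = {0, O'}
  /-- near `O'`, `∂Ω` and `Σ⁰` are straight and perpendicular (`ν` is the unit inward normal) -/
  straight_at_O' : ∃ (ν : Plane) (ε : ℝ), ‖ν‖ = 1 ∧ 0 < ε ∧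
    Ω ∩ Metric.ball O' ε = {x | 0 < inner ℝ (x - O') ν} ∩ Metric.ball O' ε ∧
    closure Ωp ∩ closure Ωm ∩ Metric.ball O' ε =
      {x | ∃ s : ℝ, 0 ≤ s ∧ x = O' + s • ν} ∩ Metric.ball O' ε
  /-- `2 r₀` is the radius of a disk around `O` in which the geometry is conical -/
  r₀ : ℝ
  r₀_pos : 0 < r₀
  halfDisk_subset : Metric.ball 0 (2 * r₀) ∩ upperHalf ⊆ Ω
  Ωp_near_O : Ωp ∩ Metric.ball 0 (2 * r₀) = sectorPos ∩ Metric.ball 0 (2 * r₀)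
  Ωm_near_O : Ωm ∩ Metric.ball 0 (2 * r₀) = sectorNeg ∩ Metric.ball 0 (2 * r₀)
  /-- the piece `Ξ₊` of the upper half plane -/
  Ξp : Set Plane
  /-- the piece `Ξ₋` of the upper half plane -/
  Ξm : Set Plane
  partition_Ξ : IsPartition upperHalf Ξp Ξm
  /-- the parametrization `φ_Γ` over `[0, ∞)` of the frozen interface `Γ` -/
  φΓ : ℝ → Plane
  φΓ_contDiff : ContDiff ℝ ∞ φΓ
  φΓ_injOn : InjOn φΓ (Ici 0)
  φΓ_deriv_ne : ∀ t ∈ Ici (0 : ℝ), deriv φΓ t ≠ 0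
  φΓ_image : φΓ '' Ici 0 = closure Ξp ∩ closure Ξm
  /-- `Γ` starts on the `x`-axis, orthogonally to it, and then stays in the open half plane -/
  φΓ_zero : φΓ 0 1 = 0
  φΓ_deriv_zero : deriv φΓ 0 0 = 0
  φΓ_mem : ∀ t : ℝ, 0 < t → φΓ t ∈ upperHalf
  φΓ_diag : ∀ t : ℝ, 1 ≤ t → φΓ t 0 = t ∧ φΓ t 1 = t
  /-- outside the unit disk the frozen geometry is conical, so that the rounded interface coincides
  with `Σ⁰` outside the disk `D(O, δ)` -/
  Ξp_far : Ξp \ Metric.ball 0 1 = sectorPos \ Metric.ball 0 1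
  Ξm_far : Ξm \ Metric.ball 0 1 = sectorNeg \ Metric.ball 0 1

namespace RoundedCornerGeometry

/-- `Ω₊^δ`: equal to `Ω₊⁰` outside `D(O, δ)` and to `δ Ξ₊` inside. -/
def Ωpδ (G : RoundedCornerGeometry) (δ : ℝ) : Set Plane :=
  (G.Ωp \ Metric.ball 0 δ) ∪ {x | x ∈ Metric.ball 0 δ ∧ δ⁻¹ • x ∈ G.Ξp}

/-- `Ω₋^δ`: equal to `Ω₋⁰` outside `D(O, δ)` and to `δ Ξ₋` inside. -/
def Ωmδ (G : RoundedCornerGeometry) (δ : ℝ) : Set Plane :=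
  (G.Ωm \ Metric.ball 0 δ) ∪ {x | x ∈ Metric.ball 0 δ ∧ δ⁻¹ • x ∈ G.Ξm}

open scoped Classical in
/-- The coefficient `σ^δ`, equal to `σp` in `Ω₊^δ` and to `σm` in `Ω₋^δ` (its value on the null set
`Ω \ (Ω₊^δ ∪ Ω₋^δ)` and outside `Ω` plays no role). -/
noncomputable def coeff (G : RoundedCornerGeometry) (δ σp σm : ℝ) (x : Plane) : ℝ :=
  if x ∈ G.Ωpδ δ then σp else if x ∈ G.Ωmδ δ then σm else 0

theorem coeff_measurable (G : RoundedCornerGeometry) (δ σp σm : ℝ) :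
    Measurable (G.coeff δ σp σm) := by
  have hb : MeasurableSet (Metric.ball (0 : Plane) δ) := measurableSet_ball
  have hs : Measurable fun x : Plane => δ⁻¹ • x := measurable_const_smul _
  have h1 : MeasurableSet (G.Ωpδ δ) :=
    (G.partition_Ω.isOpen_pos.measurableSet.diff hb).union
      (hb.inter (hs G.partition_Ξ.isOpen_pos.measurableSet))
  have h2 : MeasurableSet (G.Ωmδ δ) :=
    (G.partition_Ω.isOpen_neg.measurableSet.diff hb).union
      (hb.inter (hs G.partition_Ξ.isOpen_neg.measurableSet))
  classical
  exact Measurable.ite h1 measurable_const (Measurable.ite h2 measurable_const measurable_const)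

theorem coeff_bounded (G : RoundedCornerGeometry) (δ σp σm : ℝ) :
    ∃ C : ℝ, ∀ x, |G.coeff δ σp σm x| ≤ C := by
  refine ⟨|σp| + |σm|, fun x => ?_⟩
  unfold coeff
  split_ifs
  · exact le_add_of_nonneg_right (abs_nonneg _)
  · exact le_add_of_nonneg_left (abs_nonneg _)
  · rw [abs_zero]; positivity

/-- The operator `A^δ v = -div(σ^δ ∇v)` in `L²(Ω)`, with domain
`{v ∈ H¹₀(Ω) | div(σ^δ ∇v) ∈ L²(Ω)}`. -/
noncomputable def operatorA (G : RoundedCornerGeometry) (δ σp σm : ℝ) :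
    L2 G.Ω →ₗ.[ℂ] L2 G.Ω :=
  divOp G.Ω (G.coeff δ σp σm) (G.coeff_measurable δ σp σm) (G.coeff_bounded δ σp σm)

end RoundedCornerGeometry

/-! The form `(u, v) ↦ ∫ σ ∇u · ∇v̄` on `H¹₀(Ω)` is symmetric but indefinite, so coercivity is not
available. Its substitute is weak T-coercivity: every `u` admits a companion `v`, with norm
controlled by that of `u`, such that `Re ∫ σ ∇u · ∇v̄` dominates `‖∇u‖²` up to an error `C ‖u‖_{L²}
‖u‖_{H¹}`. If `B` is the bounded operator of the form, this yields the a priori estimate `‖u‖ ≤ C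
(‖B u‖ + ‖u‖_{L²})`.

The spectral conclusion is then abstract. By Rellich's theorem (`isCompactOperator_embL2`) the
embedding `ι` of `H¹₀(Ω)` into `L²(Ω)` is compact. Since `L²(Ω)` is separable, only countably many
real numbers are eigenvalues of the form relative to the `L²` product, and a real `l0` can be chosen
outside them. There `B - l0 ι*ι` is injective, bounded below by compactness, and symmetric, hence
bijective. So `A^δ - l0` has a compact symmetric inverse `R` (`exists_compact_resolvent`). The
spectrum of `A^δ` is the image of the eigenvalues `μ` of `R` under `μ ↦ l0 + 1/μ`; it is real,
locally finite and of finite multiplicity. It is unbounded in both directions because the quadratic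
form is: rapidly oscillating functions supported where `σ > 0`, respectively `σ < 0`, have
arbitrarily large positive, respectively negative, Rayleigh quotients (`exists_rayleigh`).

Weak T-coercivity is a local matter, because commuting a cut-off function with the form produces
only terms in which one factor is not differentiated. Near a point where `σ` equals a constant `a`,
the companion of `w` is `w / a`. Near a point of the interface, let `a` be the value of `σ` with the
larger modulus, `b` the other one, and `R` a measure preserving `K`-Lipschitz reflection exchanging
the two sides. The companion is a real multiple of the function equal to `w` on the side of `a` and
to `2 w ∘ R - w` on the side of `b`. Young's inequality absorbs the cross term as soon as `|b| K² <
|a|` (`IsFold.locallyTCoercive`).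

It remains to find reflections with `K` as close to `1` as desired; `κ ≠ -1`, that is `|a| ≠ |b|`,
then suffices. In coordinates whose first axis is tangent to the interface, a smooth interface is
locally the graph of an `ε`-Lipschitz function for any `ε > 0`, and the vertical reflection across
it is `(1 + 2ε)`-Lipschitz. It must also preserve `Ω`. This is automatic at interior points. At the
end points the interface is orthogonal to the boundary, so that `Ω` is locally a vertical half plane
in these coordinates. This is where the rounding enters: the sharp corner, where the interface makes
the angle `π/4` with the boundary, has no such chart of small slope. -/

/-! ### Enumeration of a locally finite spectrum by the integers. -/

/-- A locally finite family of multiplicities on the line which is unbounded on both sides is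
enumerated by a monotone sequence indexed by `ℤ`, the nonnegative terms having the nonnegative
indices. -/
theorem exists_int_enumeration (m : ℝ → ℕ) (hfin : ∀ a b : ℝ, {x ∈ Icc a b | m x ≠ 0}.Finite)
    (hup : ∀ C : ℝ, ∃ x, C < x ∧ m x ≠ 0) (hlow : ∀ C : ℝ, ∃ x, x < C ∧ m x ≠ 0) :
    ∃ lam : ℤ → ℝ, Monotone lam ∧ lam (-1) < 0 ∧ 0 ≤ lam 0 ∧
      Tendsto lam atBot atBot ∧ Tendsto lam atTop atTop ∧
      Set.range lam = {x | m x ≠ 0} ∧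
      ∀ x, {j : ℤ | lam j = x}.Finite ∧ {j : ℤ | lam j = x}.ncard = m x := by
  -- Each `x` is repeated `m x` times, the copies being ordered by their second component. In the
  -- lexicographic order this is a locally finite linear order without end points, hence isomorphic
  -- to `ℤ`.
  let S := {p : ℝ ×ₗ ℕ // (ofLex p).2 < m (ofLex p).1}
  let pr : S → ℝ := fun s => (ofLex s.1).1
  have hpr : Monotone pr := by
    intro s t hst
    have h : s.1 ≤ t.1 := hst
    rw [Prod.Lex.le_iff] at h
    rcases h with h | h
    · exact h.le
    · exact h.1.le
  have hlt : ∀ s t : S, pr s < pr t → s < t := by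
    intro s t h
    change s.1 < t.1
    rw [Prod.Lex.lt_iff]
    exact Or.inl h
  have mk : ∀ x, m x ≠ 0 → ∃ s : S, pr s = x := fun x hx =>
    ⟨⟨toLex (x, 0), Nat.pos_of_ne_zero hx⟩, rfl⟩
  have hIcc : ∀ a b : S, (Icc a b).Finite := by
    intro a b
    have h1 : (⋃ x ∈ {x ∈ Icc (pr a) (pr b) | m x ≠ 0}, (fun n : ℕ => toLex (x, n)) '' Iio (m x)).Finite :=
      (hfin (pr a) (pr b)).biUnion fun x _ => (finite_Iio _).image _
    refine (h1.preimage Subtype.val_injective.injOn).subset ?_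
    intro s hs
    simp only [mem_preimage, mem_iUnion]
    exact ⟨pr s, ⟨⟨hpr hs.1, hpr hs.2⟩, (Nat.zero_le _ |>.trans_lt s.2).ne'⟩, (ofLex s.1).2, s.2, rfl⟩
  let _ : LocallyFiniteOrder S := LocallyFiniteOrder.ofFiniteIcc hIcc
  have : NoMaxOrder S := ⟨fun a => by
    obtain ⟨x, hx, hm⟩ := hup (pr a)
    obtain ⟨s, rfl⟩ := mk x hm
    exact ⟨s, hlt _ _ hx⟩⟩
  have : NoMinOrder S := ⟨fun a => by
    obtain ⟨x, hx, hm⟩ := hlow (pr a)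
    obtain ⟨s, rfl⟩ := mk x hm
    exact ⟨s, hlt _ _ hx⟩⟩
  have : Nonempty S := by
    obtain ⟨x, hx, hm⟩ := hup 0
    exact ⟨(mk x hm).choose⟩
  let _ : SuccOrder S := LinearLocallyFiniteOrder.succOrder S
  let _ : PredOrder S := LinearLocallyFiniteOrder.predOrder S
  let e : S ≃o ℤ := orderIsoIntOfLinearSuccPredArch
  -- The isomorphism with `ℤ` is only determined up to translation; shifting by the least index `k`
  -- of a nonnegative term makes index `0` the first nonnegative one.
  obtain ⟨k, hk0, hk⟩ : ∃ k : ℤ, 0 ≤ pr (e.symm k) ∧ ∀ z, 0 ≤ pr (e.symm z) → k ≤ z := by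
    refine Int.exists_least_of_bdd ?_ ?_
    · obtain ⟨x, hx, hm⟩ := hlow 0
      obtain ⟨s, rfl⟩ := mk x hm
      refine ⟨e s, fun z hz => ?_⟩
      by_contra! h
      have := hpr (e.symm.monotone h.le)
      rw [e.symm_apply_apply] at this
      linarith
    · obtain ⟨x, hx, hm⟩ := hup 0
      obtain ⟨s, rfl⟩ := mk x hm
      exact ⟨e s, by rw [e.symm_apply_apply]; exact hx.le⟩
  have hmono : Monotone fun j : ℤ => pr (e.symm (j + k)) := fun i j hij =>
    hpr (e.symm.monotone (by omega))
  have hsurj : ∀ s : S, ∃ j : ℤ, pr (e.symm (j + k)) = pr s := fun s =>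
    ⟨e s - k, by simp⟩
  refine ⟨fun j => pr (e.symm (j + k)), hmono, ?_, by simpa using hk0, ?_, ?_, ?_, ?_⟩
  · by_contra! h
    have := hk _ h
    omega
  · refine tendsto_atBot_atBot_of_monotone hmono fun b => ?_
    obtain ⟨x, hx, hm⟩ := hlow b
    obtain ⟨s, rfl⟩ := mk x hm
    obtain ⟨j, hj⟩ := hsurj s
    exact ⟨j, by rw [hj]; exact hx.le⟩
  · refine tendsto_atTop_atTop_of_monotone hmono fun b => ?_
    obtain ⟨x, hx, hm⟩ := hup b
    obtain ⟨s, rfl⟩ := mk x hm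
    obtain ⟨j, hj⟩ := hsurj s
    exact ⟨j, by rw [hj]; exact hx.le⟩
  · ext x
    constructor
    · rintro ⟨j, rfl⟩
      exact (Nat.zero_le _ |>.trans_lt (e.symm (j + k)).2).ne'
    · intro hx
      obtain ⟨s, rfl⟩ := mk x hx
      exact hsurj s
  · intro x
    have himg : {j : ℤ | pr (e.symm (j + k)) = x}
        = (fun i : Fin (m x) => e ⟨toLex (x, (i : ℕ)), i.2⟩ - k) '' univ := by
      ext j
      simp only [mem_ofPred_eq, mem_image, mem_univ, true_and]
      constructor
      · rintro rfl
        refine ⟨⟨(ofLex (e.symm (j + k)).1).2, (e.symm (j + k)).2⟩, ?_⟩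
        have : (⟨toLex (pr (e.symm (j + k)), (ofLex (e.symm (j + k)).1).2), (e.symm (j + k)).2⟩ : S)
          = e.symm (j + k) := rfl
        rw [this, e.apply_symm_apply]; ring
      · rintro ⟨i, rfl⟩
        rw [sub_add_cancel, e.symm_apply_apply]
        rfl
    have hinj : Function.Injective (fun i : Fin (m x) => e ⟨toLex (x, (i : ℕ)), i.2⟩ - k) := by
      intro i i' h
      have h1 := e.injective (sub_left_injective h)
      have h2 := congrArg (fun s : S => (ofLex s.1).2) h1
      exact Fin.ext h2
    constructor
    · rw [himg]; exact finite_univ.image _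
    · change {j : ℤ | pr (e.symm (j + k)) = x}.ncard = m x
      rw [himg, ncard_image_of_injective _ hinj, ncard_univ, Nat.card_eq_fintype_card, Fintype.card_fin]

/-! ### Compact symmetric operators. -/

/-- Eigenvectors for distinct eigenvalues are orthogonal. Infinitely many unit eigenvectors with
`|μ| ≥ ε` would have images at mutual distance at least `ε`, which contradicts compactness. -/
theorem finite_hasEigenvalue_of_le_abs {H : Type*} [NormedAddCommGroup H] [InnerProductSpace ℂ H]
    [CompleteSpace H] {R : H →L[ℂ] H} (hc : IsCompactOperator R)
    (hs : (R : H →ₗ[ℂ] H).IsSymmetric) {ε : ℝ} (hε : 0 < ε) :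
    {μ : ℝ | ε ≤ |μ| ∧ Module.End.HasEigenvalue (R : H →ₗ[ℂ] H) (μ : ℂ)}.Finite := by
  by_contra hinf
  let f := (Set.Infinite.natEmbedding _ hinf)
  have hex : ∀ n, ∃ v : H, ‖v‖ = 1 ∧ R v = ((f n : ℝ) : ℂ) • v := by
    intro n
    obtain ⟨v, hv⟩ := (f n).2.2.exists_hasEigenvector
    have h1 := hv.apply_eq_smul
    refine ⟨((‖v‖⁻¹ : ℝ) : ℂ) • v, ?_, ?_⟩
    · rw [norm_smul, Complex.norm_real, norm_inv, norm_norm, inv_mul_cancel₀ (norm_ne_zero_iff.2 hv.2)]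
    · rw [map_smul, smul_comm]; congr 1
  choose v hv1 hvR using hex
  have horth : ∀ n m, n ≠ m → inner ℂ (v n) (v m) = 0 := by
    intro n m hnm
    have h1 := hs (v n) (v m)
    simp only [ContinuousLinearMap.coe_coe, hvR, inner_smul_left, inner_smul_right,
      Complex.conj_ofReal] at h1
    have h2 : ((f n : ℝ) : ℂ) ≠ ((f m : ℝ) : ℂ) := by
      intro h
      exact hnm (f.injective (Subtype.ext (Complex.ofReal_injective h)))
    have h3 : (((f n : ℝ) : ℂ) - ((f m : ℝ) : ℂ)) * inner ℂ (v n) (v m) = 0 := by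
      rw [sub_mul, h1, sub_self]
    exact (mul_eq_zero.1 h3).resolve_left (sub_ne_zero.2 h2)
  have hfar : ∀ n m, n ≠ m → ε ≤ ‖R (v n) - R (v m)‖ := by
    intro n m hnm
    have h1 : ‖R (v n) - R (v m)‖ ^ 2 = ‖R (v n)‖ ^ 2 + ‖R (v m)‖ ^ 2 := by
      rw [norm_sub_sq (𝕜 := ℂ), hvR n, hvR m, inner_smul_left, inner_smul_right, horth n m hnm]
      simp
    have h2 : ε ≤ ‖R (v n)‖ := by
      rw [hvR, norm_smul, hv1, mul_one, Complex.norm_real]; exact (f n).2.1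
    nlinarith [norm_nonneg (R (v n) - R (v m)), norm_nonneg (R (v m))]
  obtain ⟨K, hK, hK'⟩ := hc.image_closedBall_subset_compact (1 : ℝ)
  obtain ⟨y, -, ψ, hψ, hψy⟩ := hK.tendsto_subseq
    (fun n ↦ hK' ⟨v n, by simp [hv1], rfl⟩)
  have hcau := hψy.cauchySeq
  rw [Metric.cauchySeq_iff'] at hcau
  obtain ⟨N, hN⟩ := hcau ε hε
  have h1 := hN (N + 1) (Nat.le_succ N)
  rw [dist_eq_norm] at h1
  exact absurd (hfar _ _ (hψ.injective.ne (Nat.succ_ne_self N))) (not_le.2 h1)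

/-- If all the eigenvalues `μ` of the compact symmetric operator `R` satisfy `0 ≤ b μ + c μ²`, then
`b R + c R²` is a nonnegative operator. -/
theorem inner_add_mul_norm_sq_nonneg {H : Type*} [NormedAddCommGroup H] [InnerProductSpace ℂ H]
    [CompleteSpace H] {R : H →L[ℂ] H} (hc : IsCompactOperator R)
    (hs : (R : H →ₗ[ℂ] H).IsSymmetric) (b c : ℝ)
    (h : ∀ μ : ℝ, Module.End.HasEigenvalue (R : H →ₗ[ℂ] H) (μ : ℂ) → 0 ≤ b * μ + c * μ ^ 2)
    (f : H) : 0 ≤ b * (inner ℂ (R f) f).re + c * ‖R f‖ ^ 2 := by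
  have hsa : IsSelfAdjoint R := hs.isSelfAdjoint
  -- Continuous functional calculus: nonzero spectral values of a compact operator are eigenvalues,
  -- and at `0` the polynomial vanishes, so it is nonnegative on the whole spectrum.
  have h1 : (0 : H →L[ℂ] H) ≤ cfc (fun x : ℝ => b * x + c * x ^ 2) R := by
    refine cfc_nonneg fun x hx => ?_
    rcases eq_or_ne x 0 with rfl | hx0
    · simp
    refine h x ((hc.hasEigenvalue_iff_mem_spectrum (by exact_mod_cast hx0)).2 ?_)
    exact (spectrum.algebraMap_mem_iff ℂ (R := ℝ)).2 hx
  have h2 : cfc (fun x : ℝ => b * x + c * x ^ 2) R = b • R + c • R ^ 2 := by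
    rw [cfc_add R (fun x : ℝ => b * x) (fun x => c * x ^ 2) (by fun_prop) (by fun_prop),
      cfc_const_mul c (fun x : ℝ => x ^ 2) R (by fun_prop), cfc_pow_id R 2 hsa,
      cfc_const_mul_id b R hsa]
  rw [h2, ContinuousLinearMap.nonneg_iff_isPositive] at h1
  have h3 := h1.re_inner_nonneg_left f
  have h5 := hs (R f) f
  simp only [ContinuousLinearMap.coe_coe] at h5
  have h4 : (b • R + c • R ^ 2) f = (b : ℂ) • R f + (c : ℂ) • R (R f) := by
    rw [pow_two]; rfl
  rw [h4, inner_add_left, inner_smul_left, inner_smul_left, h5, inner_self_eq_norm_sq_to_K] at h3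
  simp only [Complex.conj_ofReal, RCLike.re_to_complex, Complex.add_re, Complex.re_ofReal_mul] at h3
  simpa [← Complex.ofReal_pow] using h3

/-! ### Operators with a compact symmetric resolvent. -/

section ResolventModel

variable {H : Type*} [NormedAddCommGroup H] [InnerProductSpace ℂ H]
  {A : H →ₗ.[ℂ] H} {R : H →L[ℂ] H} {l0 : ℝ}

theorem LinearPMap.apply_eq_of_mem_graph {A : H →ₗ.[ℂ] H} {x f : H} (h : (x, f) ∈ A.graph) :
    ∃ hx : x ∈ A.domain, A ⟨x, hx⟩ = f := by
  obtain ⟨y, hy1, hy2⟩ := A.mem_graph_iff.1 h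
  simp only at hy1 hy2
  subst hy1
  exact ⟨y.2, hy2⟩

theorem mem_unboundedEigenspace_iff {z : ℂ} {u : A.domain} :
    u ∈ unboundedEigenspace A z ↔ A u = z • (u : H) := by
  rw [unboundedEigenspace, LinearMap.mem_ker, LinearMap.sub_apply, sub_eq_zero]
  rfl

/-- The hypothesis `hA` encodes `R = (A - l0)⁻¹` through graphs. Hence `A x = z x` means `R ((z -
l0) x) = x`, and for `z ≠ l0` one may divide. -/
theorem map_unboundedEigenspace_eq (hA : ∀ x f, (x, f) ∈ A.graph ↔ R (f - (l0 : ℂ) • x) = x)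
    {z : ℂ} (hz : z ≠ l0) :
    (unboundedEigenspace A z).map A.domain.subtype
      = Module.End.eigenspace (R : H →ₗ[ℂ] H) (z - l0)⁻¹ := by
  have hw : z - l0 ≠ 0 := sub_ne_zero.2 hz
  have key : ∀ x : H, (x, z • x) ∈ A.graph ↔ R x = (z - l0)⁻¹ • x := by
    intro x
    rw [hA, ← sub_smul, map_smul]
    constructor
    · intro h
      nth_rewrite 2 [← h]
      rw [smul_smul, inv_mul_cancel₀ hw, one_smul]
    · intro h
      rw [h, smul_smul, mul_inv_cancel₀ hw, one_smul]
  ext x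
  rw [Module.End.mem_eigenspace_iff, ContinuousLinearMap.coe_coe, ← key]
  constructor
  · rintro ⟨u, hu, rfl⟩
    have h1 := A.mem_graph u
    rw [mem_unboundedEigenspace_iff.1 hu] at h1
    exact h1
  · intro h
    obtain ⟨hx, hAx⟩ := LinearPMap.apply_eq_of_mem_graph h
    exact ⟨⟨x, hx⟩, mem_unboundedEigenspace_iff.2 hAx, rfl⟩

theorem unboundedEigenspace_eq_bot_of_resolvent
    (hA : ∀ x f, (x, f) ∈ A.graph ↔ R (f - (l0 : ℂ) • x) = x) :
    unboundedEigenspace A l0 = ⊥ := by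
  rw [Submodule.eq_bot_iff]
  intro u hu
  have h1 := A.mem_graph u
  rw [mem_unboundedEigenspace_iff.1 hu, hA, sub_self, map_zero] at h1
  exact Subtype.ext h1.symm

/-- One has `(A - z) R = (z - l0) ((z - l0)⁻¹ - R)`, so inverting `A - z` reduces to inverting `(z -
l0)⁻¹ - R`. As `R` is compact, this can fail only at an eigenvalue of `R`. The point `l0` itself is
regular, with inverse `R`. -/
theorem mem_unboundedSpectrum_iff [CompleteSpace H] (hc : IsCompactOperator R)
    (hA : ∀ x f, (x, f) ∈ A.graph ↔ R (f - (l0 : ℂ) • x) = x) {z : ℂ} :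
    z ∈ unboundedSpectrum A ↔
      z ≠ l0 ∧ Module.End.HasEigenvalue (R : H →ₗ[ℂ] H) (z - l0)⁻¹ := by
  have hRg : ∀ g, (R g, g + (l0 : ℂ) • R g) ∈ A.graph := fun g => by
    rw [hA, add_sub_cancel_right]
  have hux : ∀ u : A.domain, R (A u - (l0 : ℂ) • (u : H)) = u := fun u =>
    (hA _ _).1 (A.mem_graph u)
  rw [unboundedSpectrum, mem_compl_iff]
  constructor
  · intro h
    have hz : z ≠ l0 := by
      rintro rfl
      refine h ⟨R, fun f => ?_, hux⟩
      obtain ⟨hx, hAx⟩ := LinearPMap.apply_eq_of_mem_graph (hRg f)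
      exact ⟨hx, by rw [hAx, add_sub_cancel_right]⟩
    refine ⟨hz, ?_⟩
    have hw : z - l0 ≠ 0 := sub_ne_zero.2 hz
    by_contra hne
    have hres := (hc.hasEigenvalue_or_mem_resolventSet (inv_ne_zero hw)).resolve_left hne
    rw [spectrum.mem_resolventSet_iff] at hres
    obtain ⟨U, hU⟩ := hres
    have hUapp : ∀ g, (U : H →L[ℂ] H) g = (z - l0)⁻¹ • g - R g := fun g => by
      rw [hU]; simp [Algebra.algebraMap_eq_smul_one]
    have hU1 : ∀ g, (U : H →L[ℂ] H) ((↑U⁻¹ : H →L[ℂ] H) g) = g := fun g =>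
      congrArg (fun T : H →L[ℂ] H => T g) U.mul_inv
    have hU2 : ∀ g, (↑U⁻¹ : H →L[ℂ] H) ((U : H →L[ℂ] H) g) = g := fun g =>
      congrArg (fun T : H →L[ℂ] H => T g) U.inv_mul
    have hkey : ∀ g, g + (l0 : ℂ) • R g - z • R g = (z - l0) • (U : H →L[ℂ] H) g := fun g => by
      rw [hUapp, smul_sub, smul_smul, mul_inv_cancel₀ hw, one_smul, sub_smul]
      abel
    refine h ⟨(z - l0)⁻¹ • (R ∘L (↑U⁻¹ : H →L[ℂ] H)), fun f => ?_, fun u => ?_⟩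
    · have h1 : ((z - l0)⁻¹ • (R ∘L (↑U⁻¹ : H →L[ℂ] H))) f
          = R ((z - l0)⁻¹ • (↑U⁻¹ : H →L[ℂ] H) f) := by
        rw [map_smul]; rfl
      rw [h1]
      obtain ⟨hx, hAx⟩ := LinearPMap.apply_eq_of_mem_graph (hRg ((z - l0)⁻¹ • (↑U⁻¹ : H →L[ℂ] H) f))
      refine ⟨hx, ?_⟩
      rw [hAx, hkey, map_smul, hU1, smul_smul, mul_inv_cancel₀ hw, one_smul]
    · set g := A u - (l0 : ℂ) • (u : H) with hg
      have h1 : A u - z • (u : H) = (z - l0) • (U : H →L[ℂ] H) g := by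
        rw [← hkey, hux u, hg]; abel
      rw [h1]
      have h2 : ((z - l0)⁻¹ • (R ∘L (↑U⁻¹ : H →L[ℂ] H))) ((z - l0) • (U : H →L[ℂ] H) g)
          = R ((z - l0)⁻¹ • (z - l0) • (↑U⁻¹ : H →L[ℂ] H) ((U : H →L[ℂ] H) g)) := by
        rw [map_smul, map_smul, map_smul, smul_comm]; rfl
      rw [h2, hU2, smul_smul, inv_mul_cancel₀ hw, one_smul, hux]
  · rintro ⟨hz, hev⟩ ⟨S, -, hS⟩
    obtain ⟨x, hx⟩ := hev.exists_hasEigenvector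
    have h1 : x ∈ (unboundedEigenspace A z).map A.domain.subtype := by
      rw [map_unboundedEigenspace_eq hA hz]; exact hx.1
    obtain ⟨u, hu, rfl⟩ := h1
    have h2 := hS u
    rw [mem_unboundedEigenspace_iff.1 hu, sub_self, map_zero] at h2
    exact hx.2 h2.symm

/-- The spectral theorem for an operator with a compact symmetric resolvent, whose quadratic form
is bounded neither from below nor from above. -/
theorem exists_int_enumeration_spectrum [CompleteSpace H] (hc : IsCompactOperator R)
    (hs : (R : H →ₗ[ℂ] H).IsSymmetric)
    (hA : ∀ x f, (x, f) ∈ A.graph ↔ R (f - (l0 : ℂ) • x) = x)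
    (hlow : ∀ C : ℝ, ∃ u : A.domain, (inner ℂ (u : H) (A u)).re < C * ‖(u : H)‖ ^ 2)
    (hup : ∀ C : ℝ, ∃ u : A.domain, C * ‖(u : H)‖ ^ 2 < (inner ℂ (u : H) (A u)).re) :
    ∃ lam : ℤ → ℝ, Monotone lam ∧ lam (-1) < 0 ∧ 0 ≤ lam 0 ∧
      Tendsto lam atBot atBot ∧ Tendsto lam atTop atTop ∧
      unboundedSpectrum A = Set.range (fun m : ℤ => (lam m : ℂ)) ∧
      ∀ m : ℤ,
        unboundedEigenspace A (lam m) ≠ ⊥ ∧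
        FiniteDimensional ℂ (unboundedEigenspace A (lam m)) ∧
        {j : ℤ | lam j = lam m}.Finite ∧
        Module.finrank ℂ (unboundedEigenspace A (lam m)) = {j : ℤ | lam j = lam m}.ncard := by
  have hinj : ∀ g, R g = 0 → g = 0 := fun g hg => by
    refine A.graph_fst_eq_zero_snd (x := 0) (x' := g) ?_ rfl
    rw [hA, smul_zero, sub_zero, hg]
  have hfd : ∀ z : ℂ, FiniteDimensional ℂ (unboundedEigenspace A z) := by
    intro z
    rcases eq_or_ne z l0 with rfl | hz
    · rw [unboundedEigenspace_eq_bot_of_resolvent hA]; infer_instance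
    have h1 := ContinuousLinearMap.finite_dimensional_eigenspace hc (z - l0)⁻¹
      (inv_ne_zero (sub_ne_zero.2 hz))
    rw [← map_unboundedEigenspace_eq hA hz] at h1
    exact (Submodule.equivMapOfInjective _ A.domain.injective_subtype _).symm.finiteDimensional
  have hev : ∀ z : ℂ, unboundedEigenspace A z ≠ ⊥ ↔
      z ≠ l0 ∧ Module.End.HasEigenvalue (R : H →ₗ[ℂ] H) (z - l0)⁻¹ := by
    intro z
    rcases eq_or_ne z l0 with rfl | hz
    · simp [unboundedEigenspace_eq_bot_of_resolvent hA]
    · rw [Module.End.hasEigenvalue_iff, ← map_unboundedEigenspace_eq hA hz, Ne, Ne, Ne,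
        ← Submodule.map_bot A.domain.subtype,
        (Submodule.map_injective_of_injective A.domain.injective_subtype).eq_iff]
      simp [hz]
  have hrank : ∀ z : ℂ, Module.finrank ℂ (unboundedEigenspace A z) ≠ 0 ↔
      unboundedEigenspace A z ≠ ⊥ := by
    intro z
    have := hfd z
    rw [Ne, Submodule.finrank_eq_zero]
  have hback : ∀ μ : ℝ, Module.End.HasEigenvalue (R : H →ₗ[ℂ] H) (μ : ℂ) →
      μ ≠ 0 ∧ Module.finrank ℂ (unboundedEigenspace A ((l0 + μ⁻¹ : ℝ) : ℂ)) ≠ 0 := by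
    intro μ hμ
    have hμ0 : μ ≠ 0 := by
      rintro rfl
      obtain ⟨v, hv⟩ := hμ.exists_hasEigenvector
      have h1 := hv.apply_eq_smul
      rw [Complex.ofReal_zero, zero_smul] at h1
      exact hv.2 (hinj v h1)
    refine ⟨hμ0, ?_⟩
    rw [hrank, hev]
    push_cast
    refine ⟨by simpa using hμ0, ?_⟩
    rw [add_sub_cancel_left, inv_inv]
    exact hμ
  have hfin : ∀ a b : ℝ, {x ∈ Icc a b |
      Module.finrank ℂ (unboundedEigenspace A (x : ℂ)) ≠ 0}.Finite := by
    intro a b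
    -- A spectral value `x` in `[a, b]` is `l0 + μ⁻¹` with `|μ⁻¹| = |x - l0| ≤ |a| + |b| + |l0|`, so
    -- `|μ|` stays away from zero; the added `1` keeps the bound positive.
    have hK : 0 < |a| + |b| + |l0| + 1 := by positivity
    refine ((finite_hasEigenvalue_of_le_abs hc hs (inv_pos.2 hK)).image
      (fun μ => l0 + μ⁻¹)).subset ?_
    rintro x ⟨hx, hxm⟩
    rw [hrank, hev] at hxm
    have hxl : x - l0 ≠ 0 := by
      intro h
      exact hxm.1 (by rw [sub_eq_zero.1 h])
    refine ⟨(x - l0)⁻¹, ⟨?_, by simpa using hxm.2⟩, by simp⟩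
    rw [abs_inv]
    refine inv_anti₀ (abs_pos.2 hxl) ?_
    have h1 := abs_le_max_abs_abs hx.1 hx.2
    have h2 : max |a| |b| ≤ |a| + |b| := max_le_add_of_nonneg (abs_nonneg _) (abs_nonneg _)
    have h3 := abs_sub x l0
    linarith
  have hup' : ∀ C : ℝ, ∃ x : ℝ, C < x ∧
      Module.finrank ℂ (unboundedEigenspace A (x : ℂ)) ≠ 0 := by
    intro C
    by_contra! hcon
    obtain ⟨u, hu⟩ := hup C
    have hR := (hA _ _).1 (A.mem_graph u)
    -- For `f = (A - l0) u` one has `R f = u`, and the quantity of the lemma with these coefficients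
    -- is `C ‖u‖² - Re (u, A u)`. Its sign contradicts the choice of `u`.
    have h1 := inner_add_mul_norm_sq_nonneg hc hs (-1) (C - l0) (fun μ hμ => by
      obtain ⟨hμ0, hm⟩ := hback μ hμ
      have : l0 + μ⁻¹ ≤ C := by
        by_contra! hlt
        exact hm (hcon _ hlt)
      have h2 : -1 * μ + (C - l0) * μ ^ 2 = μ ^ 2 * (C - (l0 + μ⁻¹)) := by
        field_simp; ring
      rw [h2]
      exact mul_nonneg (sq_nonneg _) (by linarith)) (A u - (l0 : ℂ) • (u : H))
    rw [hR, inner_sub_right, inner_smul_right, inner_self_eq_norm_sq_to_K, Complex.sub_re] at h1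
    simp only [Complex.coe_algebraMap, ← Complex.ofReal_pow, Complex.re_ofReal_mul,
      Complex.ofReal_re] at h1
    linarith
  have hlow' : ∀ C : ℝ, ∃ x : ℝ, x < C ∧
      Module.finrank ℂ (unboundedEigenspace A (x : ℂ)) ≠ 0 := by
    intro C
    by_contra! hcon
    obtain ⟨u, hu⟩ := hlow C
    have hR := (hA _ _).1 (A.mem_graph u)
    have h1 := inner_add_mul_norm_sq_nonneg hc hs 1 (l0 - C) (fun μ hμ => by
      obtain ⟨hμ0, hm⟩ := hback μ hμ
      have : C ≤ l0 + μ⁻¹ := by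
        by_contra! hlt
        exact hm (hcon _ hlt)
      have h2 : 1 * μ + (l0 - C) * μ ^ 2 = μ ^ 2 * ((l0 + μ⁻¹) - C) := by
        field_simp; ring
      rw [h2]
      exact mul_nonneg (sq_nonneg _) (by linarith)) (A u - (l0 : ℂ) • (u : H))
    rw [hR, inner_sub_right, inner_smul_right, inner_self_eq_norm_sq_to_K, Complex.sub_re] at h1
    simp only [Complex.coe_algebraMap, ← Complex.ofReal_pow, Complex.re_ofReal_mul,
      Complex.ofReal_re] at h1
    linarith
  obtain ⟨lam, h1, h2, h3, h4, h5, h6, h7⟩ := exists_int_enumeration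
    (fun x : ℝ => Module.finrank ℂ (unboundedEigenspace A (x : ℂ))) hfin hup' hlow'
  have hne : ∀ m, unboundedEigenspace A (lam m) ≠ ⊥ := fun m => by
    rw [← hrank]
    have : lam m ∈ Set.range lam := ⟨m, rfl⟩
    rw [h6] at this
    exact this
  refine ⟨lam, h1, h2, h3, h4, h5, ?_, fun m => ⟨hne m, hfd _, (h7 _).1, (h7 _).2.symm⟩⟩
  ext z
  rw [mem_unboundedSpectrum_iff hc hA]
  constructor
  · rintro ⟨hz, hzev⟩
    have hreal := hs.conj_eigenvalue_eq_self hzev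
    have hzr : ((z.re : ℝ) : ℂ) = z := by
      rw [map_inv₀, inv_inj, map_sub, Complex.conj_ofReal, sub_left_inj] at hreal
      exact Complex.conj_eq_iff_re.1 hreal
    have hmem : z.re ∈ Set.range lam := by
      rw [h6]
      change Module.finrank ℂ (unboundedEigenspace A (z.re : ℂ)) ≠ 0
      rw [hrank, hev, hzr]
      exact ⟨hz, hzev⟩
    obtain ⟨m, hm⟩ := hmem
    exact ⟨m, by simp only [hm, hzr]⟩
  · rintro ⟨m, rfl⟩
    exact (hev _).1 (hne m)

end ResolventModel

/-! ### From an a priori estimate to a compact resolvent. -/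

section Variational

variable {V H : Type*} [NormedAddCommGroup V] [InnerProductSpace ℂ V] [CompleteSpace V]
  [NormedAddCommGroup H] [InnerProductSpace ℂ H] [CompleteSpace H]

omit [CompleteSpace H] in
/-- A continuous operator which is bounded below modulo a compact operator and injective is bounded
below. -/
theorem antilipschitz_of_injective_of_compact {ι : V →L[ℂ] H} (hι : IsCompactOperator ι)
    {T : V →L[ℂ] V} {C : ℝ} (hest : ∀ u, ‖u‖ ≤ C * (‖T u‖ + ‖ι u‖)) (hinj : ∀ u, T u = 0 → u = 0) :
    ∃ K, AntilipschitzWith K T := by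
  rw [antilipschitzWith_iff_exists_mul_le_norm]
  by_contra! hcon
  have hex : ∀ n : ℕ, ∃ v : V, ‖v‖ = 1 ∧ ‖T v‖ < 1 / ((n : ℝ) + 1) := by
    intro n
    obtain ⟨x, hx⟩ := hcon (1 / ((n : ℝ) + 1)) (by positivity)
    have hx0 : 0 < ‖x‖ := by
      rcases (norm_nonneg x).eq_or_lt with h | h
      · rw [← h, mul_zero] at hx
        exact absurd hx (not_lt.2 (norm_nonneg _))
      · exact h
    refine ⟨((‖x‖⁻¹ : ℝ) : ℂ) • x, ?_, ?_⟩
    · rw [norm_smul, Complex.norm_real, norm_inv, norm_norm, inv_mul_cancel₀ hx0.ne']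
    · rw [map_smul, norm_smul, Complex.norm_real, norm_inv, norm_norm, inv_mul_lt_iff₀ hx0, mul_comm]
      exact hx
  choose v hv1 hvT using hex
  have hT0 : Tendsto (fun n => T (v n)) atTop (𝓝 0) :=
    squeeze_zero_norm (fun n => (hvT n).le) tendsto_one_div_add_atTop_nhds_zero_nat
  obtain ⟨K, hK, hK'⟩ := hι.image_closedBall_subset_compact (1 : ℝ)
  obtain ⟨y, -, ψ, hψ, hψy⟩ := hK.tendsto_subseq (fun n ↦ hK' ⟨v n, by simp [hv1], rfl⟩)
  have hT1 : Tendsto (fun n => T (v (ψ n))) atTop (𝓝 0) := hT0.comp hψ.tendsto_atTop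
  have hC : 0 ≤ C := by
    have := hest (v 0)
    rw [hv1] at this
    by_contra! h
    nlinarith [norm_nonneg (T (v 0)), norm_nonneg (ι (v 0))]
  -- Along the subsequence both `T v` and `ι v` converge; the estimate applied to differences turns
  -- this into convergence of `v` itself. The limit is then a unit vector in the kernel of `T`.
  have hcau : CauchySeq (fun n => v (ψ n)) := by
    have c1 := hT1.cauchySeq
    have c2 := hψy.cauchySeq
    rw [Metric.cauchySeq_iff] at c1 c2 ⊢
    intro ε hε
    have hε' : 0 < ε / (2 * (C + 1)) := by positivity
    obtain ⟨N1, h1⟩ := c1 _ hε'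
    obtain ⟨N2, h2⟩ := c2 _ hε'
    refine ⟨max N1 N2, fun m hm n hn => ?_⟩
    have a1 := h1 m (le_trans (le_max_left _ _) hm) n (le_trans (le_max_left _ _) hn)
    have a2 := h2 m (le_trans (le_max_right _ _) hm) n (le_trans (le_max_right _ _) hn)
    simp only [Function.comp, dist_eq_norm, ← map_sub] at a1 a2
    rw [dist_eq_norm]
    calc _ ≤ C * (‖T (v (ψ m) - v (ψ n))‖ + ‖ι (v (ψ m) - v (ψ n))‖) := hest _
      _ ≤ C * (ε / (2 * (C + 1)) + ε / (2 * (C + 1))) :=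
        mul_le_mul_of_nonneg_left (add_le_add a1.le a2.le) hC
      _ < (C + 1) * (ε / (2 * (C + 1)) + ε / (2 * (C + 1))) := by gcongr; linarith
      _ = ε := by field_simp; ring
  obtain ⟨w, hw⟩ := cauchySeq_tendsto_of_complete hcau
  have hw1 : ‖w‖ = 1 := by
    refine tendsto_nhds_unique hw.norm ?_
    simp only [hv1]; exact tendsto_const_nhds
  have hw0 : T w = 0 := tendsto_nhds_unique ((T.continuous.tendsto w).comp hw) hT1
  rw [hinj w hw0, norm_zero] at hw1
  exact zero_ne_one hw1

-- Eigenvectors for distinct values, normalized in `H`, have orthonormal images under `ι`; the balls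
-- of radius `1/2` around these images are disjoint, and a separable space holds only countably
-- many.
omit [CompleteSpace V] [CompleteSpace H] in
theorem countable_setOf_generalized_eigenvalue [TopologicalSpace.SeparableSpace H] (ι : V →L[ℂ] H)
    (hinj : Function.Injective ι) (B : V →L[ℂ] V) (hB : (B : V →ₗ[ℂ] V).IsSymmetric)
    (K : V →L[ℂ] V) (hK : ∀ u v, inner ℂ u (K v) = inner ℂ (ι u) (ι v)) :
    {l : ℝ | ∃ u, u ≠ 0 ∧ B u = (l : ℂ) • K u}.Countable := by
  set S := {l : ℝ | ∃ u, u ≠ 0 ∧ B u = (l : ℂ) • K u}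
  have hex : ∀ l : S, ∃ u, ‖ι u‖ = 1 ∧ B u = ((l : ℝ) : ℂ) • K u := by
    rintro ⟨l, u, hu0, hu⟩
    have h0 : ‖ι u‖ ≠ 0 := by
      rw [norm_ne_zero_iff]
      intro h
      exact hu0 (hinj (by rw [h, map_zero]))
    refine ⟨((‖ι u‖⁻¹ : ℝ) : ℂ) • u, ?_, ?_⟩
    · rw [map_smul, norm_smul, Complex.norm_real, norm_inv, norm_norm, inv_mul_cancel₀ h0]
    · rw [map_smul, map_smul, smul_comm]; exact congrArg _ hu
  choose u hu1 hu using hex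
  have hon : Orthonormal ℂ (fun l : S => ι (u l)) := by
    refine ⟨hu1, fun l m hlm => ?_⟩
    have h1 := hB (u l) (u m)
    simp only [ContinuousLinearMap.coe_coe, hu, inner_smul_left, inner_smul_right,
      Complex.conj_ofReal] at h1
    rw [← inner_conj_symm, hK, inner_conj_symm, hK] at h1
    have h2 : (((l : ℝ) : ℂ) - ((m : ℝ) : ℂ)) * inner ℂ (ι (u l)) (ι (u m)) = 0 := by
      rw [sub_mul, h1, sub_self]
    refine (mul_eq_zero.1 h2).resolve_left (sub_ne_zero.2 ?_)
    intro h
    exact hlm (Subtype.ext (Complex.ofReal_injective h))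
  have hdist : Pairwise fun l m : S => 1 ≤ dist (ι (u l)) (ι (u m)) := by
    intro l m hlm
    have h1 : ‖ι (u l) - ι (u m)‖ ^ 2 = 2 := by
      rw [norm_sub_sq (𝕜 := ℂ), hu1, hu1, hon.2 hlm]
      norm_num
    rw [dist_eq_norm]
    nlinarith [norm_nonneg (ι (u l) - ι (u m))]
  have hd : Pairwise fun l m : S => Disjoint (Metric.ball (ι (u l)) (1 / 2)) (Metric.ball (ι (u m)) (1 / 2)) := by
    intro l m hlm
    refine Metric.ball_disjoint_ball ?_
    have := hdist hlm
    linarith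
  have : Countable S := Pairwise.countable_of_isOpen_disjoint hd (fun _ => Metric.isOpen_ball)
    (fun l => ⟨ι (u l), Metric.mem_ball_self (by norm_num)⟩)
  exact countable_coe_iff.1 this

/-- A symmetric form which is coercive up to a bounded operator and a compact perturbation has a
compact symmetric resolvent at some real point. -/
theorem exists_compact_resolvent [TopologicalSpace.SeparableSpace H] (ι : V →L[ℂ] H)
    (hι : IsCompactOperator ι) (hinj : Function.Injective ι) (B : V →L[ℂ] V)
    (hB : (B : V →ₗ[ℂ] V).IsSymmetric) {C : ℝ} (hest : ∀ u, ‖u‖ ≤ C * (‖B u‖ + ‖ι u‖)) :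
    ∃ (l0 : ℝ) (R : H →L[ℂ] H), IsCompactOperator R ∧ (R : H →ₗ[ℂ] H).IsSymmetric ∧
      ∀ x f, (∃ u, ι u = x ∧ ∀ v, inner ℂ v (B u) = inner ℂ (ι v) f) ↔
        R (f - (l0 : ℂ) • x) = x := by
  set K : V →L[ℂ] V := ι.adjoint ∘L ι with hKdef
  have hK : ∀ u v, inner ℂ u (K v) = inner ℂ (ι u) (ι v) := fun u v =>
    ι.adjoint_inner_right u (ι v)
  have hcount := countable_setOf_generalized_eigenvalue ι hinj B hB K hK
  -- The complement of a countable subset of `ℝ` is dense, so there is a real shift which is not an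
  -- eigenvalue. It must be real for `T` to be symmetric.
  obtain ⟨l0, hl0⟩ := (hcount.dense_compl ℝ).nonempty
  set T : V →L[ℂ] V := B - (l0 : ℂ) • K with hTdef
  have hTapp : ∀ u, T u = B u - (l0 : ℂ) • K u := fun u => rfl
  have hTinj : ∀ u, T u = 0 → u = 0 := by
    intro u hu
    by_contra h0
    exact hl0 ⟨u, h0, sub_eq_zero.1 hu⟩
  have hTs : ∀ u v, inner ℂ (T u) v = inner ℂ u (T v) := by
    intro u v
    have h1 := hB u v
    simp only [ContinuousLinearMap.coe_coe] at h1
    rw [hTapp, hTapp, inner_sub_left, inner_sub_right, h1, inner_smul_left, inner_smul_right, hK,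
      ← inner_conj_symm (K u) v, hK, inner_conj_symm, Complex.conj_ofReal]
  have hTest : ∀ u, ‖u‖ ≤ max C 0 * (1 + |l0| * ‖ι.adjoint‖) * (‖T u‖ + ‖ι u‖) := by
    intro u
    have h1 : B u = T u + (l0 : ℂ) • K u := by rw [hTapp]; abel
    have h2 : ‖B u‖ ≤ ‖T u‖ + |l0| * (‖ι.adjoint‖ * ‖ι u‖) := by
      rw [h1]
      refine (norm_add_le _ _).trans ?_
      rw [norm_smul, Complex.norm_real, Real.norm_eq_abs]
      gcongr
      exact ι.adjoint.le_opNorm (ι u)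
    calc ‖u‖ ≤ C * (‖B u‖ + ‖ι u‖) := hest u
      _ ≤ max C 0 * (‖T u‖ + |l0| * (‖ι.adjoint‖ * ‖ι u‖) + ‖ι u‖) := by
          gcongr
          exact le_max_left _ _
      _ ≤ _ := by
          rw [mul_assoc]
          gcongr
          have : 0 ≤ |l0| * ‖ι.adjoint‖ * ‖T u‖ := by positivity
          nlinarith
  obtain ⟨κ, hκ⟩ := antilipschitz_of_injective_of_compact hι hTest hTinj
  have hclosed : IsClosed (T.range : Set V) := by
    have h : (T.range : Set V) = Set.range T := by ext; simp
    rw [h]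
    exact hκ.isClosed_range T.uniformContinuous
  -- The range is closed since `T` is bounded below, and its orthogonal complement is the kernel of
  -- the symmetric operator `T`, which is zero.
  have hTr : T.range = ⊤ := by
    have : CompleteSpace T.range := hclosed.completeSpace_coe
    rw [← Submodule.orthogonal_eq_bot_iff, Submodule.eq_bot_iff]
    intro v hv
    refine hTinj v (ext_inner_left ℂ fun w => ?_)
    rw [inner_zero_right, ← hTs]
    exact (Submodule.mem_orthogonal _ _).1 hv _ ⟨w, rfl⟩
  let E : V ≃L[ℂ] V := ContinuousLinearEquiv.ofBijective T
    (LinearMap.ker_eq_bot'.2 hTinj) hTr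
  have hE1 : ∀ u, T (E.symm u) = u := fun u => E.apply_symm_apply u
  have hE2 : ∀ u, E.symm (T u) = u := fun u => E.symm_apply_apply u
  refine ⟨l0, ι ∘L (E.symm : V →L[ℂ] V) ∘L ι.adjoint, ?_, ?_, ?_⟩
  · exact hι.comp_clm ((E.symm : V →L[ℂ] V) ∘L ι.adjoint)
  · intro f g
    change inner ℂ (ι (E.symm (ι.adjoint f))) g = inner ℂ f (ι (E.symm (ι.adjoint g)))
    rw [← ι.adjoint_inner_right, ← ι.adjoint_inner_left]
    nth_rewrite 1 [← hE1 (ι.adjoint g)]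
    rw [← hTs, hE1]
  · intro x f
    change _ ↔ ι (E.symm (ι.adjoint (f - (l0 : ℂ) • x))) = x
    constructor
    · rintro ⟨u, rfl, hu⟩
      have h1 : ι.adjoint (f - (l0 : ℂ) • ι u) = T u := by
        refine ext_inner_left ℂ fun v => ?_
        rw [ι.adjoint_inner_right, inner_sub_right, ← hu v, hTapp, inner_sub_right,
          inner_smul_right, inner_smul_right, hK]
      rw [h1, hE2]
    · intro h
      refine ⟨_, h, fun v => ?_⟩
      set u := E.symm (ι.adjoint (f - (l0 : ℂ) • x)) with hu
      have h1 : T u = ι.adjoint (f - (l0 : ℂ) • x) := by rw [hu, hE1]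
      have h2 : B u = T u + (l0 : ℂ) • K u := by rw [hTapp]; abel
      rw [h2, h1, inner_add_right, ι.adjoint_inner_right, inner_sub_right, inner_smul_right,
        inner_smul_right, hK, h]
      ring

end Variational

/-! ### Compactly supported Lipschitz functions. -/

/-- Compactly supported Lipschitz functions. -/
structure IsLip (Ω : Set Plane) (w : Plane → ℂ) : Prop where
  lipschitz : ∃ C, LipschitzWith C w
  hasCompactSupport : HasCompactSupport w
  tsupport_subset : tsupport w ⊆ Ω

theorem measurable_pderiv (i : Fin 2) (w : Plane → ℂ) : Measurable (pderiv i w) :=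
  measurable_fderiv_apply_const ℝ w _

theorem LipschitzWith.norm_pderiv_le {C : NNReal} {w : Plane → ℂ} (h : LipschitzWith C w) (i : Fin 2)
    (x : Plane) : ‖pderiv i w x‖ ≤ C := by
  refine ((fderiv ℝ w x).le_opNorm _).trans ?_
  rw [PiLp.norm_single, norm_one, mul_one]
  exact norm_fderiv_le_of_lipschitz ℝ h

theorem support_pderiv_subset (i : Fin 2) (w : Plane → ℂ) :
    Function.support (pderiv i w) ⊆ tsupport w := by
  intro x hx
  refine support_fderiv_subset ℝ (f := w) ?_
  intro h
  exact hx (by simp [pderiv, h])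

theorem pderiv_eq_zero_of_notMem_tsupport {w : Plane → ℂ} {x : Plane} (i : Fin 2)
    (hx : x ∉ tsupport w) : pderiv i w x = 0 := by
  by_contra h
  exact hx (support_pderiv_subset i w h)

theorem memLp_of_bounded_of_compact {f : Plane → ℂ} {K : Set Plane} (hf : AEStronglyMeasurable f)
    (hK : IsCompact K) (hsupp : Function.support f ⊆ K) {C : ℝ} (hC : ∀ x, ‖f x‖ ≤ C)
    (p : ENNReal) (Ω : Set Plane) : MemLp f p (volume.restrict Ω) := by
  have h1 : MemLp f p (volume.restrict K) := by
    have : IsFiniteMeasure (volume.restrict K) := ⟨by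
      rw [Measure.restrict_apply_univ]; exact hK.measure_lt_top⟩
    exact MemLp.of_bound hf.restrict C (ae_of_all _ hC)
  have h2 : MemLp f p volume := by
    rw [← memLp_indicator_iff_restrict hK.measurableSet] at h1
    rwa [indicator_eq_self.2 hsupp] at h1
  exact h2.restrict _

namespace IsLip

variable {Ω : Set Plane} {w : Plane → ℂ}

theorem continuous (h : IsLip Ω w) : Continuous w := h.lipschitz.choose_spec.continuous

theorem bounded (h : IsLip Ω w) : ∃ M : ℝ, ∀ x, ‖w x‖ ≤ M :=
  h.hasCompactSupport.exists_bound_of_continuous h.continuous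

theorem memLp (h : IsLip Ω w) : MemLp w 2 (volume.restrict Ω) :=
  h.continuous.memLp_of_hasCompactSupport h.hasCompactSupport

theorem memLp_pderiv (h : IsLip Ω w) (i : Fin 2) : MemLp (pderiv i w) 2 (volume.restrict Ω) := by
  obtain ⟨C, hC⟩ := h.lipschitz
  exact memLp_of_bounded_of_compact (measurable_pderiv i w).aestronglyMeasurable
    h.hasCompactSupport (support_pderiv_subset i w) (hC.norm_pderiv_le i) _ _

theorem ae_differentiableAt (h : IsLip Ω w) : ∀ᵐ x, DifferentiableAt ℝ w x :=
  h.lipschitz.choose_spec.ae_differentiableAt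

theorem mul {w' : Plane → ℂ} (h : IsLip Ω w) (h' : IsLip univ w') : IsLip Ω (fun x => w x * w' x) := by
  obtain ⟨C, hC⟩ := h.lipschitz
  obtain ⟨D, hD⟩ := h'.lipschitz
  obtain ⟨M, hM⟩ := h.bounded
  obtain ⟨N, hN⟩ := h'.bounded
  have hM0 : 0 ≤ M := (norm_nonneg _).trans (hM 0)
  have hN0 : 0 ≤ N := (norm_nonneg _).trans (hN 0)
  refine ⟨⟨M.toNNReal * D + N.toNNReal * C, LipschitzWith.of_dist_le_mul fun x y => ?_⟩,
    h.hasCompactSupport.mul_right, (tsupport_mul_subset_left).trans h.tsupport_subset⟩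
  have e : w x * w' x - w y * w' y = w x * (w' x - w' y) + w' y * (w x - w y) := by ring
  rw [dist_eq_norm, e]
  refine (norm_add_le _ _).trans ?_
  rw [norm_mul, norm_mul, ← dist_eq_norm, ← dist_eq_norm]
  push_cast
  rw [Real.coe_toNNReal _ hM0, Real.coe_toNNReal _ hN0, add_mul, mul_assoc, mul_assoc]
  gcongr
  · exact hM x
  · exact hD.dist_le_mul x y
  · exact hN y
  · exact hC.dist_le_mul x y

theorem mono {Ω' : Set Plane} (h : IsLip Ω w) (hΩ : Ω ⊆ Ω') : IsLip Ω' w :=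
  ⟨h.lipschitz, h.hasCompactSupport, h.tsupport_subset.trans hΩ⟩

/-- This is integration by parts of the line derivative against the constant `1`. That formula
concerns real functions, hence the passage through the real linear forms `L`. -/
theorem integral_pderiv_eq_zero (h : IsLip Ω w) (i : Fin 2) : ∫ x, pderiv i w x = 0 := by
  obtain ⟨C, hC⟩ := h.lipschitz
  have hint : Integrable (pderiv i w) := by
    have := memLp_of_bounded_of_compact (measurable_pderiv i w).aestronglyMeasurable
      h.hasCompactSupport (support_pderiv_subset i w) (hC.norm_pderiv_le i) 1 univ
    rwa [Measure.restrict_univ, memLp_one_iff_integrable] at this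
  have key : ∀ L : ℂ →L[ℝ] ℝ, L (∫ x, pderiv i w x) = 0 := by
    intro L
    rw [← L.integral_comp_comm hint]
    have hL : LipschitzWith (‖L‖₊ * C) (fun x => L (w x)) := L.lipschitz.comp hC
    have hLs : HasCompactSupport (fun x => L (w x)) := h.hasCompactSupport.comp_left (map_zero L)
    have h1 := LipschitzWith.integral_lineDeriv_mul_eq (μ := (volume : Measure Plane))
      (LipschitzWith.const (1 : ℝ)) hL hLs (-(EuclideanSpace.single i (1 : ℝ)))
    rw [neg_neg] at h1
    have h2 : ∀ x : Plane, lineDeriv ℝ (fun _ : Plane => (1 : ℝ)) x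
      (-(EuclideanSpace.single i (1 : ℝ))) = 0 := fun x => by simp [lineDeriv]
    simp only [h2, zero_mul, integral_zero, mul_one] at h1
    rw [h1]
    refine integral_congr_ae ?_
    filter_upwards [h.ae_differentiableAt] with x hx
    have h3 : HasFDerivAt (fun x => L (w x)) (L ∘L fderiv ℝ w x) x := L.hasFDerivAt.comp x hx.hasFDerivAt
    rw [h3.differentiableAt.lineDeriv_eq_fderiv, h3.fderiv]
    rfl
  exact Complex.ext (key Complex.reCLM) (key Complex.imCLM)

end IsLip

theorem IsTest.isLip {Ω : Set Plane} {φ : Plane → ℂ} (h : IsTest Ω φ) : IsLip Ω φ :=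
  ⟨h.contDiff.lipschitzWith_of_hasCompactSupport h.hasCompactSupport (by simp),
    h.hasCompactSupport, h.tsupport_subset⟩

theorem IsTest.mono {Ω Ω' : Set Plane} {φ : Plane → ℂ} (h : IsTest Ω φ) (hΩ : Ω ⊆ Ω') :
    IsTest Ω' φ :=
  ⟨h.contDiff, h.hasCompactSupport, h.tsupport_subset.trans hΩ⟩

theorem pderiv_mul {w w' : Plane → ℂ} {x : Plane} (hw : DifferentiableAt ℝ w x)
    (hw' : DifferentiableAt ℝ w' x) (i : Fin 2) :
    pderiv i (fun x => w x * w' x) x = w x * pderiv i w' x + pderiv i w x * w' x := by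
  rw [pderiv, fderiv_fun_mul hw hw']
  simp [pderiv, mul_comm]

/-- Integration by parts. -/
theorem IsLip.integral_mul_pderiv {w w' : Plane → ℂ} (h : IsLip univ w)
    (h' : IsLip univ w') (i : Fin 2) :
    ∫ x, w x * pderiv i w' x = - ∫ x, pderiv i w x * w' x := by
  have h1 := (h.mul h').integral_pderiv_eq_zero i
  have h2 : ∫ x, pderiv i (fun x => w x * w' x) x
      = ∫ x, (w x * pderiv i w' x + pderiv i w x * w' x) := by
    refine integral_congr_ae ?_
    filter_upwards [h.ae_differentiableAt, h'.ae_differentiableAt] with x hx hx'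
    exact pderiv_mul hx hx' i
  have i1 : MemLp w 2 volume := by simpa using h.memLp
  have i2 : MemLp w' 2 volume := by simpa using h'.memLp
  have i3 : MemLp (pderiv i w) 2 volume := by simpa using h.memLp_pderiv i
  have i4 : MemLp (pderiv i w') 2 volume := by simpa using h'.memLp_pderiv i
  have h3 : ∫ x, (w x * pderiv i w' x + pderiv i w x * w' x)
      = (∫ x, w x * pderiv i w' x) + ∫ x, pderiv i w x * w' x :=
    integral_add (i1.integrable_mul i4) (i3.integrable_mul i2)
  rw [h2, h3] at h1
  exact eq_neg_of_add_eq_zero_left h1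

/-! ### The space `H¹₀(Ω)` as a Hilbert space -/

theorem L2.norm_sq_toLp {Ω : Set Plane} {f : Plane → ℂ} (hf : MemLp f 2 (volume.restrict Ω)) :
    ‖hf.toLp f‖ ^ 2 = ∫ x in Ω, ‖f x‖ ^ 2 := by
  have h1 : ((‖hf.toLp f‖ ^ 2 : ℝ) : ℂ) = ((∫ x in Ω, ‖f x‖ ^ 2 : ℝ) : ℂ) := by
    rw [Complex.ofReal_pow]
    have h0 := inner_self_eq_norm_sq_to_K (𝕜 := ℂ) (hf.toLp f)
    refine h0.symm.trans ?_
    rw [L2.inner_def, ← integral_complex_ofReal]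
    refine integral_congr_ae ?_
    filter_upwards [hf.coeFn_toLp] with x hx
    rw [hx, inner_self_eq_norm_sq_to_K]
    simp
  exact Complex.ofReal_injective h1

theorem L2.tendsto_toLp_of_dominated {Ω : Set Plane} {f : ℕ → Plane → ℂ} {g : Plane → ℂ}
    (hf : ∀ n, MemLp (f n) 2 (volume.restrict Ω)) (hg : MemLp g 2 (volume.restrict Ω))
    {b : Plane → ℝ} (hb : Integrable (fun x => b x ^ 2) (volume.restrict Ω))
    (hfb : ∀ n x, ‖f n x - g x‖ ≤ b x)
    (hlim : ∀ᵐ x ∂(volume.restrict Ω), Tendsto (fun n => f n x) atTop (𝓝 (g x))) :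
    Tendsto (fun n => (hf n).toLp (f n)) atTop (𝓝 (hg.toLp g)) := by
  rw [tendsto_iff_norm_sub_tendsto_zero]
  have h1 : ∀ n, ‖(hf n).toLp (f n) - hg.toLp g‖ = Real.sqrt (∫ x in Ω, ‖f n x - g x‖ ^ 2) := by
    intro n
    rw [← MemLp.toLp_sub, ← Real.sqrt_sq (norm_nonneg _), L2.norm_sq_toLp]
    rfl
  simp only [h1]
  rw [← Real.sqrt_zero]
  refine (Real.continuous_sqrt.tendsto 0).comp ?_
  have h2 : (0 : ℝ) = ∫ x in Ω, (0 : ℝ) := by simp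
  rw [h2]
  refine tendsto_integral_of_dominated_convergence (fun x => b x ^ 2) (fun n => ?_) hb
    (fun n => ae_of_all _ fun x => ?_) ?_
  · exact ((hf n).sub hg).aestronglyMeasurable.norm.pow 2
  · rw [Real.norm_of_nonneg (by positivity)]
    gcongr
    exact hfb n x
  · filter_upwards [hlim] with x hx
    have := ((hx.sub_const (g x)).norm).pow 2
    simpa using this

/-- Pairs `(u, (p₀, p₁)) ∈ L²(Ω) × L²(Ω)²`, with the Hilbert norm. -/
abbrev SobolevPair (Ω : Set Plane) : Type := PiLp 2 (fun _ : Option (Fin 2) => L2 Ω)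

noncomputable def SobolevPair.toProd (Ω : Set Plane) :
    SobolevPair Ω →ₗ[ℂ] L2 Ω × (Fin 2 → L2 Ω) where
  toFun e := (e none, fun i => e (some i))
  map_add' _ _ := rfl
  map_smul' _ _ := rfl

theorem SobolevPair.continuous_toProd (Ω : Set Plane) : Continuous (SobolevPair.toProd Ω) :=
  (PiLp.continuous_apply 2 _ none).prodMk
    (continuous_pi fun i => PiLp.continuous_apply 2 _ (some i))

/-- The space `H¹₀(Ω)` as a subspace of a Hilbert space. -/
noncomputable def H10Space (Ω : Set Plane) : Submodule ℂ (SobolevPair Ω) :=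
  (H10 Ω).comap (SobolevPair.toProd Ω)

theorem L2.integral_mul_eq_inner {Ω : Set Plane} {φ : Plane → ℂ}
    (hφ : MemLp (fun x => (starRingEnd ℂ) (φ x)) 2 (volume.restrict Ω)) (u : L2 Ω) :
    ∫ x in Ω, u x * φ x = inner ℂ (hφ.toLp _) u := by
  rw [L2.inner_def]
  refine integral_congr_ae ?_
  filter_upwards [hφ.coeFn_toLp] with x hx
  rw [hx, RCLike.inner_apply, Complex.conj_conj]

theorem L2.continuous_integral_mul {Ω : Set Plane} {φ : Plane → ℂ}
    (hφ : MemLp φ 2 (volume.restrict Ω)) :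
    Continuous fun u : L2 Ω => ∫ x in Ω, u x * φ x := by
  have h1 : MemLp (fun x => (starRingEnd ℂ) (φ x)) 2 (volume.restrict Ω) := hφ.star
  simp only [L2.integral_mul_eq_inner h1]
  fun_prop

theorem isClosed_H1 (Ω : Set Plane) : IsClosed (H1 Ω : Set (L2 Ω × (Fin 2 → L2 Ω))) := by
  have h1 : (H1 Ω : Set (L2 Ω × (Fin 2 → L2 Ω))) = ⋂ (φ : Plane → ℂ) (_ : IsTest Ω φ) (i : Fin 2),
      {p | ∫ x in Ω, p.1 x * pderiv i φ x = - ∫ x in Ω, p.2 i x * φ x} := by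
    ext p
    simp only [mem_iInter, mem_ofPred_eq]
    rfl
  rw [h1]
  refine isClosed_iInter fun φ => isClosed_iInter fun hφ => isClosed_iInter fun i => ?_
  exact isClosed_eq ((L2.continuous_integral_mul (hφ.memLp_pderiv i)).comp continuous_fst)
    ((L2.continuous_integral_mul hφ.memLp).comp ((continuous_apply i).comp continuous_snd)).neg

theorem isClosed_H10Space (Ω : Set Plane) : IsClosed (H10Space Ω : Set (SobolevPair Ω)) := by
  have h1 : IsClosed (H10 Ω : Set (L2 Ω × (Fin 2 → L2 Ω))) :=
    (isClosed_H1 Ω).inter (Submodule.isClosed_topologicalClosure _)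
  exact h1.preimage (SobolevPair.continuous_toProd Ω)

instance (Ω : Set Plane) : CompleteSpace (H10Space Ω) :=
  (isClosed_H10Space Ω).completeSpace_coe

/-- The element `(w, ∇w)`. -/
noncomputable def IsLip.toSobolev {Ω : Set Plane} {w : Plane → ℂ} (h : IsLip Ω w) :
    SobolevPair Ω :=
  WithLp.toLp 2 fun o => o.elim (h.memLp.toLp w) fun i => (h.memLp_pderiv i).toLp (pderiv i w)

@[simp] theorem IsLip.toSobolev_some {Ω : Set Plane} {w : Plane → ℂ} (h : IsLip Ω w) (i : Fin 2) :
    h.toSobolev (some i) = (h.memLp_pderiv i).toLp (pderiv i w) := rfl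

theorem IsLip.toProd_toSobolev_mem_H1 {Ω : Set Plane} {w : Plane → ℂ} (h : IsLip Ω w) :
    SobolevPair.toProd Ω h.toSobolev ∈ H1 Ω := by
  intro φ hφ i
  change ∫ x in Ω, (h.memLp.toLp w) x * pderiv i φ x
    = - ∫ x in Ω, ((h.memLp_pderiv i).toLp (pderiv i w)) x * φ x
  have e1 : ∫ x in Ω, (h.memLp.toLp w) x * pderiv i φ x = ∫ x in Ω, w x * pderiv i φ x :=
    integral_congr_ae (h.memLp.coeFn_toLp.mono fun x hx => by simp only [hx])
  have e2 : ∫ x in Ω, ((h.memLp_pderiv i).toLp (pderiv i w)) x * φ x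
      = ∫ x in Ω, pderiv i w x * φ x :=
    integral_congr_ae ((h.memLp_pderiv i).coeFn_toLp.mono fun x hx => by simp only [hx])
  have hx0 : ∀ x, x ∉ Ω → x ∉ tsupport φ := fun x hx hx' => hx (hφ.tsupport_subset hx')
  rw [e1, e2, setIntegral_eq_integral_of_forall_compl_eq_zero (fun x hx => by
    rw [pderiv_eq_zero_of_notMem_tsupport i (hx0 x hx), mul_zero]),
    setIntegral_eq_integral_of_forall_compl_eq_zero (fun x hx => by
    rw [image_eq_zero_of_notMem_tsupport (hx0 x hx), mul_zero])]
  exact (h.mono (subset_univ _)).integral_mul_pderiv (hφ.isLip.mono (subset_univ _)) i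

theorem IsTest.toProd_toSobolev_mem_testPairs {Ω : Set Plane} {φ : Plane → ℂ} (h : IsTest Ω φ) :
    SobolevPair.toProd Ω h.isLip.toSobolev ∈ testPairs Ω :=
  ⟨φ, h, h.isLip.memLp.coeFn_toLp, fun i => (h.isLip.memLp_pderiv i).coeFn_toLp⟩

theorem IsTest.toSobolev_mem {Ω : Set Plane} {φ : Plane → ℂ} (h : IsTest Ω φ) :
    h.isLip.toSobolev ∈ H10Space Ω :=
  ⟨h.isLip.toProd_toSobolev_mem_H1,
    Submodule.le_topologicalClosure _ h.toProd_toSobolev_mem_testPairs⟩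

theorem mem_H10Space_of_tendsto {Ω : Set Plane} {e : SobolevPair Ω} {s : ℕ → SobolevPair Ω}
    (hs : ∀ n, s n ∈ H10Space Ω) (h : Tendsto s atTop (𝓝 e)) : e ∈ H10Space Ω :=
  (isClosed_H10Space Ω).mem_of_tendsto h (Eventually.of_forall hs)

theorem SobolevPair.tendsto_iff {Ω : Set Plane} {e : SobolevPair Ω} {s : ℕ → SobolevPair Ω} :
    Tendsto s atTop (𝓝 e) ↔ ∀ o, Tendsto (fun n => s n o) atTop (𝓝 (e o)) := by
  rw [← tendsto_pi_nhds, ← (PiLp.homeomorph 2 (fun _ : Option (Fin 2) => L2 Ω)).isInducing.tendsto_nhds_iff.symm]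
  rfl

/-! ### Mollification. -/

open scoped Convolution in
/-- Mollification by a bump function. -/
noncomputable def mollify (ρ : ContDiffBump (0 : Plane)) (w : Plane → ℂ) : Plane → ℂ :=
  ρ.normed volume ⋆[ContinuousLinearMap.lsmul ℝ ℝ, volume] w

theorem mollify_apply (ρ : ContDiffBump (0 : Plane)) (w : Plane → ℂ) (x : Plane) :
    mollify ρ w x = ∫ t, ρ.normed volume t • w (x - t) := rfl

theorem support_mollify_subset (ρ : ContDiffBump (0 : Plane)) (w : Plane → ℂ) :
    Function.support (mollify ρ w) ⊆ Metric.cthickening ρ.rOut (tsupport w) := by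
  intro x hx
  obtain ⟨a, ha, b, hb, rfl⟩ := support_convolution_subset (L := ContinuousLinearMap.lsmul ℝ ℝ) hx
  rw [ContDiffBump.support_normed_eq, mem_ball_zero_iff] at ha
  refine Metric.mem_cthickening_of_dist_le (a + b) b _ _ (subset_tsupport w hb) ?_
  rw [dist_eq_norm, add_sub_cancel_right]
  exact ha.le

theorem contDiff_mollify (ρ : ContDiffBump (0 : Plane)) {w : Plane → ℂ}
    (hw : LocallyIntegrable w) : ContDiff ℝ ∞ (mollify ρ w) :=
  HasCompactSupport.contDiff_convolution_left _ ρ.hasCompactSupport_normed ρ.contDiff_normed hw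

theorem norm_mollify_le (ρ : ContDiffBump (0 : Plane)) {w : Plane → ℂ} {C : ℝ}
    (hC : ∀ x, ‖w x‖ ≤ C) (x : Plane) : ‖mollify ρ w x‖ ≤ C := by
  rw [mollify_apply]
  calc _ ≤ ∫ t, ρ.normed volume t * C := by
        refine norm_integral_le_of_norm_le (ρ.integrable_normed.mul_const C) (ae_of_all _ fun t => ?_)
        rw [norm_smul, Real.norm_of_nonneg (ρ.nonneg_normed t)]
        exact mul_le_mul_of_nonneg_left (hC _) (ρ.nonneg_normed t)
    _ = C := by rw [integral_mul_const, ρ.integral_normed, one_mul]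

/-- The derivative is made to fall on `w`, not on the kernel. By Rademacher's theorem `w` is
differentiable almost everywhere, and its Lipschitz constant supplies the domination needed to
differentiate under the integral. -/
theorem pderiv_mollify (ρ : ContDiffBump (0 : Plane)) {w : Plane → ℂ} {C : NNReal}
    (hC : LipschitzWith C w) (i : Fin 2) : pderiv i (mollify ρ w) = mollify ρ (pderiv i w) := by
  ext x
  have hcont : Continuous w := hC.continuous
  have hρ : Continuous (ρ.normed volume) := ρ.continuous_normed
  have hae : ∀ᵐ t : Plane, DifferentiableAt ℝ w (x - t) := by
    have h1 := hC.ae_differentiableAt (μ := (volume : Measure Plane))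
    exact (Measure.measurePreserving_sub_left (volume : Measure Plane) x).quasiMeasurePreserving.ae h1
  have hmeas : AEStronglyMeasurable (fun t => ρ.normed volume t • fderiv ℝ w (x - t)) :=
    hρ.aestronglyMeasurable.smul
      ((measurable_fderiv ℝ w).comp (measurable_const.sub measurable_id)).aestronglyMeasurable
  have hF : HasFDerivAt (fun y => ∫ t, ρ.normed volume t • w (y - t))
      (∫ t, ρ.normed volume t • fderiv ℝ w (x - t)) x := by
    refine (hasFDerivAt_integral_of_dominated_loc_of_lip (μ := volume) (s := univ)
      (bound := fun t => ρ.normed volume t * C) univ_mem ?_ ?_ hmeas ?_ ?_ ?_).2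
    · exact Eventually.of_forall fun y => (hρ.smul (hcont.comp (by fun_prop))).aestronglyMeasurable
    · exact Continuous.integrable_of_hasCompactSupport (hρ.smul (hcont.comp (by fun_prop)))
        ρ.hasCompactSupport_normed.smul_right
    · refine ae_of_all _ fun t => LipschitzWith.lipschitzOnWith (LipschitzWith.of_dist_le_mul ?_)
      intro y z
      have h0 : 0 ≤ ρ.normed volume t * C := mul_nonneg (ρ.nonneg_normed t) C.2
      rw [dist_eq_norm, ← smul_sub, norm_smul, Real.norm_of_nonneg (ρ.nonneg_normed t),
        ← dist_eq_norm, Real.coe_nnabs, abs_of_nonneg h0, mul_assoc]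
      refine mul_le_mul_of_nonneg_left ?_ (ρ.nonneg_normed t)
      have := hC.dist_le_mul (y - t) (z - t)
      rwa [dist_sub_right] at this
    · exact ρ.integrable_normed.mul_const _
    · filter_upwards [hae] with t ht
      have h1 : HasFDerivAt (fun y => w (y - t)) (fderiv ℝ w (x - t)) x :=
        (hasFDerivAt_comp_sub (f := w) t).2 ht.hasFDerivAt
      exact h1.const_smul (ρ.normed volume t)
  have hint : Integrable (fun t => ρ.normed volume t • fderiv ℝ w (x - t)) := by
    refine (ρ.integrable_normed.mul_const (C : ℝ)).mono' hmeas (ae_of_all _ fun t => ?_)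
    rw [norm_smul, Real.norm_of_nonneg (ρ.nonneg_normed t)]
    exact mul_le_mul_of_nonneg_left (norm_fderiv_le_of_lipschitz ℝ hC) (ρ.nonneg_normed t)
  have h2 : fderiv ℝ (mollify ρ w) x = ∫ t, ρ.normed volume t • fderiv ℝ w (x - t) := hF.fderiv
  rw [pderiv, h2, ContinuousLinearMap.integral_apply hint]
  rfl

/-- A bounded ratio of outer to inner radius is what makes mollifications of a merely locally
integrable function converge almost everywhere. This is needed for the gradients, which are only
bounded and measurable. -/
theorem exists_bump_seq {d : ℝ} (hd : 0 < d) : ∃ ρ : ℕ → ContDiffBump (0 : Plane),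
    (∀ n, (ρ n).rOut ≤ d) ∧ Tendsto (fun n => (ρ n).rOut) atTop (𝓝 0) ∧
    ∀ n, (ρ n).rOut ≤ 2 * (ρ n).rIn := by
  have h1 : ∀ n : ℕ, 0 < d / ((n : ℝ) + 1) := fun n => by positivity
  refine ⟨fun n => ⟨d / ((n : ℝ) + 1) / 2, d / ((n : ℝ) + 1), half_pos (h1 n), half_lt_self (h1 n)⟩,
    fun n => ?_, ?_, fun n => ?_⟩
  · exact div_le_self hd.le (by linarith [(Nat.cast_nonneg n : (0 : ℝ) ≤ n)])
  · have := (tendsto_one_div_add_atTop_nhds_zero_nat (𝕜 := ℝ)).const_mul d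
    simpa [div_eq_mul_inv] using this
  · change d / ((n : ℝ) + 1) ≤ 2 * (d / ((n : ℝ) + 1) / 2)
    linarith

/-- Folding a smooth function across an interface leaves it only Lipschitz, and the result must
still be admissible in the form. Mollifications at scales below the distance from the support to the
complement of `Ω` are test functions, and they and their gradients converge in `L²` by domination.
-/
theorem IsLip.toSobolev_mem {Ω : Set Plane} (hΩ : IsOpen Ω) {w : Plane → ℂ} (h : IsLip Ω w) :
    h.toSobolev ∈ H10Space Ω := by
  obtain ⟨d, hd, hdΩ⟩ := h.hasCompactSupport.isCompact.exists_cthickening_subset_open hΩ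
    h.tsupport_subset
  set K := Metric.cthickening d (tsupport w)
  have hK : IsCompact K := h.hasCompactSupport.isCompact.cthickening
  obtain ⟨ρ, hρd, hρ0, hρ2⟩ := exists_bump_seq hd
  have hsub : ∀ n, Metric.cthickening (ρ n).rOut (tsupport w) ⊆ K := fun n =>
    Metric.cthickening_mono (hρd n) _
  have hsuppK : ∀ (n : ℕ) (f : Plane → ℂ), Function.support f ⊆ tsupport w →
      Function.support (mollify (ρ n) f) ⊆ K := fun n f hf =>
    (support_mollify_subset _ _).trans ((Metric.cthickening_subset_of_subset _
      (closure_minimal hf isClosed_closure)).trans (hsub n))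
  have htest : ∀ n, IsTest Ω (mollify (ρ n) w) := fun n =>
    ⟨contDiff_mollify _ h.continuous.locallyIntegrable,
      HasCompactSupport.intro' hK hK.isClosed fun x hx => by
        by_contra hne
        exact hx (hsuppK n w (subset_tsupport w) hne),
      (closure_minimal (hsuppK n w (subset_tsupport w)) hK.isClosed).trans hdΩ⟩
  refine mem_H10Space_of_tendsto (fun n => (htest n).toSobolev_mem) ?_
  obtain ⟨C, hC⟩ := h.lipschitz
  have key : ∀ (f : Plane → ℂ) (M : ℝ), LocallyIntegrable f → Function.support f ⊆ tsupport w →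
      (∀ x, ‖f x‖ ≤ M) → ∀ (hf : MemLp f 2 (volume.restrict Ω))
      (hfn : ∀ n, MemLp (mollify (ρ n) f) 2 (volume.restrict Ω)),
      Tendsto (fun n => (hfn n).toLp (mollify (ρ n) f)) atTop (𝓝 (hf.toLp f)) := by
    intro f M hfi hfs hfM hf hfn
    refine L2.tendsto_toLp_of_dominated hfn hf (b := K.indicator fun _ => 2 * M) ?_ ?_ ?_
    · have h1 : (fun x => K.indicator (fun _ => 2 * M) x ^ 2) = K.indicator fun _ => (2 * M) ^ 2 := by
        ext x
        by_cases hx : x ∈ K <;> simp [hx]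
      rw [h1]
      refine Integrable.restrict ?_
      rw [integrable_indicator_iff hK.measurableSet]
      exact integrableOn_const hK.measure_lt_top.ne
    · intro n x
      by_cases hx : x ∈ K
      · rw [indicator_of_mem hx]
        refine (norm_sub_le _ _).trans ?_
        linarith [norm_mollify_le (ρ n) hfM x, hfM x]
      · have h1 : mollify (ρ n) f x = 0 := by
          by_contra hne; exact hx (hsuppK n f hfs hne)
        have h2 : f x = 0 := by
          by_contra hne
          exact hx (Metric.self_subset_cthickening _ (hfs hne))
        rw [indicator_of_notMem hx, h1, h2, sub_zero, norm_zero]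
    · exact ae_restrict_of_ae (ContDiffBump.ae_convolution_tendsto_right_of_locallyIntegrable
        (K := 2) hρ0 (Eventually.of_forall hρ2) hfi)
  rw [SobolevPair.tendsto_iff]
  obtain ⟨M, hM⟩ := h.bounded
  rintro (_ | i)
  · exact key w M h.continuous.locallyIntegrable (subset_tsupport w) hM h.memLp
      fun n => (htest n).isLip.memLp
  · have h1 : MemLp (pderiv i w) 2 volume := by
      have := (h.mono (subset_univ _)).memLp_pderiv i
      rwa [Measure.restrict_univ] at this
    have hfn : ∀ n, MemLp (mollify (ρ n) (pderiv i w)) 2 (volume.restrict Ω) := fun n => by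
      rw [← pderiv_mollify _ hC]; exact (htest n).isLip.memLp_pderiv i
    have h2 := key (pderiv i w) C (h1.locallyIntegrable (by norm_num)) (support_pderiv_subset i w)
      (hC.norm_pderiv_le i) (h.memLp_pderiv i) hfn
    refine h2.congr fun n => ?_
    rw [IsLip.toSobolev_some]
    congr 1
    exact (pderiv_mollify _ hC i).symm

theorem H10Space.exists_seq_test {Ω : Set Plane} {e : SobolevPair Ω} (he : e ∈ H10Space Ω) :
    ∃ (φ : ℕ → Plane → ℂ) (hφ : ∀ n, IsTest Ω (φ n)),
      Tendsto (fun n => (hφ n).isLip.toSobolev) atTop (𝓝 e) := by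
  have h1 : SobolevPair.toProd Ω e ∈ closure (testPairs Ω : Set (L2 Ω × (Fin 2 → L2 Ω))) := he.2
  rw [mem_closure_iff_seq_limit] at h1
  obtain ⟨p, hp, hlim⟩ := h1
  choose φ hφ h2 h3 using hp
  refine ⟨φ, hφ, SobolevPair.tendsto_iff.2 ?_⟩
  have e1 : ∀ n, (hφ n).isLip.toSobolev none = (p n).1 := fun n =>
    Lp.ext ((hφ n).isLip.memLp.coeFn_toLp.trans (h2 n).symm)
  have e2 : ∀ n i, (hφ n).isLip.toSobolev (some i) = (p n).2 i := fun n i =>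
    Lp.ext (((hφ n).isLip.memLp_pderiv i).coeFn_toLp.trans (h3 n i).symm)
  rintro (_ | i)
  · simp only [e1]
    exact (continuous_fst.tendsto _).comp hlim
  · simp only [e2]
    exact (((continuous_apply i).comp continuous_snd).tendsto _).comp hlim

/-! ### Compactness of the embedding of `H¹₀(Ω)` into `L²(Ω)` -/

theorem sq_lintegral_le {α : Type*} [MeasurableSpace α] (μ : Measure α) {f : α → ENNReal}
    (hf : AEMeasurable f μ) : (∫⁻ a, f a ∂μ) ^ 2 ≤ μ univ * ∫⁻ a, f a ^ 2 ∂μ := by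
  have h := ENNReal.lintegral_mul_le_Lp_mul_Lq μ Real.HolderConjugate.two_two hf
    (aemeasurable_const (b := (1 : ENNReal)))
  simp only [Pi.mul_apply, mul_one, lintegral_const, ENNReal.rpow_ofNat] at h
  have hs : ∀ x : ENNReal, (x ^ (1 / 2 : ℝ)) ^ 2 = x := fun x => by
    rw [← ENNReal.rpow_natCast, ← ENNReal.rpow_mul]
    norm_num
  have h2 := pow_le_pow_left' h 2
  rw [mul_pow, hs, hs, one_pow, one_mul] at h2
  rwa [mul_comm]

theorem norm_sq_fderiv_le {φ : Plane → ℂ} (x : Plane) :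
    ‖fderiv ℝ φ x‖ ^ 2 ≤ ∑ i, ‖pderiv i φ x‖ ^ 2 := by
  have h1 : ‖fderiv ℝ φ x‖ ≤ Real.sqrt (∑ i, ‖pderiv i φ x‖ ^ 2) := by
    refine ContinuousLinearMap.opNorm_le_bound _ (Real.sqrt_nonneg _) fun v => ?_
    have h2 : fderiv ℝ φ x v = ∑ i, (v i) • pderiv i φ x := by
      have h3 : v = ∑ i, v i • EuclideanSpace.single i (1 : ℝ) := by
        ext j
        fin_cases j <;> simp
      conv_lhs => rw [h3]
      rw [map_sum]
      simp [pderiv]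
    rw [h2]
    refine (norm_sum_le _ _).trans ?_
    simp only [norm_smul]
    rw [EuclideanSpace.norm_eq v]
    refine (Real.sum_mul_le_sqrt_mul_sqrt _ _ _).trans (le_of_eq (mul_comm _ _))
  calc _ ≤ Real.sqrt (∑ i, ‖pderiv i φ x‖ ^ 2) ^ 2 := by gcongr
    _ = _ := Real.sq_sqrt (by positivity)

/-- Write the increment as the integral of the derivative along the segment from `x` to `x + v`,
apply Cauchy–Schwarz, exchange the integrals and use translation invariance. -/
theorem lintegral_sq_translate_sub_le {φ : Plane → ℂ} (hφ : ContDiff ℝ ∞ φ) (v : Plane) :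
    ∫⁻ x, ‖φ (x + v) - φ x‖ₑ ^ 2 ≤ ‖v‖ₑ ^ 2 * ∫⁻ x, ‖fderiv ℝ φ x‖ₑ ^ 2 := by
  have hc : Continuous (fderiv ℝ φ) := hφ.continuous_fderiv (by simp)
  have hd : Differentiable ℝ φ := hφ.differentiable (by simp)
  have h1 : ∀ x, ‖φ (x + v) - φ x‖ₑ ^ 2
      ≤ ∫⁻ s in Ioc (0 : ℝ) 1, ‖v‖ₑ ^ 2 * ‖fderiv ℝ φ (x + s • v)‖ₑ ^ 2 := by
    intro x
    have hcs : Continuous fun s : ℝ => fderiv ℝ φ (x + s • v) v := by fun_prop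
    have hder : ∀ s ∈ uIcc (0 : ℝ) 1, HasDerivAt (fun s : ℝ => φ (x + s • v))
        (fderiv ℝ φ (x + s • v) v) s := by
      intro s _
      have h2 : HasDerivAt (fun s : ℝ => x + s • v) v s := by
        simpa using ((hasDerivAt_id s).smul_const v).const_add x
      exact (hd _).hasFDerivAt.comp_hasDerivAt s h2
    have h3 := intervalIntegral.integral_eq_sub_of_hasDerivAt hder
      (hcs.intervalIntegrable (μ := volume) 0 1)
    simp only [one_smul, zero_smul, add_zero] at h3
    rw [← h3, intervalIntegral.integral_of_le zero_le_one]
    calc _ ≤ (∫⁻ s in Ioc (0 : ℝ) 1, ‖fderiv ℝ φ (x + s • v) v‖ₑ) ^ 2 := by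
          gcongr
          exact enorm_integral_le_lintegral_enorm _
      _ ≤ (volume.restrict (Ioc (0 : ℝ) 1)) univ
            * ∫⁻ s in Ioc (0 : ℝ) 1, ‖fderiv ℝ φ (x + s • v) v‖ₑ ^ 2 :=
          sq_lintegral_le _ hcs.enorm.measurable.aemeasurable
      _ = ∫⁻ s in Ioc (0 : ℝ) 1, ‖fderiv ℝ φ (x + s • v) v‖ₑ ^ 2 := by simp
      _ ≤ _ := by
          refine lintegral_mono fun s => ?_
          rw [← mul_pow, mul_comm]
          gcongr
          exact ContinuousLinearMap.le_opENorm _ _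
  calc _ ≤ ∫⁻ x, ∫⁻ s in Ioc (0 : ℝ) 1, ‖v‖ₑ ^ 2 * ‖fderiv ℝ φ (x + s • v)‖ₑ ^ 2 :=
        lintegral_mono h1
    _ = ∫⁻ s in Ioc (0 : ℝ) 1, ∫⁻ x, ‖v‖ₑ ^ 2 * ‖fderiv ℝ φ (x + s • v)‖ₑ ^ 2 := by
        refine lintegral_lintegral_swap ?_
        refine Measurable.aemeasurable ?_
        have : Continuous fun p : Plane × ℝ => ‖fderiv ℝ φ (p.1 + p.2 • v)‖ₑ := by fun_prop
        exact (this.measurable.pow_const 2).const_mul _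
    _ = ∫⁻ s in Ioc (0 : ℝ) 1, ‖v‖ₑ ^ 2 * ∫⁻ x, ‖fderiv ℝ φ x‖ₑ ^ 2 := by
        refine lintegral_congr fun s => ?_
        rw [lintegral_const_mul]
        · congr 1
          exact lintegral_add_right_eq_self (fun x => ‖fderiv ℝ φ x‖ₑ ^ 2) (s • v)
        · have : Continuous fun x : Plane => ‖fderiv ℝ φ (x + s • v)‖ₑ := by fun_prop
          exact this.measurable.pow_const 2
    _ = _ := by simp

/-- The cell of index `k` of the grid of mesh size `h`. -/
def gridCell (h : ℝ) (k : Fin 2 → ℤ) : Set Plane := {x | ∀ i, ⌊x i / h⌋ = k i}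

/-- The index of the cell of `x`. -/
noncomputable def gridIndex (h : ℝ) (x : Plane) : Fin 2 → ℤ := fun i => ⌊x i / h⌋

theorem mem_gridCell_iff {h : ℝ} {k : Fin 2 → ℤ} {x : Plane} :
    x ∈ gridCell h k ↔ gridIndex h x = k := by
  rw [funext_iff]; rfl

theorem gridCell_eq_preimage {h : ℝ} (hh : 0 < h) (k : Fin 2 → ℤ) :
    gridCell h k = (WithLp.ofLp : Plane → Fin 2 → ℝ) ⁻¹'
      (pi univ fun i => Ico (k i * h) ((k i + 1) * h)) := by
  ext x
  simp only [gridCell, mem_ofPred_eq, mem_preimage, Set.mem_pi, mem_univ, true_implies, mem_Ico,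
    Int.floor_eq_iff, le_div_iff₀ hh, div_lt_iff₀ hh]

theorem measurableSet_gridCell {h : ℝ} (hh : 0 < h) (k : Fin 2 → ℤ) :
    MeasurableSet (gridCell h k) := by
  rw [gridCell_eq_preimage hh]
  exact (MeasurableSet.univ_pi fun i => measurableSet_Ico).preimage
    (PiLp.volume_preserving_ofLp (Fin 2)).measurable

theorem volume_gridCell {h : ℝ} (hh : 0 < h) (k : Fin 2 → ℤ) :
    volume (gridCell h k) = ENNReal.ofReal (h ^ 2) := by
  rw [gridCell_eq_preimage hh, (PiLp.volume_preserving_ofLp (Fin 2)).measure_preimage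
    (MeasurableSet.univ_pi fun i => measurableSet_Ico).nullMeasurableSet, Real.volume_pi_Ico]
  have : ∀ i, (k i + 1) * h - k i * h = h := fun i => by ring
  simp only [this, Fin.prod_univ_two, ← ENNReal.ofReal_mul hh.le, pow_two]

theorem dist_lt_of_mem_gridCell {h : ℝ} (hh : 0 < h) {k : Fin 2 → ℤ} {x y : Plane}
    (hx : x ∈ gridCell h k) (hy : y ∈ gridCell h k) : dist y x < 2 * h := by
  have h1 : ∀ i, (y i - x i) ^ 2 < h ^ 2 := by
    intro i
    have a := hx i
    have b := hy i
    rw [Int.floor_eq_iff, le_div_iff₀ hh, div_lt_iff₀ hh] at a b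
    exact sq_lt_sq' (by linarith [a.1, b.2]) (by linarith [a.2, b.1])
  rw [dist_eq_norm, EuclideanSpace.norm_eq]
  refine (Real.sqrt_lt_sqrt (by positivity) (y := (2 * h) ^ 2) ?_).trans_eq
    (Real.sqrt_sq (by positivity))
  simp only [Fin.sum_univ_two, PiLp.sub_apply, Real.norm_eq_abs, sq_abs]
  nlinarith [h1 0, h1 1]

/-- Poincaré's inequality for the averages over the cells of a grid. -/
theorem lintegral_sq_sub_average_le {φ : Plane → ℂ} (hφ : ContDiff ℝ ∞ φ)
    (hφc : HasCompactSupport φ) {h : ℝ} (hh : 0 < h) :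
    ∫⁻ x, ‖φ x - ((h ^ 2)⁻¹ : ℝ) • ∫ y in gridCell h (gridIndex h x), φ y‖ₑ ^ 2
      ≤ ENNReal.ofReal (16 * Real.pi * h ^ 2) * ∫⁻ x, ‖fderiv ℝ φ x‖ₑ ^ 2 := by
  have hcont : Continuous φ := hφ.continuous
  have hm : 0 < h ^ 2 := by positivity
  set m := ENNReal.ofReal (h ^ 2) with hmdef
  have hm0 : m ≠ 0 := (ENNReal.ofReal_pos.2 hm).ne'
  have hmt : m ≠ ⊤ := ENNReal.ofReal_ne_top
  have h1 : ∀ x, ‖φ x - ((h ^ 2)⁻¹ : ℝ) • ∫ y in gridCell h (gridIndex h x), φ y‖ₑ ^ 2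
      ≤ m⁻¹ * ∫⁻ v in Metric.ball (0 : Plane) (2 * h), ‖φ (x + v) - φ x‖ₑ ^ 2 := by
    intro x
    set Q := gridCell h (gridIndex h x) with hQ
    have hxQ : x ∈ Q := mem_gridCell_iff.2 rfl
    have hvol : volume Q = m := volume_gridCell hh _
    have hint : IntegrableOn φ Q :=
      (hcont.integrable_of_hasCompactSupport hφc).integrableOn
    have e1 : φ x - ((h ^ 2)⁻¹ : ℝ) • ∫ y in Q, φ y
        = ((h ^ 2)⁻¹ : ℝ) • ∫ y in Q, (φ x - φ y) := by
      have hconst : IntegrableOn (fun _ => φ x) Q := integrableOn_const (by rw [hvol]; exact hmt)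
      rw [integral_sub hconst hint, setIntegral_const,
        smul_sub, smul_smul, measureReal_def, hvol, hmdef, ENNReal.toReal_ofReal hm.le,
        inv_mul_cancel₀ hm.ne', one_smul]
    have e2 : ‖((h ^ 2)⁻¹ : ℝ)‖ₑ = m⁻¹ := by
      rw [Real.enorm_eq_ofReal (by positivity), ENNReal.ofReal_inv_of_pos hm]
    rw [e1, enorm_smul, e2, mul_pow]
    have hmeas : Measurable fun y => ‖φ x - φ y‖ₑ := (continuous_const.sub hcont).enorm.measurable
    calc m⁻¹ ^ 2 * ‖∫ y in Q, (φ x - φ y)‖ₑ ^ 2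
        ≤ m⁻¹ ^ 2 * (∫⁻ y in Q, ‖φ x - φ y‖ₑ) ^ 2 := by
          gcongr
          exact enorm_integral_le_lintegral_enorm _
      _ ≤ m⁻¹ ^ 2 * (m * ∫⁻ y in Q, ‖φ x - φ y‖ₑ ^ 2) := by
          gcongr
          refine (sq_lintegral_le _ hmeas.aemeasurable).trans_eq ?_
          rw [Measure.restrict_apply_univ, hvol]
      _ = m⁻¹ * ∫⁻ y in Q, ‖φ x - φ y‖ₑ ^ 2 := by
          rw [← mul_assoc, pow_two, mul_assoc m⁻¹ m⁻¹ m, ENNReal.inv_mul_cancel hm0 hmt, mul_one]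
      -- Replacing the cell by a ball centred at `x` makes the domain of `v = y - x` independent of
      -- `x`; the integrals can then be exchanged and the translation estimate used for each `v`.
      _ ≤ m⁻¹ * ∫⁻ y in Metric.ball x (2 * h), ‖φ x - φ y‖ₑ ^ 2 := by
          gcongr
          intro y hy
          exact dist_lt_of_mem_gridCell hh hxQ hy
      _ = _ := by
          congr 1
          rw [← lintegral_indicator measurableSet_ball, ← lintegral_indicator measurableSet_ball,
            ← lintegral_add_left_eq_self _ x]
          refine lintegral_congr fun v => ?_
          by_cases hv : v ∈ Metric.ball (0 : Plane) (2 * h)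
          · have hv' : x + v ∈ Metric.ball x (2 * h) := by simpa using hv
            rw [indicator_of_mem hv, indicator_of_mem hv', ← enorm_neg, neg_sub]
          · have hv' : x + v ∉ Metric.ball x (2 * h) := by simpa using hv
            rw [indicator_of_notMem hv, indicator_of_notMem hv']
  have hcu : Continuous fun p : Plane × Plane => ‖φ (p.1 + p.2) - φ p.1‖ₑ := by fun_prop
  calc _ ≤ ∫⁻ x, m⁻¹ * ∫⁻ v in Metric.ball (0 : Plane) (2 * h), ‖φ (x + v) - φ x‖ₑ ^ 2 :=
        lintegral_mono h1
    _ = m⁻¹ * ∫⁻ x, ∫⁻ v in Metric.ball (0 : Plane) (2 * h), ‖φ (x + v) - φ x‖ₑ ^ 2 := by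
        rw [lintegral_const_mul' _ _ (ENNReal.inv_ne_top.2 hm0)]
    _ = m⁻¹ * ∫⁻ v in Metric.ball (0 : Plane) (2 * h), ∫⁻ x, ‖φ (x + v) - φ x‖ₑ ^ 2 := by
        congr 1
        exact lintegral_lintegral_swap (hcu.measurable.pow_const 2).aemeasurable
    _ ≤ m⁻¹ * ∫⁻ v in Metric.ball (0 : Plane) (2 * h),
          ENNReal.ofReal (2 * h) ^ 2 * ∫⁻ x, ‖fderiv ℝ φ x‖ₑ ^ 2 := by
        gcongr m⁻¹ * ?_
        refine setLIntegral_mono' measurableSet_ball fun v hv => ?_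
        refine (lintegral_sq_translate_sub_le hφ v).trans ?_
        gcongr
        rw [← ofReal_norm]
        exact ENNReal.ofReal_le_ofReal (mem_ball_zero_iff.1 hv).le
    -- The constant is `h⁻²` times the area `4πh²` of the ball times the squared length `4h²`.
    _ = _ := by
        rw [setLIntegral_const, EuclideanSpace.volume_ball_fin_two, hmdef,
          ← ENNReal.ofReal_inv_of_pos hm, ← ENNReal.ofReal_pow (by positivity)]
        rw [← ENNReal.ofReal_mul (by positivity), mul_assoc (ENNReal.ofReal _),
          mul_comm (∫⁻ x, ‖fderiv ℝ φ x‖ₑ ^ 2), ← mul_assoc, ← mul_assoc,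
          ← ENNReal.ofReal_mul (by positivity), ← ENNReal.ofReal_mul (by positivity)]
        congr 2
        field_simp
        ring

theorem L2.enorm_sq {Ω : Set Plane} (u : L2 Ω) : ‖u‖ₑ ^ 2 = ∫⁻ x in Ω, ‖u x‖ₑ ^ 2 := by
  rw [Lp.enorm_def, eLpNorm_eq_lintegral_rpow_enorm_toReal (by norm_num) (by norm_num)]
  simp only [ENNReal.toReal_ofNat, ENNReal.rpow_ofNat]
  rw [← ENNReal.rpow_natCast, ← ENNReal.rpow_mul]
  norm_num

theorem measure_gridCell_ne_top {h : ℝ} (hh : 0 < h) (Ω : Set Plane) (k : Fin 2 → ℤ) :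
    (volume.restrict Ω) (gridCell h k) ≠ ⊤ := by
  refine ne_top_of_le_ne_top ?_ (Measure.restrict_apply_le _ _)
  rw [volume_gridCell hh]
  exact ENNReal.ofReal_ne_top

/-- The indicator function of a cell, in `L²(Ω)`. -/
noncomputable def cellIndicator (Ω : Set Plane) {h : ℝ} (hh : 0 < h) (k : Fin 2 → ℤ) : L2 Ω :=
  indicatorConstLp 2 (measurableSet_gridCell hh k) (measure_gridCell_ne_top hh Ω k) (1 : ℂ)

/-- Averages over finitely many cells of a grid, a finite rank operator. -/
noncomputable def gridAverage (Ω : Set Plane) {h : ℝ} (hh : 0 < h) (F : Finset (Fin 2 → ℤ)) :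
    L2 Ω →L[ℂ] L2 Ω :=
  ∑ k ∈ F, (((h ^ 2)⁻¹ : ℝ) : ℂ) •
    (innerSL ℂ (cellIndicator Ω hh k)).smulRight (cellIndicator Ω hh k)

theorem isCompactOperator_gridAverage (Ω : Set Plane) {h : ℝ} (hh : 0 < h)
    (F : Finset (Fin 2 → ℤ)) : IsCompactOperator (gridAverage Ω hh F) := by
  have h1 : gridAverage Ω hh F ∈ compactOperator (RingHom.id ℂ) (L2 Ω) (L2 Ω) := by
    refine Submodule.sum_mem _ fun k _ => Submodule.smul_mem _ _ ?_
    have h2 : IsCompactOperator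
        (((1 : ℂ →L[ℂ] ℂ).smulRight (cellIndicator Ω hh k)) : ℂ → L2 Ω) :=
      isCompactOperator_of_locallyCompactSpace_rng _
    exact h2.comp_clm (innerSL ℂ (cellIndicator Ω hh k))
  exact h1

theorem gridAverage_coeFn (Ω : Set Plane) {h : ℝ} (hh : 0 < h) (F : Finset (Fin 2 → ℤ)) (u : L2 Ω) :
    ∀ᵐ x ∂(volume.restrict Ω), gridIndex h x ∈ F →
      (gridAverage Ω hh F u) x
        = ((h ^ 2)⁻¹ : ℝ) • ∫ y in gridCell h (gridIndex h x), u y ∂(volume.restrict Ω) := by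
  have h1 : gridAverage Ω hh F u = ∑ k ∈ F, ((((h ^ 2)⁻¹ : ℝ) : ℂ) *
      ∫ y in gridCell h k, u y ∂(volume.restrict Ω)) • cellIndicator Ω hh k := by
    rw [gridAverage, sum_apply]
    refine Finset.sum_congr rfl fun k _ => ?_
    change (((h ^ 2)⁻¹ : ℝ) : ℂ) • (inner ℂ (cellIndicator Ω hh k) u) • cellIndicator Ω hh k = _
    rw [smul_smul, cellIndicator, L2.inner_indicatorConstLp_one]
  rw [h1]
  have h2 : ∀ᵐ x ∂(volume.restrict Ω), ∀ k ∈ F, (cellIndicator Ω hh k) x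
      = (gridCell h k).indicator (fun _ => (1 : ℂ)) x :=
    (Finset.eventually_all F).2 fun k _ => indicatorConstLp_coeFn
  have h3 : ∀ᵐ x ∂(volume.restrict Ω), ∀ k ∈ F, ((((((h ^ 2)⁻¹ : ℝ) : ℂ) *
      ∫ y in gridCell h k, u y ∂(volume.restrict Ω)) • cellIndicator Ω hh k : L2 Ω) : Plane → ℂ) x
      = ((((h ^ 2)⁻¹ : ℝ) : ℂ) * ∫ y in gridCell h k, u y ∂(volume.restrict Ω)) •
        (cellIndicator Ω hh k) x :=
    (Finset.eventually_all F).2 fun k _ => Lp.coeFn_smul _ _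
  filter_upwards [h2, h3, Lp.coeFn_fun_finsetSum F (fun k => ((((h ^ 2)⁻¹ : ℝ) : ℂ) *
      ∫ y in gridCell h k, u y ∂(volume.restrict Ω)) • cellIndicator Ω hh k)] with x hx2 hx3 hx4 hxF
  rw [hx4, Finset.sum_eq_single_of_mem _ hxF]
  · rw [hx3 _ hxF, hx2 _ hxF, indicator_of_mem (mem_gridCell_iff.2 rfl), smul_eq_mul, mul_one,
      Complex.real_smul]
  · intro k hk hkx
    rw [hx3 k hk, hx2 k hk, indicator_of_notMem (fun hx => hkx (mem_gridCell_iff.1 hx).symm),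
      smul_zero]

theorem exists_finset_gridIndex {Ω : Set Plane} (hb : Bornology.IsBounded Ω) (h : ℝ) :
    ∃ F : Finset (Fin 2 → ℤ), ∀ x ∈ Ω, gridIndex h x ∈ F := by
  obtain ⟨M, hM⟩ := hb.exists_norm_le
  refine ⟨Fintype.piFinset fun _ => Finset.Icc (-⌈M * |h⁻¹|⌉ - 1) ⌈M * |h⁻¹|⌉, fun x hx => ?_⟩
  rw [Fintype.mem_piFinset]
  intro i
  have h1 : |x i / h| ≤ M * |h⁻¹| := by
    rw [div_eq_mul_inv, abs_mul]
    gcongr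
    exact (PiLp.norm_apply_le x i).trans (hM x hx)
  have h2 := (abs_le.1 h1)
  have h3 := Int.le_ceil (M * |h⁻¹|)
  rw [Finset.mem_Icc]
  constructor
  · rw [gridIndex, Int.le_floor]
    push_cast
    linarith
  · have h4 : (⌊x i / h⌋ : ℝ) ≤ ⌈M * |h⁻¹|⌉ := (Int.floor_le _).trans (h2.2.trans h3)
    exact_mod_cast h4

/-- The embedding `(u, ∇u) ↦ u`. -/
noncomputable def embL2 (Ω : Set Plane) : H10Space Ω →L[ℂ] L2 Ω :=
  (PiLp.proj (𝕜 := ℂ) 2 (fun _ : Option (Fin 2) => L2 Ω) none) ∘L (H10Space Ω).subtypeL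

theorem lintegral_enorm_sq_fderiv_le {Ω : Set Plane} {φ : Plane → ℂ} (hφ : IsTest Ω φ) :
    ∫⁻ x, ‖fderiv ℝ φ x‖ₑ ^ 2 ≤ ‖hφ.isLip.toSobolev‖ₑ ^ 2 := by
  have h0 : ∀ i, ∫⁻ x, ‖pderiv i φ x‖ₑ ^ 2 = ‖hφ.isLip.toSobolev (some i)‖ₑ ^ 2 := by
    intro i
    rw [L2.enorm_sq]
    have h1 : ∫⁻ x in Ω, ‖hφ.isLip.toSobolev (some i) x‖ₑ ^ 2 = ∫⁻ x in Ω, ‖pderiv i φ x‖ₑ ^ 2 := by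
      refine lintegral_congr_ae ?_
      filter_upwards [(hφ.isLip.memLp_pderiv i).coeFn_toLp] with x hx
      rw [IsLip.toSobolev_some, hx]
    rw [h1, setLIntegral_eq_of_support_subset]
    intro x hx
    refine hφ.tsupport_subset (support_pderiv_subset i φ ?_)
    intro h2
    exact hx (by simp [h2])
  calc ∫⁻ x, ‖fderiv ℝ φ x‖ₑ ^ 2 ≤ ∫⁻ x, ∑ i, ‖pderiv i φ x‖ₑ ^ 2 := by
        refine lintegral_mono fun x => ?_
        have h1 := norm_sq_fderiv_le (φ := φ) x
        simp only [← ofReal_norm, ← ENNReal.ofReal_pow (norm_nonneg _)]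
        rw [← ENNReal.ofReal_sum_of_nonneg (fun i _ => by positivity)]
        exact ENNReal.ofReal_le_ofReal h1
    _ = ∑ i, ∫⁻ x, ‖pderiv i φ x‖ₑ ^ 2 :=
        lintegral_finsetSum _ fun i _ => ((measurable_pderiv i φ).enorm.pow_const 2)
    _ = ∑ i, ‖hφ.isLip.toSobolev (some i)‖ₑ ^ 2 := by simp only [h0]
    _ ≤ _ := by
        simp only [← ofReal_norm, ← ENNReal.ofReal_pow (norm_nonneg _)]
        rw [← ENNReal.ofReal_sum_of_nonneg (fun i _ => by positivity)]
        refine ENNReal.ofReal_le_ofReal ?_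
        rw [PiLp.norm_sq_eq_of_L2, Fintype.sum_option]
        exact le_add_of_nonneg_left (by positivity)

/-- The constant is the square root of `16πh²`. Test functions extend by zero, so the cells crossing
`∂Ω` need no special treatment and no regularity of `Ω` enters; the general case follows by density.
-/
theorem norm_sub_gridAverage_le {Ω : Set Plane} (hΩ : MeasurableSet Ω) {h : ℝ} (hh : 0 < h)
    {F : Finset (Fin 2 → ℤ)} (hF : ∀ x ∈ Ω, gridIndex h x ∈ F) (e : H10Space Ω) :
    ‖embL2 Ω e - gridAverage Ω hh F (embL2 Ω e)‖ ≤ (4 * Real.sqrt Real.pi * h) * ‖e‖ := by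
  obtain ⟨φ, hφ, hlim⟩ := H10Space.exists_seq_test e.2
  have key : ∀ (φ : Plane → ℂ) (hφ : IsTest Ω φ),
      ‖hφ.isLip.toSobolev none - gridAverage Ω hh F (hφ.isLip.toSobolev none)‖
        ≤ (4 * Real.sqrt Real.pi * h) * ‖hφ.isLip.toSobolev‖ := by
    intro φ hφ
    set u : L2 Ω := hφ.isLip.toSobolev none with hu
    have hu' : u =ᵐ[volume.restrict Ω] φ := hφ.isLip.memLp.coeFn_toLp
    have h1 : ‖u - gridAverage Ω hh F u‖ₑ ^ 2
        ≤ ENNReal.ofReal (16 * Real.pi * h ^ 2) * ‖hφ.isLip.toSobolev‖ₑ ^ 2 := by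
      calc ‖u - gridAverage Ω hh F u‖ₑ ^ 2
          = ∫⁻ x in Ω, ‖(u - gridAverage Ω hh F u) x‖ₑ ^ 2 := L2.enorm_sq _
        _ = ∫⁻ x in Ω, ‖φ x - ((h ^ 2)⁻¹ : ℝ) • ∫ y in gridCell h (gridIndex h x), φ y‖ₑ ^ 2 := by
            refine lintegral_congr_ae ?_
            filter_upwards [Lp.coeFn_sub u (gridAverage Ω hh F u), hu', gridAverage_coeFn Ω hh F u,
              ae_restrict_mem hΩ] with x hx1 hx2 hx3 hx4
            rw [hx1, Pi.sub_apply, hx2, hx3 (hF x hx4)]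
            have e1 : ∫ y in gridCell h (gridIndex h x), u y ∂(volume.restrict Ω)
                = ∫ y in gridCell h (gridIndex h x), φ y ∂(volume.restrict Ω) :=
              integral_congr_ae (ae_restrict_of_ae hu')
            have e2 : ∫ y in gridCell h (gridIndex h x), φ y ∂(volume.restrict Ω)
                = ∫ y in gridCell h (gridIndex h x), φ y := by
              rw [Measure.restrict_restrict (measurableSet_gridCell hh _), inter_comm,
                ← Measure.restrict_restrict hΩ]
              exact setIntegral_eq_integral_of_forall_compl_eq_zero fun y hy =>
                image_eq_zero_of_notMem_tsupport fun hy' => hy (hφ.tsupport_subset hy')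
            rw [e1, e2]
        _ ≤ ∫⁻ x, ‖φ x - ((h ^ 2)⁻¹ : ℝ) • ∫ y in gridCell h (gridIndex h x), φ y‖ₑ ^ 2 :=
            setLIntegral_le_lintegral _ _
        _ ≤ _ := lintegral_sq_sub_average_le hφ.contDiff hφ.hasCompactSupport hh
        _ ≤ _ := by
            gcongr
            exact lintegral_enorm_sq_fderiv_le hφ
    rw [← ofReal_norm, ← ofReal_norm, ← ENNReal.ofReal_pow (norm_nonneg _),
      ← ENNReal.ofReal_pow (norm_nonneg _), ← ENNReal.ofReal_mul (by positivity),
      ENNReal.ofReal_le_ofReal_iff (by positivity)] at h1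
    refine le_of_sq_le_sq ?_ (by positivity)
    rw [mul_pow, mul_pow, mul_pow, Real.sq_sqrt Real.pi_pos.le]
    linarith
  have hlim0 : Tendsto (fun n => (hφ n).isLip.toSobolev none) atTop (𝓝 (embL2 Ω e)) :=
    SobolevPair.tendsto_iff.1 hlim none
  refine le_of_tendsto_of_tendsto' (f := fun n => ‖(hφ n).isLip.toSobolev none
    - gridAverage Ω hh F ((hφ n).isLip.toSobolev none)‖) ?_
    (hlim.norm.const_mul (4 * Real.sqrt Real.pi * h)) (fun n => key _ (hφ n))
  exact (hlim0.sub (((gridAverage Ω hh F).continuous.tendsto _).comp hlim0)).norm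

/-- **Rellich's theorem**. -/
theorem isCompactOperator_embL2 {Ω : Set Plane} (hΩ : MeasurableSet Ω)
    (hb : Bornology.IsBounded Ω) : IsCompactOperator (embL2 Ω) := by
  have hpos : ∀ n : ℕ, 0 < 1 / ((n : ℝ) + 1) := fun n => by positivity
  choose F hF using fun n : ℕ => exists_finset_gridIndex hb (1 / ((n : ℝ) + 1))
  refine isCompactOperator_of_tendsto (l := atTop)
    (F := fun n => gridAverage Ω (hpos n) (F n) ∘L embL2 Ω) ?_
    (Eventually.of_forall fun n => (isCompactOperator_gridAverage Ω (hpos n) (F n)).comp_clm _)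
  -- The embedding is the limit in operator norm of the cell averages, which are compact, as the
  -- mesh size tends to zero.
  refine (tendsto_iff_norm_sub_tendsto_zero (E := H10Space Ω →L[ℂ] L2 Ω)).2 ?_
  have h1 := (tendsto_one_div_add_atTop_nhds_zero_nat (𝕜 := ℝ)).const_mul (4 * Real.sqrt Real.pi)
  rw [mul_zero] at h1
  refine squeeze_zero (fun n => ContinuousLinearMap.opNorm_nonneg _) (fun n => ?_) h1
  refine ContinuousLinearMap.opNorm_le_bound _ (by positivity) fun e => ?_
  have h2 := norm_sub_gridAverage_le hΩ (hpos n) (hF n) e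
  rw [← norm_neg, neg_sub] at h2
  exact h2

/-! ### The sesquilinear form -/

theorem memLp_real_mul {Ω : Set Plane} {a : Plane → ℝ} (ha : Measurable a)
    (hb : ∃ C : ℝ, ∀ x, |a x| ≤ C) {f : Plane → ℂ} (hf : MemLp f 2 (volume.restrict Ω)) :
    MemLp (fun x => (a x : ℂ) * f x) 2 (volume.restrict Ω) := by
  obtain ⟨C, hC⟩ := hb
  refine hf.of_le_mul (c := C)
    ((Complex.measurable_ofReal.comp ha).aestronglyMeasurable.mul hf.aestronglyMeasurable)
    (ae_of_all _ fun x => ?_)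
  rw [norm_mul, Complex.norm_real]
  exact mul_le_mul_of_nonneg_right (hC x) (norm_nonneg _)

/-- Multiplication by a bounded real function. -/
noncomputable def mulL2 (Ω : Set Plane) {a : Plane → ℝ} (ha : Measurable a)
    (hb : ∃ C : ℝ, ∀ x, |a x| ≤ C) : L2 Ω →L[ℂ] L2 Ω :=
  LinearMap.mkContinuousOfExistsBound
    { toFun := fun u => (memLp_real_mul ha hb (Lp.memLp u)).toLp _
      map_add' := fun u v => by
        rw [← MemLp.toLp_add]
        refine MemLp.toLp_congr _ _ ?_
        filter_upwards [Lp.coeFn_add u v] with x hx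
        simp only [hx, Pi.add_apply, mul_add]
      map_smul' := fun c u => by
        rw [RingHom.id_apply, ← MemLp.toLp_const_smul]
        refine MemLp.toLp_congr _ _ ?_
        filter_upwards [Lp.coeFn_smul c u] with x hx
        simp only [hx, Pi.smul_apply, smul_eq_mul]
        ring } (by
    obtain ⟨C, hC⟩ := hb
    refine ⟨C, fun u => ?_⟩
    refine Lp.norm_le_mul_norm_of_ae_le_mul ?_
    filter_upwards [(memLp_real_mul ha ⟨C, hC⟩ (Lp.memLp u)).coeFn_toLp] with x hx
    simp only [LinearMap.coe_mk, AddHom.coe_mk, hx, norm_mul, Complex.norm_real]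
    exact mul_le_mul_of_nonneg_right (hC x) (norm_nonneg _))

section MulL2

variable {Ω : Set Plane} {a : Plane → ℝ} (ha : Measurable a) (hb : ∃ C : ℝ, ∀ x, |a x| ≤ C)

theorem mulL2_coeFn (u : L2 Ω) :
    mulL2 Ω ha hb u =ᵐ[volume.restrict Ω] fun x => (a x : ℂ) * u x :=
  (memLp_real_mul ha hb (Lp.memLp u)).coeFn_toLp

theorem norm_mulL2_le {C : ℝ} (hC : ∀ x, |a x| ≤ C) (u : L2 Ω) :
    ‖mulL2 Ω ha hb u‖ ≤ C * ‖u‖ := by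
  refine Lp.norm_le_mul_norm_of_ae_le_mul ?_
  filter_upwards [mulL2_coeFn ha hb u] with x hx
  rw [hx, norm_mul, Complex.norm_real]
  exact mul_le_mul_of_nonneg_right (hC x) (norm_nonneg _)

theorem inner_mulL2_left (u v : L2 Ω) :
    inner ℂ (mulL2 Ω ha hb u) v = inner ℂ u (mulL2 Ω ha hb v) := by
  rw [L2.inner_def, L2.inner_def]
  refine integral_congr_ae ?_
  filter_upwards [mulL2_coeFn ha hb u, mulL2_coeFn ha hb v] with x hx hy
  rw [hx, hy, RCLike.inner_apply, RCLike.inner_apply, map_mul, Complex.conj_ofReal]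
  ring

theorem mulL2_comm {a' : Plane → ℝ} (ha' : Measurable a') (hb' : ∃ C : ℝ, ∀ x, |a' x| ≤ C)
    (u : L2 Ω) :
    mulL2 Ω ha hb (mulL2 Ω ha' hb' u) = mulL2 Ω ha' hb' (mulL2 Ω ha hb u) := by
  refine Lp.ext ?_
  filter_upwards [mulL2_coeFn ha hb (mulL2 Ω ha' hb' u), mulL2_coeFn ha' hb' (mulL2 Ω ha hb u),
    mulL2_coeFn ha' hb' u, mulL2_coeFn ha hb u] with x h1 h2 h3 h4
  rw [h1, h2, h3, h4]
  ring

end MulL2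

/-- A shortcut instance, for the inner product of `H¹₀(Ω)` as a subspace of a Hilbert space. -/
noncomputable instance (Ω : Set Plane) : Inner ℂ (H10Space Ω) := InnerProductSpace.toInner

/-- The partial derivative `(u, ∇u) ↦ ∂ᵢ u`. -/
noncomputable def gradL2 (Ω : Set Plane) (i : Fin 2) : H10Space Ω →L[ℂ] L2 Ω :=
  (PiLp.proj (𝕜 := ℂ) 2 (fun _ : Option (Fin 2) => L2 Ω) (some i)) ∘L (H10Space Ω).subtypeL

/-- The operator associated with the form `(u, v) ↦ ∫ σ ∇u · ∇v̄`. -/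
noncomputable def formOp (Ω : Set Plane) {σ : Plane → ℝ} (hσ : Measurable σ)
    (hb : ∃ C : ℝ, ∀ x, |σ x| ≤ C) : H10Space Ω →L[ℂ] H10Space Ω :=
  ∑ i, (gradL2 Ω i).adjoint ∘L mulL2 Ω hσ hb ∘L gradL2 Ω i

section FormOp

variable {Ω : Set Plane} {σ : Plane → ℝ} (hσ : Measurable σ) (hb : ∃ C : ℝ, ∀ x, |σ x| ≤ C)

theorem inner_formOp (u v : H10Space Ω) :
    inner ℂ v (formOp Ω hσ hb u)
      = ∑ i, inner ℂ (gradL2 Ω i v) (mulL2 Ω hσ hb (gradL2 Ω i u)) := by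
  rw [formOp, sum_apply, inner_sum]
  refine Finset.sum_congr rfl fun i _ => ?_
  rw [ContinuousLinearMap.comp_apply, ContinuousLinearMap.adjoint_inner_right]
  rfl

theorem isSymmetric_formOp : (formOp Ω hσ hb : H10Space Ω →ₗ[ℂ] H10Space Ω).IsSymmetric := by
  intro u v
  rw [ContinuousLinearMap.coe_coe, ← inner_conj_symm, inner_formOp, inner_formOp, map_sum]
  refine Finset.sum_congr rfl fun i _ => ?_
  rw [inner_conj_symm, inner_mulL2_left]

theorem norm_sq_H10Space (e : H10Space Ω) :
    ‖e‖ ^ 2 = ‖embL2 Ω e‖ ^ 2 + ∑ i, ‖gradL2 Ω i e‖ ^ 2 := by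
  rw [Submodule.coe_norm, PiLp.norm_sq_eq_of_L2, Fintype.sum_option]
  rfl

theorem norm_embL2_le (e : H10Space Ω) : ‖embL2 Ω e‖ ≤ ‖e‖ :=
  PiLp.norm_apply_le (e : SobolevPair Ω) none

theorem norm_gradL2_le (i : Fin 2) (e : H10Space Ω) : ‖gradL2 Ω i e‖ ≤ ‖e‖ :=
  PiLp.norm_apply_le (e : SobolevPair Ω) (some i)

end FormOp

/-- The element `(w, ∇w)` of `H¹₀(Ω)`. -/
noncomputable def IsLip.toH10 {Ω : Set Plane} (hΩ : IsOpen Ω) {w : Plane → ℂ} (h : IsLip Ω w) :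
    H10Space Ω := ⟨h.toSobolev, h.toSobolev_mem hΩ⟩

@[simp] theorem IsLip.embL2_toH10 {Ω : Set Plane} (hΩ : IsOpen Ω) {w : Plane → ℂ} (h : IsLip Ω w) :
    embL2 Ω (h.toH10 hΩ) = h.memLp.toLp w := rfl

@[simp] theorem IsLip.gradL2_toH10 {Ω : Set Plane} (hΩ : IsOpen Ω) {w : Plane → ℂ} (h : IsLip Ω w)
    (i : Fin 2) : gradL2 Ω i (h.toH10 hΩ) = (h.memLp_pderiv i).toLp (pderiv i w) := rfl

theorem H10Space.exists_seq_test' {Ω : Set Plane} (hΩ : IsOpen Ω) (e : H10Space Ω) :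
    ∃ (φ : ℕ → Plane → ℂ) (hφ : ∀ n, IsTest Ω (φ n)),
      Tendsto (fun n => (hφ n).isLip.toH10 hΩ) atTop (𝓝 e) := by
  obtain ⟨φ, hφ, h⟩ := H10Space.exists_seq_test e.2
  exact ⟨φ, hφ, tendsto_subtype_rng.2 h⟩

/-! ### Localization of the weak T-coercivity -/

/-- Weak T-coercivity near `p`. -/
def LocallyTCoercive {Ω : Set Plane} (hΩ : IsOpen Ω) {σ : Plane → ℝ} (hσ : Measurable σ)
    (hb : ∃ C : ℝ, ∀ x, |σ x| ≤ C) (p : Plane) : Prop :=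
  ∃ ρ > 0, ∃ M ≥ 0, ∀ (w : Plane → ℂ) (hw : IsTest Ω w), tsupport w ⊆ Metric.ball p ρ →
    ∃ (v : Plane → ℂ) (hv : IsLip Ω v),
      ‖embL2 Ω (hv.toH10 hΩ)‖ ≤ M * ‖embL2 Ω (hw.isLip.toH10 hΩ)‖ ∧
      (∀ i, ‖gradL2 Ω i (hv.toH10 hΩ)‖ ≤ M * ∑ j, ‖gradL2 Ω j (hw.isLip.toH10 hΩ)‖) ∧
      ∑ i, ‖gradL2 Ω i (hw.isLip.toH10 hΩ)‖ ^ 2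
        ≤ (inner ℂ (hv.toH10 hΩ) (formOp Ω hσ hb (hw.isLip.toH10 hΩ))).re

/-- Weak T-coercivity on the set `T`. -/
def TCoerciveOn {Ω : Set Plane} (hΩ : IsOpen Ω) {σ : Plane → ℝ} (hσ : Measurable σ)
    (hb : ∃ C : ℝ, ∀ x, |σ x| ≤ C) (T : Set Plane) : Prop :=
  ∃ M ≥ 0, ∃ C ≥ 0, ∀ (φ : Plane → ℂ) (hφ : IsTest Ω φ), ∃ v : H10Space Ω,
    ‖v‖ ≤ M * ‖hφ.isLip.toH10 hΩ‖ ∧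
    ∫ x in T, ∑ i, ‖pderiv i φ x‖ ^ 2
      ≤ (inner ℂ v (formOp Ω hσ hb (hφ.isLip.toH10 hΩ))).re
        + C * ‖embL2 Ω (hφ.isLip.toH10 hΩ)‖ * ‖hφ.isLip.toH10 hΩ‖

/-- Here `N`, `b` and `i` stand for `‖u‖_{H¹}`, `‖B u‖` and `‖u‖_{L²}`: dividing the quadratic
inequality by `N` gives the linear a priori estimate. -/
theorem le_mul_add_of_sq_le {N b i M C : ℝ} (hM : 0 ≤ M) (hC : 0 ≤ C) (hN : 0 ≤ N) (hb : 0 ≤ b)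
    (hi : 0 ≤ i) (hiN : i ≤ N) (h : N ^ 2 ≤ i ^ 2 + (M * N * b + C * i * N)) :
    N ≤ (M + C + 1) * (b + i) := by
  rcases hN.eq_or_lt with h6 | h6
  · rw [← h6]; positivity
  refine le_of_mul_le_mul_right ?_ h6
  have a1 : 0 ≤ b * N := by positivity
  have a3 : i ^ 2 ≤ i * N := by rw [pow_two]; gcongr
  have a4 : 0 ≤ C * (b * N) := by positivity
  have a5 : 0 ≤ M * (i * N) := by positivity
  nlinarith

section TCoercive

variable {Ω : Set Plane} (hΩ : IsOpen Ω) {σ : Plane → ℝ} (hσ : Measurable σ)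
  (hb : ∃ C : ℝ, ∀ x, |σ x| ≤ C)

theorem IsTest.integrable_sum_norm_sq_pderiv {φ : Plane → ℂ} (hφ : IsTest Ω φ) :
    Integrable fun x => ∑ i, ‖pderiv i φ x‖ ^ 2 := by
  refine integrable_finsetSum _ fun i _ => ?_
  have h1 := (hφ.mono (subset_univ Ω)).memLp_pderiv i
  rw [Measure.restrict_univ] at h1
  exact (memLp_two_iff_integrable_sq_norm h1.aestronglyMeasurable).1 h1

theorem IsTest.sum_norm_sq_gradL2 {φ : Plane → ℂ} (hφ : IsTest Ω φ) :
    ∑ i, ‖gradL2 Ω i (hφ.isLip.toH10 hΩ)‖ ^ 2 = ∫ x in Ω, ∑ i, ‖pderiv i φ x‖ ^ 2 := by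
  rw [integral_finsetSum]
  · refine Finset.sum_congr rfl fun i _ => ?_
    rw [IsLip.gradL2_toH10, L2.norm_sq_toLp]
  · intro i _
    have h1 := hφ.memLp_pderiv i
    exact (memLp_two_iff_integrable_sq_norm h1.aestronglyMeasurable).1 h1

-- The companions for `S` and `T` are added, and the Dirichlet integral over the union is at most
-- the sum of the two integrals.
include hΩ in
theorem TCoerciveOn.union {S T : Set Plane} (hT : MeasurableSet T) (hS : MeasurableSet S)
    (h1 : TCoerciveOn hΩ hσ hb S) (h2 : TCoerciveOn hΩ hσ hb T) :
    TCoerciveOn hΩ hσ hb (S ∪ T) := by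
  obtain ⟨M1, hM1, C1, hC1, h1⟩ := h1
  obtain ⟨M2, hM2, C2, hC2, h2⟩ := h2
  refine ⟨M1 + M2, by positivity, C1 + C2, by positivity, fun φ hφ => ?_⟩
  obtain ⟨v1, hv1, h1⟩ := h1 φ hφ
  obtain ⟨v2, hv2, h2⟩ := h2 φ hφ
  refine ⟨v1 + v2, (norm_add_le _ _).trans (by rw [add_mul]; gcongr), ?_⟩
  have hint := hφ.integrable_sum_norm_sq_pderiv
  rw [← union_sdiff_self, setIntegral_union disjoint_sdiff_self_right (hT.diff hS)
    hint.integrableOn hint.integrableOn]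
  have h3 : ∫ x in T \ S, ∑ i, ‖pderiv i φ x‖ ^ 2 ≤ ∫ x in T, ∑ i, ‖pderiv i φ x‖ ^ 2 :=
    setIntegral_mono_set hint.integrableOn
      (ae_of_all _ fun x => Finset.sum_nonneg fun i _ => by positivity)
      (ae_of_all _ fun x hx => hx.1)
  rw [inner_add_left, Complex.add_re, add_mul, add_mul]
  linarith

/-- Testing against the companion bounds `‖∇u‖²` by `M ‖u‖ ‖B u‖` plus the lower order error. The
estimate is proved for test functions and passes to limits. -/
theorem coercive_of_TCoerciveOn {T : Set Plane} (hT : Ω ⊆ T)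
    (h : TCoerciveOn hΩ hσ hb T) :
    ∃ C : ℝ, ∀ e : H10Space Ω, ‖e‖ ≤ C * (‖formOp Ω hσ hb e‖ + ‖embL2 Ω e‖) := by
  obtain ⟨M, hM, C, hC, h⟩ := h
  refine ⟨M + C + 1, fun e => ?_⟩
  obtain ⟨φ, hφ, hlim⟩ := H10Space.exists_seq_test' hΩ e
  refine le_of_tendsto_of_tendsto' hlim.norm (((((formOp Ω hσ hb).continuous.tendsto _).comp
    hlim).norm.add (((embL2 Ω).continuous.tendsto _).comp hlim).norm).const_mul _) fun n => ?_
  simp only [Function.comp]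
  obtain ⟨v, hv, hle⟩ := h (φ n) (hφ n)
  set u := (hφ n).isLip.toH10 hΩ with hu
  have hint := (hφ n).integrable_sum_norm_sq_pderiv
  have h1 : ∑ i, ‖gradL2 Ω i u‖ ^ 2 ≤ ∫ x in T, ∑ i, ‖pderiv i (φ n) x‖ ^ 2 := by
    rw [hu, (hφ n).sum_norm_sq_gradL2 hΩ]
    exact setIntegral_mono_set hint.integrableOn
      (ae_of_all _ fun x => Finset.sum_nonneg fun i _ => by positivity)
      (ae_of_all _ fun x hx => hT hx)
  have h2 : (inner ℂ v (formOp Ω hσ hb u)).re ≤ M * ‖u‖ * ‖formOp Ω hσ hb u‖ :=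
    (Complex.re_le_norm _).trans ((norm_inner_le_norm _ _).trans (by gcongr))
  have h3 := norm_sq_H10Space u
  have h4 := norm_embL2_le u
  exact le_mul_add_of_sq_le hM hC (norm_nonneg _) (norm_nonneg _) (norm_nonneg _) h4
    (h3.trans_le (add_le_add_right (h1.trans (hle.trans (add_le_add_left h2 _))) _))

end TCoercive

/-! ### Cut-off functions and the passage from local to global. -/

section Cutoff

variable {Ω : Set Plane} (hΩ : IsOpen Ω)

/-- The partial derivative of a real function. -/
noncomputable def rpderiv (i : Fin 2) (a : Plane → ℝ) (x : Plane) : ℝ :=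
  fderiv ℝ a x (EuclideanSpace.single i (1 : ℝ))

theorem measurable_rpderiv (i : Fin 2) (a : Plane → ℝ) : Measurable (rpderiv i a) :=
  measurable_fderiv_apply_const ℝ a _

theorem pderiv_ofReal {a : Plane → ℝ} {x : Plane} (ha : DifferentiableAt ℝ a x) (i : Fin 2) :
    pderiv i (fun x => (a x : ℂ)) x = rpderiv i a x := by
  have h1 : HasFDerivAt (fun x => (a x : ℂ)) (Complex.ofRealCLM ∘L fderiv ℝ a x) x :=
    Complex.ofRealCLM.hasFDerivAt.comp x ha.hasFDerivAt
  rw [pderiv, h1.fderiv]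
  rfl

theorem exists_abs_rpderiv_le {a : Plane → ℝ} (ha : ContDiff ℝ ∞ a) (hc : HasCompactSupport a)
    (i : Fin 2) : ∃ D, ∀ x, |rpderiv i a x| ≤ D := by
  have h1 : Continuous (rpderiv i a) := (ha.continuous_fderiv (by simp)).clm_apply continuous_const
  have h2 : HasCompactSupport (rpderiv i a) := hc.fderiv_apply ℝ _
  exact h2.exists_bound_of_continuous h1

theorem isTest_ofReal {a : Plane → ℝ} (ha : ContDiff ℝ ∞ a) (hc : HasCompactSupport a) :
    IsTest univ (fun x => (a x : ℂ)) :=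
  ⟨Complex.ofRealCLM.contDiff.comp ha, hc.comp_left (g := fun r : ℝ => (r : ℂ)) Complex.ofReal_zero,
    subset_univ _⟩

theorem IsLip.ofReal_mul {a : Plane → ℝ} (ha : ContDiff ℝ ∞ a) (hc : HasCompactSupport a)
    {w : Plane → ℂ} (hw : IsLip Ω w) : IsLip Ω (fun x => (a x : ℂ) * w x) := by
  have := hw.mul (isTest_ofReal ha hc).isLip
  simpa only [mul_comm] using this

theorem IsTest.ofReal_mul {a : Plane → ℝ} (ha : ContDiff ℝ ∞ a)
    {w : Plane → ℂ} (hw : IsTest Ω w) : IsTest Ω (fun x => (a x : ℂ) * w x) :=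
  ⟨(Complex.ofRealCLM.contDiff.comp ha).mul hw.contDiff, hw.hasCompactSupport.mul_left,
    tsupport_mul_subset_right.trans hw.tsupport_subset⟩

theorem IsLip.embL2_ofReal_mul {a : Plane → ℝ} (ha : ContDiff ℝ ∞ a) (hc : HasCompactSupport a)
    (hm : Measurable a) (hb : ∃ C : ℝ, ∀ x, |a x| ≤ C) {w : Plane → ℂ} (hw : IsLip Ω w) :
    embL2 Ω ((hw.ofReal_mul ha hc).toH10 hΩ) = mulL2 Ω hm hb (embL2 Ω (hw.toH10 hΩ)) := by
  rw [IsLip.embL2_toH10, IsLip.embL2_toH10]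
  refine Lp.ext ?_
  filter_upwards [(hw.ofReal_mul ha hc).memLp.coeFn_toLp, mulL2_coeFn hm hb (hw.memLp.toLp w),
    hw.memLp.coeFn_toLp] with x h1 h2 h3
  rw [h1, h2, h3]

theorem IsLip.gradL2_ofReal_mul {a : Plane → ℝ} (ha : ContDiff ℝ ∞ a) (hc : HasCompactSupport a)
    (hm : Measurable a) (hb : ∃ C : ℝ, ∀ x, |a x| ≤ C) (i : Fin 2)
    (hb' : ∃ C : ℝ, ∀ x, |rpderiv i a x| ≤ C) {w : Plane → ℂ} (hw : IsLip Ω w) :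
    gradL2 Ω i ((hw.ofReal_mul ha hc).toH10 hΩ) = mulL2 Ω hm hb (gradL2 Ω i (hw.toH10 hΩ))
      + mulL2 Ω (measurable_rpderiv i a) hb' (embL2 Ω (hw.toH10 hΩ)) := by
  rw [IsLip.gradL2_toH10, IsLip.gradL2_toH10, IsLip.embL2_toH10]
  refine Lp.ext ?_
  filter_upwards [((hw.ofReal_mul ha hc).memLp_pderiv i).coeFn_toLp,
    mulL2_coeFn hm hb ((hw.memLp_pderiv i).toLp _), (hw.memLp_pderiv i).coeFn_toLp,
    hw.memLp.coeFn_toLp, mulL2_coeFn (measurable_rpderiv i a) hb' (hw.memLp.toLp w),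
    Lp.coeFn_add (mulL2 Ω hm hb ((hw.memLp_pderiv i).toLp _))
      (mulL2 Ω (measurable_rpderiv i a) hb' (hw.memLp.toLp w)),
    ae_restrict_of_ae hw.ae_differentiableAt] with x h1 h2 h3 h4 h5 h6 h7
  rw [h1, h6, Pi.add_apply, h2, h3, h5, h4,
    pderiv_mul ((isTest_ofReal ha hc).differentiable x) h7,
    pderiv_ofReal (ha.differentiable (by simp) x)]

theorem norm_H10Space_le (e : H10Space Ω) : ‖e‖ ≤ ‖embL2 Ω e‖ + ∑ i, ‖gradL2 Ω i e‖ := by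
  refine le_of_sq_le_sq ?_ (by positivity)
  rw [norm_sq_H10Space, Fin.sum_univ_two, Fin.sum_univ_two]
  have h0 := norm_nonneg (embL2 Ω e)
  have h1 := norm_nonneg (gradL2 Ω 0 e)
  have h2 := norm_nonneg (gradL2 Ω 1 e)
  nlinarith [mul_nonneg h0 h1, mul_nonneg h0 h2, mul_nonneg h1 h2]

/-- Localization: the commutator of the form with a cut-off function is of lower order. -/
theorem LocallyTCoercive.exists_ball {σ : Plane → ℝ} {hσ : Measurable σ}
    {hb : ∃ C : ℝ, ∀ x, |σ x| ≤ C} {p : Plane} (h : LocallyTCoercive hΩ hσ hb p) :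
    ∃ r > 0, TCoerciveOn hΩ hσ hb (Metric.ball p r) := by
  obtain ⟨ρ, hρ, M, hM, h⟩ := h
  obtain ⟨S, hS⟩ := hb
  have hb : ∃ C : ℝ, ∀ x, |σ x| ≤ C := ⟨S, hS⟩
  have hS0 : 0 ≤ S := (abs_nonneg _).trans (hS 0)
  let χ : ContDiffBump p := ⟨ρ / 3, ρ / 2, by positivity, by linarith⟩
  have ha : ContDiff ℝ ∞ χ := χ.contDiff
  have hc : HasCompactSupport χ := χ.hasCompactSupport
  have hm : Measurable χ := χ.continuous.measurable
  have hχ1 : ∀ x, |χ x| ≤ 1 := fun x => by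
    rw [abs_of_nonneg χ.nonneg]; exact χ.le_one
  have hbχ : ∃ C : ℝ, ∀ x, |χ x| ≤ C := ⟨1, hχ1⟩
  choose D' hD' using fun i => exists_abs_rpderiv_le ha hc i
  set D := max (D' 0) (D' 1) with hD
  have hDb : ∀ i x, |rpderiv i χ x| ≤ D := by
    intro i x
    refine (hD' i x).trans ?_
    fin_cases i
    · exact le_max_left _ _
    · exact le_max_right _ _
  have hD0 : 0 ≤ D := (abs_nonneg _).trans (hDb 0 0)
  have hbd : ∀ i, ∃ C : ℝ, ∀ x, |rpderiv i χ x| ≤ C := fun i => ⟨D, hDb i⟩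
  refine ⟨ρ / 3, by positivity, M + 2 * (2 * M * (1 + D) + D * M), by positivity,
    2 * (2 * M * (1 + D) * (S * D) + D * M * S), by positivity, fun φ hφ => ?_⟩
  have hw := hφ.ofReal_mul ha
  obtain ⟨v0, hv0, e1, e2, e3⟩ := h _ hw (by
    refine (tsupport_mul_subset_left).trans ?_
    have h1 : tsupport (fun x => ((χ x : ℝ) : ℂ)) ⊆ tsupport χ :=
      closure_mono fun x hx hx0 => hx (by simp [hx0])
    refine h1.trans ?_
    rw [χ.tsupport_eq]
    exact Metric.closedBall_subset_ball (by change ρ / 2 < ρ; linarith))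
  set u := hφ.isLip.toH10 hΩ with hu
  have eW : embL2 Ω (hw.isLip.toH10 hΩ) = mulL2 Ω hm hbχ (embL2 Ω u) :=
    hφ.isLip.embL2_ofReal_mul hΩ ha hc hm hbχ
  have eWi : ∀ i, gradL2 Ω i (hw.isLip.toH10 hΩ) = mulL2 Ω hm hbχ (gradL2 Ω i u)
      + mulL2 Ω (measurable_rpderiv i χ) (hbd i) (embL2 Ω u) := fun i =>
    hφ.isLip.gradL2_ofReal_mul hΩ ha hc hm hbχ i (hbd i)
  set V0 := hv0.toH10 hΩ with hV0
  -- The local companion `v0` belongs to `χ φ`. The companion of `φ` is `χ v0`: the cut-off moves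
  -- from one argument of the form to the other, at the price of commutators.
  set v := (hv0.ofReal_mul ha hc).toH10 hΩ with hv
  have eV : embL2 Ω v = mulL2 Ω hm hbχ (embL2 Ω V0) := hv0.embL2_ofReal_mul hΩ ha hc hm hbχ
  have eVi : ∀ i, gradL2 Ω i v = mulL2 Ω hm hbχ (gradL2 Ω i V0)
      + mulL2 Ω (measurable_rpderiv i χ) (hbd i) (embL2 Ω V0) := fun i =>
    hv0.gradL2_ofReal_mul hΩ ha hc hm hbχ i (hbd i)
  have nU : ‖embL2 Ω u‖ ≤ ‖u‖ := norm_embL2_le u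
  have nP : ∀ i, ‖gradL2 Ω i u‖ ≤ ‖u‖ := fun i => norm_gradL2_le i u
  -- This is why local T-coercivity asks for a bound of `v0` in `L²` by `w` in `L²` alone: an
  -- undifferentiated `v0` is then as small as an undifferentiated `u`.
  have nV0 : ‖embL2 Ω V0‖ ≤ M * ‖embL2 Ω u‖ := by
    refine e1.trans (mul_le_mul_of_nonneg_left ?_ hM)
    rw [eW]
    simpa using norm_mulL2_le hm hbχ hχ1 (embL2 Ω u)
  have nWi : ∀ i, ‖gradL2 Ω i (hw.isLip.toH10 hΩ)‖ ≤ (1 + D) * ‖u‖ := fun i => by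
    rw [eWi]
    refine (norm_add_le _ _).trans ?_
    have a1 := norm_mulL2_le hm hbχ hχ1 (gradL2 Ω i u)
    have a2 := norm_mulL2_le (measurable_rpderiv i χ) (hbd i) (hDb i) (embL2 Ω u)
    have a3 : D * ‖embL2 Ω u‖ ≤ D * ‖u‖ := mul_le_mul_of_nonneg_left nU hD0
    linarith [nP i]
  have nV0i : ∀ i, ‖gradL2 Ω i V0‖ ≤ 2 * M * (1 + D) * ‖u‖ := fun i => by
    refine (e2 i).trans ?_
    rw [Fin.sum_univ_two]
    have a1 := mul_le_mul_of_nonneg_left (add_le_add (nWi 0) (nWi 1)) hM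
    linarith
  refine ⟨v, ?_, ?_⟩
  · refine (norm_H10Space_le v).trans ?_
    have a1 : ‖embL2 Ω v‖ ≤ M * ‖u‖ := by
      rw [eV]
      refine (norm_mulL2_le hm hbχ hχ1 _).trans ?_
      rw [one_mul]
      exact nV0.trans (mul_le_mul_of_nonneg_left nU hM)
    have a2 : ∀ i, ‖gradL2 Ω i v‖ ≤ (2 * M * (1 + D) + D * M) * ‖u‖ := fun i => by
      rw [eVi]
      refine (norm_add_le _ _).trans ?_
      have b1 := norm_mulL2_le hm hbχ hχ1 (gradL2 Ω i V0)
      have b2 := norm_mulL2_le (measurable_rpderiv i χ) (hbd i) (hDb i) (embL2 Ω V0)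
      have b3 : D * ‖embL2 Ω V0‖ ≤ D * (M * ‖u‖) :=
        mul_le_mul_of_nonneg_left (nV0.trans (mul_le_mul_of_nonneg_left nU hM)) hD0
      linarith [nV0i i]
    rw [Fin.sum_univ_two]
    linarith [a2 0, a2 1]
  · have i1 : ∫ x in Metric.ball p (ρ / 3), ∑ i, ‖pderiv i φ x‖ ^ 2
        ≤ ∑ i, ‖gradL2 Ω i (hw.isLip.toH10 hΩ)‖ ^ 2 := by
      rw [hw.sum_norm_sq_gradL2 hΩ]
      have j1 : ∫ x in Ω, ∑ i, ‖pderiv i (fun x => ((χ x : ℝ) : ℂ) * φ x) x‖ ^ 2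
          = ∫ x, ∑ i, ‖pderiv i (fun x => ((χ x : ℝ) : ℂ) * φ x) x‖ ^ 2 := by
        refine setIntegral_eq_integral_of_forall_compl_eq_zero fun x hx => ?_
        refine Finset.sum_eq_zero fun i _ => ?_
        rw [pderiv_eq_zero_of_notMem_tsupport i fun hx' => hx (hw.tsupport_subset hx')]
        simp
      have j2 : ∫ x in Metric.ball p (ρ / 3), ∑ i, ‖pderiv i φ x‖ ^ 2
          = ∫ x in Metric.ball p (ρ / 3),
            ∑ i, ‖pderiv i (fun x => ((χ x : ℝ) : ℂ) * φ x) x‖ ^ 2 := by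
        refine setIntegral_congr_fun measurableSet_ball fun x hx => ?_
        refine Finset.sum_congr rfl fun i _ => ?_
        have : (fun x => ((χ x : ℝ) : ℂ) * φ x) =ᶠ[𝓝 x] φ := by
          filter_upwards [Metric.isOpen_ball.mem_nhds hx] with y hy
          rw [χ.one_of_mem_closedBall (Metric.ball_subset_closedBall hy), Complex.ofReal_one,
            one_mul]
        rw [pderiv, pderiv, this.fderiv_eq]
      rw [j1, j2]
      exact setIntegral_le_integral hw.integrable_sum_norm_sq_pderiv
        (ae_of_all _ fun x => Finset.sum_nonneg fun i _ => by positivity)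
    refine (i1.trans e3).trans ?_
    -- In each commutator the derivative of `χ` replaces a derivative of `u` or of `v0`, so that one
    -- factor is controlled by `‖u‖_{L²}`.
    have i2 : inner ℂ V0 (formOp Ω hσ hb (hw.isLip.toH10 hΩ)) = inner ℂ v (formOp Ω hσ hb u)
        + ∑ i, (inner ℂ (gradL2 Ω i V0)
            (mulL2 Ω hσ hb (mulL2 Ω (measurable_rpderiv i χ) (hbd i) (embL2 Ω u)))
          - inner ℂ (mulL2 Ω (measurable_rpderiv i χ) (hbd i) (embL2 Ω V0))
            (mulL2 Ω hσ hb (gradL2 Ω i u))) := by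
      rw [inner_formOp, inner_formOp, ← Finset.sum_add_distrib]
      refine Finset.sum_congr rfl fun i _ => ?_
      rw [eWi, eVi, map_add, inner_add_right, inner_add_left, mulL2_comm hσ hb hm hbχ,
        inner_mulL2_left hm hbχ]
      ring
    rw [i2, Complex.add_re, Complex.re_sum, add_le_add_iff_left]
    have i3 : ∀ i, (inner ℂ (gradL2 Ω i V0)
            (mulL2 Ω hσ hb (mulL2 Ω (measurable_rpderiv i χ) (hbd i) (embL2 Ω u)))
          - inner ℂ (mulL2 Ω (measurable_rpderiv i χ) (hbd i) (embL2 Ω V0))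
            (mulL2 Ω hσ hb (gradL2 Ω i u))).re
        ≤ (2 * M * (1 + D) * (S * D) + D * M * S) * ‖embL2 Ω u‖ * ‖u‖ := by
      intro i
      refine (Complex.re_le_norm _).trans ((norm_sub_le _ _).trans ?_)
      have c1 : ‖mulL2 Ω hσ hb (mulL2 Ω (measurable_rpderiv i χ) (hbd i) (embL2 Ω u))‖
          ≤ S * (D * ‖embL2 Ω u‖) :=
        (norm_mulL2_le hσ hb hS _).trans (mul_le_mul_of_nonneg_left
          (norm_mulL2_le (measurable_rpderiv i χ) (hbd i) (hDb i) _) hS0)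
      have c2 : ‖mulL2 Ω (measurable_rpderiv i χ) (hbd i) (embL2 Ω V0)‖
          ≤ D * (M * ‖embL2 Ω u‖) :=
        (norm_mulL2_le (measurable_rpderiv i χ) (hbd i) (hDb i) _).trans
          (mul_le_mul_of_nonneg_left nV0 hD0)
      have c3 : ‖mulL2 Ω hσ hb (gradL2 Ω i u)‖ ≤ S * ‖u‖ :=
        (norm_mulL2_le hσ hb hS _).trans (mul_le_mul_of_nonneg_left (nP i) hS0)
      have c4 := (norm_inner_le_norm (𝕜 := ℂ) (gradL2 Ω i V0)
        (mulL2 Ω hσ hb (mulL2 Ω (measurable_rpderiv i χ) (hbd i) (embL2 Ω u)))).trans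
        (mul_le_mul (nV0i i) c1 (norm_nonneg _) (by positivity))
      have c5 := (norm_inner_le_norm (𝕜 := ℂ)
        (mulL2 Ω (measurable_rpderiv i χ) (hbd i) (embL2 Ω V0)) (mulL2 Ω hσ hb (gradL2 Ω i u))).trans
        (mul_le_mul c2 c3 (norm_nonneg _) (by positivity))
      linarith
    refine (Finset.sum_le_sum fun i _ => i3 i).trans_eq ?_
    rw [Fin.sum_univ_two]
    ring

/-- By compactness finitely many of the good balls cover `closure Ω`, and T-coercivity passes to
finite unions. -/
theorem coercive_of_locallyTCoercive (hbdd : Bornology.IsBounded Ω) {σ : Plane → ℝ}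
    (hσ : Measurable σ) (hb : ∃ C : ℝ, ∀ x, |σ x| ≤ C)
    (h : ∀ p ∈ closure Ω, LocallyTCoercive hΩ hσ hb p) :
    ∃ C : ℝ, ∀ e : H10Space Ω, ‖e‖ ≤ C * (‖formOp Ω hσ hb e‖ + ‖embL2 Ω e‖) := by
  have hK : IsCompact (closure Ω) := hbdd.isCompact_closure
  obtain ⟨T, hT, -, hTC⟩ := hK.induction_on
    -- Passing through a measurable superset makes the property inherited by arbitrary subsets, as
    -- the compactness induction requires.
    (p := fun S => ∃ T, S ⊆ T ∧ MeasurableSet T ∧ TCoerciveOn hΩ hσ hb T)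
    ⟨∅, subset_rfl, MeasurableSet.empty, 0, le_rfl, 0, le_rfl, fun φ hφ => ⟨0, by simp, by simp⟩⟩
    (fun S T hST ⟨T', h1, h2, h3⟩ => ⟨T', hST.trans h1, h2, h3⟩)
    (fun S T ⟨S', h1, h2, h3⟩ ⟨T', k1, k2, k3⟩ =>
      ⟨S' ∪ T', union_subset_union h1 k1, h2.union k2, TCoerciveOn.union hΩ hσ hb k2 h2 h3 k3⟩)
    (fun p hp => by
      obtain ⟨r, hr, h1⟩ := (h p hp).exists_ball hΩ
      exact ⟨Metric.ball p r, mem_nhdsWithin_of_mem_nhds (Metric.ball_mem_nhds p hr),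
        Metric.ball p r, subset_rfl, measurableSet_ball, h1⟩)
  exact coercive_of_TCoerciveOn hΩ hσ hb (subset_closure.trans hT) hTC

end Cutoff

/-! ### Local T-coercivity -/

section Form

variable {Ω : Set Plane} (hΩ : IsOpen Ω) {σ : Plane → ℝ} (hσ : Measurable σ)
  (hb : ∃ C : ℝ, ∀ x, |σ x| ≤ C)

theorem inner_formOp_toH10_re {v w : Plane → ℂ} (hv : IsLip Ω v) (hw : IsLip Ω w) :
    (inner ℂ (hv.toH10 hΩ) (formOp Ω hσ hb (hw.toH10 hΩ))).re
      = ∫ x in Ω, σ x * ∑ i, (inner ℂ (pderiv i v x) (pderiv i w x)).re := by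
  have hae : ∀ i, ∀ᵐ x ∂(volume.restrict Ω),
      inner ℂ (gradL2 Ω i (hv.toH10 hΩ) x) (mulL2 Ω hσ hb (gradL2 Ω i (hw.toH10 hΩ)) x)
        = (σ x : ℂ) * inner ℂ (pderiv i v x) (pderiv i w x) := by
    intro i
    rw [IsLip.gradL2_toH10, IsLip.gradL2_toH10]
    filter_upwards [(hv.memLp_pderiv i).coeFn_toLp, (hw.memLp_pderiv i).coeFn_toLp,
      mulL2_coeFn hσ hb ((hw.memLp_pderiv i).toLp _)] with x h1 h2 h3
    rw [h1, h3, h2, RCLike.inner_apply, RCLike.inner_apply]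
    ring
  have hint : ∀ i, Integrable (fun x => (σ x : ℂ) * inner ℂ (pderiv i v x) (pderiv i w x))
      (volume.restrict Ω) := fun i => (L2.integrable_inner _ _).congr (hae i)
  rw [inner_formOp, Complex.re_sum]
  simp only [L2.inner_def]
  simp_rw [fun i => integral_congr_ae (hae i), Finset.mul_sum]
  rw [integral_finsetSum]
  · refine Finset.sum_congr rfl fun i _ => ?_
    have := (integral_re (hint i)).symm
    simp only [RCLike.re_eq_complex_re, Complex.re_ofReal_mul] at this
    exact this
  · intro i _
    have := (hint i).re
    simp only [RCLike.re_eq_complex_re, Complex.re_ofReal_mul] at this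
    exact this

include hσ hb in
theorem integrable_form {v w : Plane → ℂ} (hv : IsLip Ω v) (hw : IsLip Ω w) :
    Integrable (fun x => σ x * ∑ i, (inner ℂ (pderiv i v x) (pderiv i w x)).re)
      (volume.restrict Ω) := by
  obtain ⟨C, hC⟩ := hb
  refine Integrable.bdd_mul (c := C) (integrable_finsetSum _ fun i _ => ?_)
    hσ.aestronglyMeasurable (ae_of_all _ hC)
  have := (L2.integrable_inner (𝕜 := ℂ) ((hv.memLp_pderiv i).toLp _)
    ((hw.memLp_pderiv i).toLp _)).re
  refine this.congr ?_
  filter_upwards [(hv.memLp_pderiv i).coeFn_toLp, (hw.memLp_pderiv i).coeFn_toLp] with x h1 h2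
  rw [h1, h2]
  rfl

-- Where `σ` is the constant `a`, whatever its sign, the companion `w / a` turns the form into the
-- Dirichlet integral exactly.
include hΩ in
theorem locallyTCoercive_of_const {p : Plane} {a : ℝ} (ha : a ≠ 0) {r : ℝ} (hr : 0 < r)
    (h : ∀ x ∈ Metric.ball p r ∩ Ω, σ x = a) : LocallyTCoercive hΩ hσ hb p := by
  refine ⟨r, hr, |a|⁻¹, by positivity, fun w hw hwr => ?_⟩
  have hv : IsTest Ω ((a⁻¹ : ℂ) • w) := hw.smul _
  have hpd : ∀ i x, pderiv i ((a⁻¹ : ℂ) • w) x = (a⁻¹ : ℂ) * pderiv i w x := by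
    intro i x
    simp only [pderiv]
    rw [fderiv_const_smul (hw.differentiable x)]
    rfl
  have hgrad : ∀ i, gradL2 Ω i (hv.isLip.toH10 hΩ)
      = (a⁻¹ : ℂ) • gradL2 Ω i (hw.isLip.toH10 hΩ) := by
    intro i
    rw [IsLip.gradL2_toH10, IsLip.gradL2_toH10, ← MemLp.toLp_const_smul]
    exact MemLp.toLp_congr _ _ (ae_of_all _ fun x => hpd i x)
  have hn : ‖(a⁻¹ : ℂ)‖ = |a|⁻¹ := by rw [norm_inv, Complex.norm_real, Real.norm_eq_abs]
  refine ⟨_, hv.isLip, ?_, fun i => ?_, ?_⟩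
  · rw [← hn, ← norm_smul]
    rfl
  · rw [hgrad, norm_smul, hn]
    gcongr
    exact Finset.single_le_sum (f := fun j => ‖gradL2 Ω j (hw.isLip.toH10 hΩ)‖)
      (fun j _ => norm_nonneg _) (Finset.mem_univ i)
  · rw [inner_formOp_toH10_re, hw.sum_norm_sq_gradL2]
    refine le_of_eq (setIntegral_congr_fun hΩ.measurableSet fun x hx => ?_)
    simp only [hpd]
    by_cases hxw : x ∈ tsupport w
    · rw [h x ⟨hwr hxw, hx⟩, Finset.mul_sum]
      refine Finset.sum_congr rfl fun i _ => ?_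
      rw [← smul_eq_mul ((a : ℂ)⁻¹), inner_smul_left, map_inv₀, Complex.conj_ofReal, ← Complex.ofReal_inv,
        Complex.re_ofReal_mul, mul_inv_cancel_left₀ ha, inner_self_eq_norm_sq_to_K]
      norm_cast
    · simp [pderiv_eq_zero_of_notMem_tsupport _ hxw]

end Form

/-! ### Gradients of compositions -/

theorem sum_sq_apply_single (l : Plane →L[ℝ] ℝ) :
    ∑ i, l (EuclideanSpace.single i (1 : ℝ)) ^ 2 = ‖l‖ ^ 2 := by
  obtain ⟨u, rfl⟩ := (InnerProductSpace.toDual ℝ Plane).surjective l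
  rw [LinearIsometryEquiv.norm_map, EuclideanSpace.real_norm_sq_eq]
  simp [EuclideanSpace.inner_single_right]

/-- For a real linear form the Euclidean norm of the coefficients is the operator norm, so splitting
into real and imaginary parts yields the constant `‖T‖²` without a dimensional factor. A factor here
would exclude contrasts close to `-1`. -/
theorem sum_norm_sq_comp_le (L : Plane →L[ℝ] ℂ) (T : Plane →L[ℝ] Plane) :
    ∑ i, ‖L (T (EuclideanSpace.single i (1 : ℝ)))‖ ^ 2
      ≤ ‖T‖ ^ 2 * ∑ i, ‖L (EuclideanSpace.single i (1 : ℝ))‖ ^ 2 := by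
  have key : ∀ M : Plane →L[ℝ] ℂ, ∑ i, ‖M (EuclideanSpace.single i (1 : ℝ))‖ ^ 2
      = ‖Complex.reCLM ∘L M‖ ^ 2 + ‖Complex.imCLM ∘L M‖ ^ 2 := by
    intro M
    rw [← sum_sq_apply_single, ← sum_sq_apply_single, ← Finset.sum_add_distrib]
    refine Finset.sum_congr rfl fun i _ => ?_
    rw [← Complex.normSq_eq_norm_sq, Complex.normSq_apply]
    simp [pow_two]
  have h1 := key (L ∘L T)
  simp only [ContinuousLinearMap.comp_apply] at h1
  rw [h1, key L, mul_add, ← mul_pow, ← mul_pow, ← ContinuousLinearMap.comp_assoc,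
    ← ContinuousLinearMap.comp_assoc, mul_comm ‖T‖, mul_comm ‖T‖]
  gcongr <;> exact ContinuousLinearMap.opNorm_comp_le _ _

theorem sum_norm_sq_pderiv_comp_le {w : Plane → ℂ} (hw : Differentiable ℝ w) {R : Plane → Plane}
    {K : NNReal} (hR : LipschitzWith K R) {x : Plane} (hx : DifferentiableAt ℝ R x) :
    ∑ i, ‖pderiv i (w ∘ R) x‖ ^ 2 ≤ K ^ 2 * ∑ i, ‖pderiv i w (R x)‖ ^ 2 := by
  simp only [pderiv]
  rw [fderiv_comp x (hw _) hx]
  refine (sum_norm_sq_comp_le _ _).trans ?_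
  gcongr
  exact norm_fderiv_le_of_lipschitz ℝ hR

/-! ### T-coercivity by folding along an interface -/

/-- `R` is a measure preserving Lipschitz reflection across the curve `{S = 0}`, and `F` folds
`{S < 0}` onto `{0 < S}`. -/
structure IsFold (S : Plane → ℝ) (R F : Plane → Plane) (K : NNReal) : Prop where
  continuous : Continuous S
  lipschitz : LipschitzWith K R
  involutive : Function.Involutive R
  apply_reflection : ∀ x, S (R x) = -S x
  measurePreserving : MeasurePreserving R volume volume
  lipschitz_fold : ∃ C, LipschitzWith C F
  fold_of_neg : ∀ x, S x < 0 → F x = R x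
  fold_of_nonneg : ∀ x, 0 ≤ S x → F x = x
  null : volume {x | S x = 0} = 0

/-- Here `η` is the weight in Young's inequality, taken between `|b| k / |a|` and `1`, and `t` is a
multiplier with the sign of `a`, large enough that both energy coefficients are at least `1`. In the
application `k = K²`. -/
theorem exists_fold_parameters {a b k : ℝ} (hab : a * b < 0) (hk : 0 ≤ k) (h : |b| * k < |a|) :
    ∃ t η : ℝ, 0 < η ∧ 0 ≤ -(t * b) ∧ 1 ≤ t * a - -(t * b) * k / η ∧ 1 ≤ -(t * b) * (1 - η) := by
  wlog ha : 0 < a generalizing a b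
  · have hb : a < 0 ∨ a = 0 := lt_or_eq_of_le (not_lt.1 ha)
    rcases hb with hb | hb
    · obtain ⟨t, η, h1, h2, h3, h4⟩ := this (a := -a) (b := -b) (by linarith) (by simpa using h)
        (by linarith)
      exact ⟨-t, η, h1, h2.trans_eq (by ring), h3.trans_eq (by ring), h4.trans_eq (by ring)⟩
    · simp [hb] at hab
  have hb : b < 0 := by
    by_contra hb
    nlinarith [not_lt.1 hb]
  rw [abs_of_pos ha, abs_of_neg hb] at h
  obtain ⟨η, h1, h2⟩ := exists_between ((div_lt_one ha).2 h)
  have hη : 0 < η := lt_of_le_of_lt (div_nonneg (mul_nonneg (by linarith) hk) ha.le) h1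
  have hc : 0 < a - -b * k / η := by
    rw [div_lt_iff₀ ha] at h1
    rw [sub_pos, div_lt_iff₀ hη]
    linarith
  have hd : 0 < -b * (1 - η) := mul_pos (by linarith) (by linarith)
  -- Both coefficients are positive, and the sum of their inverses is a multiplier which brings each
  -- of them to at least `1`.
  refine ⟨(a - -b * k / η)⁻¹ + (-b * (1 - η))⁻¹, η, hη, ?_, ?_, ?_⟩
  · rw [← mul_neg]
    exact mul_nonneg (by positivity) (by linarith)
  · have h5 : ((a - -b * k / η)⁻¹ + (-b * (1 - η))⁻¹) * (a - -b * k / η) ≥ 1 := by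
      rw [add_mul, inv_mul_cancel₀ hc.ne']
      exact le_add_of_nonneg_right (by positivity)
    refine h5.trans_eq ?_
    ring
  · have h5 : ((a - -b * k / η)⁻¹ + (-b * (1 - η))⁻¹) * (-b * (1 - η)) ≥ 1 := by
      rw [add_mul, inv_mul_cancel₀ hd.ne']
      exact le_add_of_nonneg_left (by positivity)
    refine h5.trans_eq ?_
    ring

theorem re_inner_two_mul_sub_le {η : ℝ} (hη : 0 < η) (A W : ℂ) :
    (inner ℂ (2 * A - W) W).re ≤ η⁻¹ * ‖A‖ ^ 2 + (η - 1) * ‖W‖ ^ 2 := by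
  have h1 : (inner ℂ (2 * A - W) W).re = 2 * (inner ℂ A W).re - ‖W‖ ^ 2 := by
    rw [inner_sub_left, two_mul, inner_add_left, inner_self_eq_norm_sq_to_K, Complex.sub_re,
      Complex.add_re, two_mul]
    norm_cast
  have h2 : (inner ℂ A W).re ≤ ‖A‖ * ‖W‖ := (Complex.re_le_norm _).trans (norm_inner_le_norm _ _)
  have h3 : 2 * (‖A‖ * ‖W‖) ≤ η⁻¹ * ‖A‖ ^ 2 + η * ‖W‖ ^ 2 := by
    have h4 : 0 ≤ η⁻¹ * (‖A‖ - η * ‖W‖) ^ 2 := by positivity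
    have h5 : η⁻¹ * (‖A‖ - η * ‖W‖) ^ 2
        = η⁻¹ * ‖A‖ ^ 2 + η * ‖W‖ ^ 2 - 2 * (‖A‖ * ‖W‖) := by
      field_simp
      ring
    linarith
  linarith

theorem norm_two_mul_sub_sq_le (A W : ℂ) : ‖2 * A - W‖ ^ 2 ≤ 8 * ‖A‖ ^ 2 + 2 * ‖W‖ ^ 2 := by
  have h := norm_sub_le (2 * A) W
  rw [norm_mul, Complex.norm_ofNat] at h
  have h1 : ‖2 * A - W‖ ^ 2 ≤ (2 * ‖A‖ + ‖W‖) ^ 2 := by gcongr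
  nlinarith [sq_nonneg (2 * ‖A‖ - ‖W‖)]

namespace IsFold

variable {S : Plane → ℝ} {R F : Plane → Plane} {K : NNReal} (h : IsFold S R F K)
include h

theorem measurableEmbedding : MeasurableEmbedding R :=
  (Homeomorph.mk ⟨R, R, h.involutive, h.involutive⟩ h.lipschitz.continuous
    h.lipschitz.continuous).measurableEmbedding

theorem integral_comp (q : Plane → ℝ) : ∫ x, q (R x) = ∫ x, q x :=
  h.measurePreserving.integral_comp h.measurableEmbedding q

theorem integrable_comp {q : Plane → ℝ} (hq : Integrable q) : Integrable fun x => q (R x) :=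
  (h.measurePreserving.integrable_comp_emb h.measurableEmbedding).2 hq

theorem setIntegral_neg_comp (q : Plane → ℝ) :
    ∫ x in {x | S x < 0}, q (R x) = ∫ x in {x | 0 < S x}, q x := by
  rw [← h.measurePreserving.setIntegral_preimage_emb h.measurableEmbedding q]
  congr 2
  ext x
  simp [h.apply_reflection]

theorem measurableSet_pos : MeasurableSet {x | 0 < S x} :=
  measurableSet_lt measurable_const h.continuous.measurable

theorem measurableSet_neg : MeasurableSet {x | S x < 0} :=
  measurableSet_lt h.continuous.measurable measurable_const

theorem ae_ne : ∀ᵐ x, S x ≠ 0 := by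
  rw [ae_iff]
  simpa using h.null

theorem integral_eq_add {q : Plane → ℝ} (hq : Integrable q) :
    ∫ x, q x = (∫ x in {x | 0 < S x}, q x) + ∫ x in {x | S x < 0}, q x := by
  rw [← setIntegral_union _ h.measurableSet_neg hq.integrableOn hq.integrableOn,
    ← setIntegral_univ]
  · refine setIntegral_congr_set ?_
    filter_upwards [h.ae_ne] with x hx
    exact propext ⟨fun _ => (lt_or_gt_of_ne hx).symm, fun _ => mem_univ x⟩
  · exact disjoint_left.2 fun x (h1 : 0 < S x) (h2 : S x < 0) => lt_asymm h1 h2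

theorem comp_sub_of_nonneg (w : Plane → ℂ) {x : Plane} (hx : 0 ≤ S x) :
    2 * w (F x) - w x = w x := by
  rw [h.fold_of_nonneg x hx]
  ring

/-- The fold is Lipschitz across the interface, so no jump appears there. The hypothesis `hR` keeps
the reflected part of the support inside `Ω`, hence the Dirichlet condition. -/
theorem isLip {Ω : Set Plane} {w : Plane → ℂ} (hw : IsTest Ω w) (hR : R ⁻¹' tsupport w ⊆ Ω) :
    IsLip Ω (fun x => 2 * w (F x) - w x) := by
  obtain ⟨C, hC⟩ := hw.isLip.lipschitz
  obtain ⟨C', hC'⟩ := h.lipschitz_fold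
  have hcpt : IsCompact (R ⁻¹' tsupport w) := by
    have : R ⁻¹' tsupport w = R '' tsupport w :=
      (congrFun (image_eq_preimage_of_inverse h.involutive h.involutive) _).symm
    rw [this]
    exact hw.hasCompactSupport.isCompact.image h.lipschitz.continuous
  have hsupp : Function.support (fun x => 2 * w (F x) - w x) ⊆ tsupport w ∪ R ⁻¹' tsupport w := by
    intro x hx
    by_contra hx'
    rw [mem_union, not_or] at hx'
    have h1 : w x = 0 := image_eq_zero_of_notMem_tsupport hx'.1
    have h2 : w (R x) = 0 := image_eq_zero_of_notMem_tsupport hx'.2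
    refine hx ?_
    rcases lt_or_ge (S x) 0 with hS | hS
    · simp only [h.fold_of_neg x hS, h1, h2]
      ring
    · exact (h.comp_sub_of_nonneg w hS).trans h1
  have hts := closure_minimal hsupp ((isClosed_tsupport w).union hcpt.isClosed)
  refine ⟨⟨_, ((lipschitzWith_smul (2 : ℂ)).comp (hC.comp hC')).sub hC⟩, ?_, ?_⟩
  · exact (hw.hasCompactSupport.isCompact.union hcpt).of_isClosed_subset (isClosed_tsupport _) hts
  · exact hts.trans (union_subset hw.tsupport_subset hR)

theorem pderiv_of_pos (w : Plane → ℂ) {x : Plane} (hx : 0 < S x) (i : Fin 2) :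
    pderiv i (fun x => 2 * w (F x) - w x) x = pderiv i w x := by
  have he : (fun x => 2 * w (F x) - w x) =ᶠ[𝓝 x] w := by
    filter_upwards [(isOpen_lt continuous_const h.continuous).mem_nhds hx] with y hy
    exact h.comp_sub_of_nonneg w hy.le
  simp only [pderiv]
  rw [he.fderiv_eq]

theorem pderiv_of_neg {w : Plane → ℂ} (hw : Differentiable ℝ w) {x : Plane} (hx : S x < 0)
    (hR : DifferentiableAt ℝ R x) (i : Fin 2) :
    pderiv i (fun x => 2 * w (F x) - w x) x = 2 * pderiv i (w ∘ R) x - pderiv i w x := by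
  have he : (fun x => 2 * w (F x) - w x) =ᶠ[𝓝 x] fun x => 2 * (w ∘ R) x - w x := by
    filter_upwards [(isOpen_lt h.continuous continuous_const).mem_nhds hx] with y hy
    rw [h.fold_of_neg y hy]
    rfl
  have hd : DifferentiableAt ℝ (w ∘ R) x := (hw _).comp x hR
  simp only [pderiv]
  rw [he.fderiv_eq, fderiv_fun_sub (hd.const_mul 2) (hw x), fderiv_const_mul hd]
  rfl

theorem ae_differentiableAt : ∀ᵐ x, DifferentiableAt ℝ R x := h.lipschitz.ae_differentiableAt

theorem norm_sq_le (w : Plane → ℂ) (x : Plane) :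
    ‖2 * w (F x) - w x‖ ^ 2 ≤ 8 * ‖w (R x)‖ ^ 2 + 2 * ‖w x‖ ^ 2 := by
  rcases lt_or_ge (S x) 0 with hS | hS
  · rw [h.fold_of_neg x hS]
    exact norm_two_mul_sub_sq_le _ _
  · rw [h.comp_sub_of_nonneg w hS]
    nlinarith [sq_nonneg ‖w (R x)‖, sq_nonneg ‖w x‖]

theorem ae_norm_sq_pderiv_le {w : Plane → ℂ} (hw : Differentiable ℝ w) :
    ∀ᵐ x, ∀ i, ‖pderiv i (fun x => 2 * w (F x) - w x) x‖ ^ 2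
      ≤ 8 * K ^ 2 * (∑ j, ‖pderiv j w (R x)‖ ^ 2) + 2 * ∑ j, ‖pderiv j w x‖ ^ 2 := by
  filter_upwards [h.ae_ne, h.ae_differentiableAt] with x hx hR i
  have h0 : ‖pderiv i w x‖ ^ 2 ≤ ∑ j, ‖pderiv j w x‖ ^ 2 :=
    Finset.single_le_sum (f := fun j => ‖pderiv j w x‖ ^ 2) (fun j _ => by positivity)
      (Finset.mem_univ i)
  have h1 : 0 ≤ ∑ j, ‖pderiv j w (R x)‖ ^ 2 := Finset.sum_nonneg fun j _ => by positivity
  rcases lt_or_gt_of_ne hx with hS | hS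
  · rw [h.pderiv_of_neg hw hS hR]
    have h2 : ‖pderiv i (w ∘ R) x‖ ^ 2 ≤ K ^ 2 * ∑ j, ‖pderiv j w (R x)‖ ^ 2 :=
      (Finset.single_le_sum (f := fun j => ‖pderiv j (w ∘ R) x‖ ^ 2) (fun j _ => by positivity)
        (Finset.mem_univ i)).trans (sum_norm_sq_pderiv_comp_le hw h.lipschitz hR)
    have h3 := norm_two_mul_sub_sq_le (pderiv i (w ∘ R) x) (pderiv i w x)
    linarith
  · rw [h.pderiv_of_pos w hS]
    have h2 : 0 ≤ (K : ℝ) ^ 2 * ∑ j, ‖pderiv j w (R x)‖ ^ 2 := by positivity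
    have h3 : 0 ≤ ‖pderiv i w x‖ ^ 2 := by positivity
    linarith

end IsFold

namespace IsFold

variable {S : Plane → ℝ} {R F : Plane → Plane} {K : NNReal} (h : IsFold S R F K)
include h

variable {Ω : Set Plane} (hΩ : IsOpen Ω)

include hΩ in
theorem norm_embL2_le {w : Plane → ℂ} (hw : IsTest Ω w)
    (hv : IsLip Ω (fun x => 2 * w (F x) - w x)) :
    ‖embL2 Ω (hv.toH10 hΩ)‖ ≤ 4 * ‖embL2 Ω (hw.isLip.toH10 hΩ)‖ := by
  refine le_of_sq_le_sq ?_ (by positivity)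
  rw [IsLip.embL2_toH10, IsLip.embL2_toH10, mul_pow, L2.norm_sq_toLp, L2.norm_sq_toLp]
  have hm : MemLp w 2 volume := by
    simpa using (hw.isLip.mono (subset_univ Ω)).memLp
  have hi : Integrable fun x => ‖w x‖ ^ 2 :=
    (memLp_two_iff_integrable_sq_norm hm.aestronglyMeasurable).1 hm
  have hi' := h.integrable_comp hi
  have hmv : MemLp (fun x => 2 * w (F x) - w x) 2 volume := by
    simpa using (hv.mono (subset_univ Ω)).memLp
  have hiv : Integrable fun x => ‖2 * w (F x) - w x‖ ^ 2 :=
    (memLp_two_iff_integrable_sq_norm hmv.aestronglyMeasurable).1 hmv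
  have h1 : ∫ x in Ω, ‖w x‖ ^ 2 = ∫ x, ‖w x‖ ^ 2 := by
    refine setIntegral_eq_integral_of_forall_compl_eq_zero fun x hx => ?_
    rw [image_eq_zero_of_notMem_tsupport fun hx' => hx (hw.tsupport_subset hx')]
    simp
  have h2 : ∫ x in Ω, ‖2 * w (F x) - w x‖ ^ 2 ≤ ∫ x, ‖2 * w (F x) - w x‖ ^ 2 :=
    setIntegral_le_integral hiv (ae_of_all _ fun x => by positivity)
  have h3 : ∫ x, ‖2 * w (F x) - w x‖ ^ 2 ≤ ∫ x, (8 * ‖w (R x)‖ ^ 2 + 2 * ‖w x‖ ^ 2) :=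
    integral_mono hiv ((hi'.const_mul 8).add (hi.const_mul 2)) fun x => h.norm_sq_le w x
  have h4 := h.integral_comp fun x => ‖w x‖ ^ 2
  rw [integral_add (hi'.const_mul 8) (hi.const_mul 2), integral_const_mul, integral_const_mul,
    h4] at h3
  have h5 : 0 ≤ ∫ x, ‖w x‖ ^ 2 := integral_nonneg fun x => by positivity
  rw [h1]
  linarith

include hΩ in
theorem norm_gradL2_le {w : Plane → ℂ} (hw : IsTest Ω w)
    (hv : IsLip Ω (fun x => 2 * w (F x) - w x)) (i : Fin 2) :
    ‖gradL2 Ω i (hv.toH10 hΩ)‖ ≤ (3 * K + 2) * ∑ j, ‖gradL2 Ω j (hw.isLip.toH10 hΩ)‖ := by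
  refine le_of_sq_le_sq ?_ (by positivity)
  have h0 : ∑ j, ‖gradL2 Ω j (hw.isLip.toH10 hΩ)‖ ^ 2
      ≤ (∑ j, ‖gradL2 Ω j (hw.isLip.toH10 hΩ)‖) ^ 2 := by
    rw [Fin.sum_univ_two, Fin.sum_univ_two, add_sq]
    have := mul_nonneg (norm_nonneg (gradL2 Ω 0 (hw.isLip.toH10 hΩ)))
      (norm_nonneg (gradL2 Ω 1 (hw.isLip.toH10 hΩ)))
    linarith
  rw [mul_pow]
  refine le_trans ?_ (mul_le_mul_of_nonneg_left h0 (by positivity))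
  rw [hw.sum_norm_sq_gradL2, IsLip.gradL2_toH10, L2.norm_sq_toLp]
  have hi := hw.integrable_sum_norm_sq_pderiv
  have hi' := h.integrable_comp hi
  have hmv : MemLp (pderiv i (fun x => 2 * w (F x) - w x)) 2 volume := by
    simpa using (hv.mono (subset_univ Ω)).memLp_pderiv i
  have hiv : Integrable fun x => ‖pderiv i (fun x => 2 * w (F x) - w x) x‖ ^ 2 :=
    (memLp_two_iff_integrable_sq_norm hmv.aestronglyMeasurable).1 hmv
  have h1 : ∫ x in Ω, ∑ j, ‖pderiv j w x‖ ^ 2 = ∫ x, ∑ j, ‖pderiv j w x‖ ^ 2 := by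
    refine setIntegral_eq_integral_of_forall_compl_eq_zero fun x hx => ?_
    refine Finset.sum_eq_zero fun j _ => ?_
    rw [pderiv_eq_zero_of_notMem_tsupport j fun hx' => hx (hw.tsupport_subset hx')]
    simp
  have h2 : ∫ x in Ω, ‖pderiv i (fun x => 2 * w (F x) - w x) x‖ ^ 2
      ≤ ∫ x, ‖pderiv i (fun x => 2 * w (F x) - w x) x‖ ^ 2 :=
    setIntegral_le_integral hiv (ae_of_all _ fun x => by positivity)
  have h3 : ∫ x, ‖pderiv i (fun x => 2 * w (F x) - w x) x‖ ^ 2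
      ≤ ∫ x, (8 * K ^ 2 * (∑ j, ‖pderiv j w (R x)‖ ^ 2) + 2 * ∑ j, ‖pderiv j w x‖ ^ 2) :=
    integral_mono_ae hiv ((hi'.const_mul _).add (hi.const_mul 2)) <| by
      filter_upwards [h.ae_norm_sq_pderiv_le hw.differentiable] with x hx using hx i
  rw [integral_add (hi'.const_mul _) (hi.const_mul 2), integral_const_mul, integral_const_mul,
    h.integral_comp fun x => ∑ j, ‖pderiv j w x‖ ^ 2] at h3
  have h5 : 0 ≤ ∫ x, ∑ j, ‖pderiv j w x‖ ^ 2 :=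
    integral_nonneg fun x => Finset.sum_nonneg fun j _ => by positivity
  rw [h1]
  refine h2.trans (h3.trans ?_)
  rw [← add_mul]
  gcongr
  nlinarith [sq_nonneg (K : ℝ), K.coe_nonneg]

/-- The reflection carries the energy on `{S > 0}` onto `{S < 0}`, so the term with `γ` is charged
to the positive side. The net coefficients are `α - γ` and `β`. -/
theorem setIntegral_lower_bound {q : Plane → ℝ} (hq : Integrable q) (hq0 : ∀ x, 0 ≤ q x)
    {α β γ : ℝ} (h1 : 1 ≤ α - γ) (h2 : 1 ≤ β) :
    ∫ x, q x ≤ ∫ x, (({x | 0 < S x}.indicator (fun x => α * q x) x)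
      + {x | S x < 0}.indicator (fun x => β * q x - γ * q (R x)) x) := by
  have hq' := h.integrable_comp hq
  have hd : Integrable fun x => β * q x - γ * q (R x) := (hq.const_mul β).sub (hq'.const_mul γ)
  rw [integral_add ((hq.const_mul α).indicator h.measurableSet_pos)
    (hd.indicator h.measurableSet_neg),
    integral_indicator h.measurableSet_pos, integral_indicator h.measurableSet_neg,
    integral_sub (hq.const_mul β).integrableOn (hq'.const_mul γ).integrableOn,
    integral_const_mul, integral_const_mul, integral_const_mul, h.setIntegral_neg_comp,
    h.integral_eq_add hq]
  have h3 : 0 ≤ ∫ x in {x | 0 < S x}, q x := integral_nonneg hq0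
  have h4 : 0 ≤ ∫ x in {x | S x < 0}, q x := integral_nonneg hq0
  nlinarith

/-- The companion is `t (2 w ∘ F - w)`: it is `t w` where `σ = a`, which gives energy of the right
sign, and `t (2 w ∘ R - w)` where `σ = b`, where the term `-w` reverses the wrong sign. The cross
term is split by Young's inequality, and its reflected half is paid for by the side of `a`. -/
theorem locallyTCoercive {σ : Plane → ℝ} (hσ : Measurable σ) (hb : ∃ C : ℝ, ∀ x, |σ x| ≤ C)
    {a b : ℝ} (hab : a * b < 0) (hK : |b| * K ^ 2 < |a|) {p : Plane} (hp : R p = p) {r : ℝ}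
    (hr : 0 < r) (hRΩ : ∀ x ∈ Metric.ball p r, R x ∈ Ω → x ∈ Ω)
    (hpos : ∀ x ∈ Metric.ball p r ∩ Ω, 0 < S x → σ x = a)
    (hneg : ∀ x ∈ Metric.ball p r ∩ Ω, S x < 0 → σ x = b) : LocallyTCoercive hΩ hσ hb p := by
  obtain ⟨t, η, hη, hb0, ht1, ht2⟩ := exists_fold_parameters hab (sq_nonneg (K : ℝ)) hK
  -- As `R` fixes `p` and is `K`-Lipschitz, both the support of `w` and its reflection then stay in
  -- the ball of radius `r`, where the geometry is known.
  refine ⟨r / (K + 1), by positivity, |t| * (3 * K + 4), by positivity, fun w hw hwr => ?_⟩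
  have hRw : R ⁻¹' tsupport w ⊆ Ω := by
    intro x hx
    refine hRΩ x ?_ (hw.tsupport_subset hx)
    have h1 := Metric.mem_ball.1 (hwr hx)
    have h2 := h.lipschitz.dist_le_mul (R x) p
    rw [h.involutive x, hp] at h2
    rw [lt_div_iff₀ (by positivity)] at h1
    rw [Metric.mem_ball]
    nlinarith [K.coe_nonneg, dist_nonneg (x := R x) (y := p), h.lipschitz.dist_le_mul (R x) p]
  have hwr' : tsupport w ⊆ Metric.ball p r :=
    hwr.trans (Metric.ball_subset_ball (div_le_self hr.le (by linarith [K.coe_nonneg])))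
  have hv0 := h.isLip hw hRw
  set v0 : Plane → ℂ := fun x => 2 * w (F x) - w x with hv0_def
  have hv : IsLip Ω ((t : ℂ) • v0) := by
    obtain ⟨C, hC⟩ := hv0.lipschitz
    exact ⟨⟨_, (lipschitzWith_smul (t : ℂ)).comp hC⟩,
      hv0.hasCompactSupport.smul_left (f := fun _ => (t : ℂ)),
      (tsupport_smul_subset_right (fun _ => (t : ℂ)) v0).trans hv0.tsupport_subset⟩
  have hpd : ∀ᵐ x, ∀ i, pderiv i ((t : ℂ) • v0) x = (t : ℂ) * pderiv i v0 x := by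
    filter_upwards [hv0.ae_differentiableAt] with x hx i
    simp only [pderiv]
    rw [fderiv_const_smul hx]
    rfl
  have hgrad : ∀ i, gradL2 Ω i (hv.toH10 hΩ) = (t : ℂ) • gradL2 Ω i (hv0.toH10 hΩ) := by
    intro i
    rw [IsLip.gradL2_toH10, IsLip.gradL2_toH10, ← MemLp.toLp_const_smul]
    refine MemLp.toLp_congr _ _ (ae_restrict_of_ae ?_)
    filter_upwards [hpd] with x hx using hx i
  have hemb : embL2 Ω (hv.toH10 hΩ) = (t : ℂ) • embL2 Ω (hv0.toH10 hΩ) := rfl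
  have hn : ‖(t : ℂ)‖ = |t| := by rw [Complex.norm_real, Real.norm_eq_abs]
  refine ⟨_, hv, ?_, fun i => ?_, ?_⟩
  · rw [hemb, norm_smul, hn, mul_assoc]
    gcongr
    refine (h.norm_embL2_le hΩ hw hv0).trans ?_
    gcongr
    linarith [K.coe_nonneg]
  · rw [hgrad, norm_smul, hn, mul_assoc]
    gcongr
    refine (h.norm_gradL2_le hΩ hw hv0 i).trans ?_
    gcongr
    norm_num
  · have hform := inner_formOp_toH10_re hΩ hσ hb hv hw.isLip
    rw [← integral_indicator hΩ.measurableSet] at hform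
    rw [hform, hw.sum_norm_sq_gradL2]
    have hi := hw.integrable_sum_norm_sq_pderiv
    have hi' := h.integrable_comp hi
    have hq0 : ∀ x, 0 ≤ ∑ j, ‖pderiv j w x‖ ^ 2 :=
      fun x => Finset.sum_nonneg fun j _ => by positivity
    refine (setIntegral_le_integral hi (ae_of_all _ hq0)).trans
      ((h.setIntegral_lower_bound hi hq0 (α := t * a) (γ := -(t * b) * K ^ 2 / η) ht1 ht2).trans ?_)
    have hd : Integrable fun x => -(t * b) * (1 - η) * (∑ j, ‖pderiv j w x‖ ^ 2)
        - -(t * b) * K ^ 2 / η * ∑ j, ‖pderiv j w (R x)‖ ^ 2 :=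
      (hi.const_mul _).sub (hi'.const_mul _)
    refine integral_mono_ae (((hi.const_mul _).indicator h.measurableSet_pos).add
      (hd.indicator h.measurableSet_neg))
      ((integrable_indicator_iff hΩ.measurableSet).2 (integrable_form hσ hb hv hw.isLip)) ?_
    filter_upwards [h.ae_ne, h.ae_differentiableAt, hpd] with x hS hR hpd
    have hγ : 0 ≤ -(t * b) * K ^ 2 / η := by positivity
    by_cases hxw : x ∈ tsupport w
    · have hxΩ := hw.tsupport_subset hxw
      have hxr := hwr' hxw
      rw [indicator_of_mem hxΩ]
      have hin : ∀ i, (inner ℂ (pderiv i ((t : ℂ) • v0) x) (pderiv i w x)).re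
          = t * (inner ℂ (pderiv i v0 x) (pderiv i w x)).re := by
        intro i
        rw [hpd, ← smul_eq_mul (t : ℂ), inner_smul_left, Complex.conj_ofReal,
          Complex.re_ofReal_mul]
      simp only [hin, ← Finset.mul_sum]
      rcases lt_or_gt_of_ne hS with hS | hS
      · rw [indicator_of_notMem (show x ∉ {x | 0 < S x} from hS.not_gt), zero_add,
          indicator_of_mem (show x ∈ {x | S x < 0} from hS), hneg x ⟨hxr, hxΩ⟩ hS]
        have h1 : ∑ i, (inner ℂ (pderiv i v0 x) (pderiv i w x)).re
            ≤ η⁻¹ * ∑ i, ‖pderiv i (w ∘ R) x‖ ^ 2 + (η - 1) * ∑ i, ‖pderiv i w x‖ ^ 2 := by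
          rw [Finset.mul_sum, Finset.mul_sum, ← Finset.sum_add_distrib]
          refine Finset.sum_le_sum fun i _ => ?_
          rw [hv0_def, h.pderiv_of_neg hw.differentiable hS hR]
          exact re_inner_two_mul_sub_le hη _ _
        have h2 := sum_norm_sq_pderiv_comp_le hw.differentiable h.lipschitz hR
        have h3 : η⁻¹ * ∑ i, ‖pderiv i (w ∘ R) x‖ ^ 2
            ≤ η⁻¹ * (K ^ 2 * ∑ i, ‖pderiv i w (R x)‖ ^ 2) := by gcongr
        have h4 := mul_le_mul_of_nonneg_left (h1.trans (add_le_add_left h3 _)) hb0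
        rw [div_eq_mul_inv]
        linarith
      · rw [indicator_of_notMem (show x ∉ {x | S x < 0} from hS.not_gt), add_zero,
          indicator_of_mem (show x ∈ {x | 0 < S x} from hS), hpos x ⟨hxr, hxΩ⟩ hS]
        refine le_of_eq ?_
        rw [← mul_assoc, mul_comm a]
        congr 1
        refine Finset.sum_congr rfl fun i _ => ?_
        rw [hv0_def, h.pderiv_of_pos w hS, inner_self_eq_norm_sq_to_K]
        norm_cast
    · have hz : ∀ i, pderiv i w x = 0 := fun i => pderiv_eq_zero_of_notMem_tsupport i hxw
      have h1 : Ω.indicator (fun x => σ x * ∑ i, (inner ℂ (pderiv i ((t : ℂ) • v0) x)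
          (pderiv i w x)).re) x = 0 := by
        refine indicator_apply_eq_zero.2 fun _ => ?_
        simp [hz]
      rw [h1]
      have h2 : {x | 0 < S x}.indicator (fun x => t * a * ∑ i, ‖pderiv i w x‖ ^ 2) x = 0 :=
        indicator_apply_eq_zero.2 fun _ => by simp [hz]
      rw [h2, zero_add]
      refine indicator_apply_le' (fun _ => ?_) fun _ => le_rfl
      simp only [hz]
      have := mul_nonneg hγ (hq0 (R x))
      simp
      simpa using this

end IsFold

/-! ### Folding along a Lipschitz graph -/

theorem measurePreserving_planeToProd :
    MeasurePreserving (fun x : Plane => (x 0, x 1)) volume volume :=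
  (volume_preserving_finTwoArrow ℝ).comp (PiLp.volume_preserving_ofLp (Fin 2))

theorem measurePreserving_prodToPlane :
    MeasurePreserving (fun z : ℝ × ℝ => (!₂[z.1, z.2] : Plane)) volume volume :=
  (PiLp.volume_preserving_toLp (Fin 2)).comp (volume_preserving_finTwoArrow ℝ).symm

/-- On each vertical line the map is a reflection of `ℝ`; Fubini does the rest, and `g` need only be
measurable. -/
theorem measurePreserving_reflection_prod {g : ℝ → ℝ} (hg : Measurable g) :
    MeasurePreserving (fun z : ℝ × ℝ => (z.1, 2 * g z.1 - z.2)) volume volume := by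
  refine (MeasurePreserving.id volume).skew_product (g := fun a c => 2 * g a - c) ?_ ?_
  · exact ((hg.comp measurable_fst).const_mul 2).sub measurable_snd
  · exact ae_of_all _ fun a => (Measure.measurePreserving_sub_left volume (2 * g a)).map_eq

theorem volume_graph_eq_zero {g : ℝ → ℝ} (hg : Measurable g) :
    volume {z : ℝ × ℝ | z.2 - g z.1 = 0} = 0 := by
  have hm : MeasurableSet {z : ℝ × ℝ | z.2 - g z.1 = 0} :=
    measurableSet_eq_fun (measurable_snd.sub (hg.comp measurable_fst)) measurable_const
  rw [Measure.volume_eq_prod, Measure.measure_prod_null hm]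
  refine ae_of_all _ fun a => ?_
  have : Prod.mk a ⁻¹' {z : ℝ × ℝ | z.2 - g z.1 = 0} = {g a} := by
    ext c
    simp [sub_eq_zero]
  simp [this]

section Graph

variable (e : Plane ≃ₗᵢ[ℝ] Plane) (g : ℝ → ℝ)

/-- The signed height over the graph of `g`, in the coordinates `e`. -/
noncomputable def graphHeight (x : Plane) : ℝ := e x 1 - g (e x 0)

/-- The direction of the ordinates, in the coordinates `e`. -/
noncomputable def graphNormal : Plane := e.symm (EuclideanSpace.single 1 1)

/-- The reflection across the graph of `g`, in the direction of the ordinates. -/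
noncomputable def graphReflection (x : Plane) : Plane := x - (2 * graphHeight e g x) • graphNormal e

/-- The folding map onto the epigraph of `g`. -/
noncomputable def graphFold (x : Plane) : Plane :=
  x + (|graphHeight e g x| - graphHeight e g x) • graphNormal e

theorem apply_add_smul_graphNormal_zero (x : Plane) (c : ℝ) : e (x + c • graphNormal e) 0 = e x 0 := by
  simp [graphNormal]

theorem apply_add_smul_graphNormal_one (x : Plane) (c : ℝ) :
    e (x + c • graphNormal e) 1 = e x 1 + c := by
  simp [graphNormal]

theorem norm_graphNormal : ‖graphNormal e‖ = 1 := by simp [graphNormal]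

theorem graphReflection_eq (x : Plane) :
    graphReflection e g x = x + (-(2 * graphHeight e g x)) • graphNormal e := by
  rw [graphReflection, neg_smul, sub_eq_add_neg]

theorem apply_graphReflection_zero (x : Plane) : e (graphReflection e g x) 0 = e x 0 := by
  rw [graphReflection_eq, apply_add_smul_graphNormal_zero]

theorem apply_graphReflection_one (x : Plane) :
    e (graphReflection e g x) 1 = 2 * g (e x 0) - e x 1 := by
  rw [graphReflection_eq, apply_add_smul_graphNormal_one, graphHeight]
  ring

theorem graphHeight_reflection (x : Plane) :
    graphHeight e g (graphReflection e g x) = -graphHeight e g x := by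
  rw [graphHeight, apply_graphReflection_zero, apply_graphReflection_one, graphHeight]
  ring

theorem measurePreserving_graphReflection (hg : Measurable g) :
    MeasurePreserving (graphReflection e g) volume volume := by
  have h : graphReflection e g = fun x => e.symm (!₂[e x 0, 2 * g (e x 0) - e x 1]) := by
    funext x
    rw [e.eq_symm_apply]
    ext i
    fin_cases i
    · exact apply_graphReflection_zero e g x
    · exact apply_graphReflection_one e g x
  rw [h]
  exact e.symm.measurePreserving.comp (measurePreserving_prodToPlane.comp
    ((measurePreserving_reflection_prod hg).comp
      (measurePreserving_planeToProd.comp e.measurePreserving)))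

variable {g} {ε : NNReal} (hg : LipschitzWith ε g)
include hg

theorem abs_graphHeight_sub_le (x y : Plane) :
    |graphHeight e g x - graphHeight e g y| ≤ (1 + ε) * ‖x - y‖ := by
  have h1 : |e x 1 - e y 1| ≤ ‖x - y‖ := by
    have := PiLp.norm_apply_le (e (x - y)) 1
    rwa [e.norm_map, map_sub, PiLp.sub_apply, Real.norm_eq_abs] at this
  have h0 : |e x 0 - e y 0| ≤ ‖x - y‖ := by
    have := PiLp.norm_apply_le (e (x - y)) 0
    rwa [e.norm_map, map_sub, PiLp.sub_apply, Real.norm_eq_abs] at this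
  have h2 : |g (e x 0) - g (e y 0)| ≤ ε * ‖x - y‖ := by
    have := hg.dist_le_mul (e x 0) (e y 0)
    rw [Real.dist_eq, Real.dist_eq] at this
    exact this.trans (by gcongr)
  have h3 : graphHeight e g x - graphHeight e g y
      = (e x 1 - e y 1) - (g (e x 0) - g (e y 0)) := by
    simp only [graphHeight]
    ring
  rw [h3]
  linarith [abs_sub (e x 1 - e y 1) (g (e x 0) - g (e y 0))]

/-- The increment is that of the orthogonal reflection in the first axis, an isometry, plus twice
the increment of `g`. It is essential that the constant tends to `1` with `ε`. -/
theorem lipschitzWith_graphReflection : LipschitzWith (1 + 2 * ε) (graphReflection e g) := by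
  refine LipschitzWith.of_dist_le_mul fun x y => ?_
  rw [dist_eq_norm, dist_eq_norm]
  have h0 : |e x 0 - e y 0| ≤ ‖x - y‖ := by
    have := PiLp.norm_apply_le (e (x - y)) 0
    rwa [e.norm_map, map_sub, PiLp.sub_apply, Real.norm_eq_abs] at this
  have h2 : |g (e x 0) - g (e y 0)| ≤ ε * ‖x - y‖ := by
    have := hg.dist_le_mul (e x 0) (e y 0)
    rw [Real.dist_eq, Real.dist_eq] at this
    exact this.trans (by gcongr)
  have h3 : graphReflection e g x - graphReflection e g y
      = ((x - y) + (-(2 * e (x - y) 1)) • graphNormal e)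
        + (2 * (g (e x 0) - g (e y 0))) • graphNormal e := by
    simp only [graphReflection, graphHeight, map_sub, PiLp.sub_apply]
    module
  have h4 : ‖(x - y) + (-(2 * e (x - y) 1)) • graphNormal e‖ = ‖x - y‖ := by
    rw [← e.norm_map, ← e.norm_map (x - y), EuclideanSpace.norm_eq, EuclideanSpace.norm_eq]
    simp only [Fin.sum_univ_two]
    rw [apply_add_smul_graphNormal_zero, apply_add_smul_graphNormal_one,
      show e (x - y) 1 + -(2 * e (x - y) 1) = - e (x - y) 1 by ring, norm_neg]
  rw [h3]
  refine (norm_add_le _ _).trans ?_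
  rw [h4, norm_smul, norm_graphNormal, mul_one, Real.norm_eq_abs, abs_mul, abs_two]
  push_cast
  linarith

theorem isFold_graph :
    IsFold (graphHeight e g) (graphReflection e g) (graphFold e g) (1 + 2 * ε) where
  continuous := (LipschitzWith.of_dist_le_mul (K := 1 + ε) fun x y => by
    rw [Real.dist_eq, dist_eq_norm]
    exact abs_graphHeight_sub_le e hg x y).continuous
  lipschitz := lipschitzWith_graphReflection e hg
  involutive x := by
    rw [graphReflection, graphHeight_reflection, graphReflection]
    module
  apply_reflection := graphHeight_reflection e g
  measurePreserving := measurePreserving_graphReflection e g hg.continuous.measurable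
  lipschitz_fold := by
    refine ⟨1 + 2 * (1 + ε), LipschitzWith.of_dist_le_mul fun x y => ?_⟩
    rw [dist_eq_norm, dist_eq_norm]
    have h1 : graphFold e g x - graphFold e g y = (x - y)
        + ((|graphHeight e g x| - |graphHeight e g y|)
          - (graphHeight e g x - graphHeight e g y)) • graphNormal e := by
      simp only [graphFold]
      module
    rw [h1]
    refine (norm_add_le _ _).trans ?_
    rw [norm_smul, norm_graphNormal, mul_one, Real.norm_eq_abs]
    have h2 := abs_sub (|graphHeight e g x| - |graphHeight e g y|)
      (graphHeight e g x - graphHeight e g y)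
    have h3 := abs_abs_sub_abs_le (graphHeight e g x) (graphHeight e g y)
    have h4 := abs_graphHeight_sub_le e hg x y
    push_cast
    linarith
  fold_of_neg x hx := by
    rw [graphFold, graphReflection, abs_of_neg hx]
    module
  fold_of_nonneg x hx := by
    rw [graphFold, abs_of_nonneg hx, sub_self, zero_smul, add_zero]
  null := (measurePreserving_planeToProd.comp e.measurePreserving).measure_preimage
    (measurableSet_eq_fun (measurable_snd.sub (hg.continuous.measurable.comp measurable_fst))
      measurable_const).nullMeasurableSet |>.trans (volume_graph_eq_zero hg.continuous.measurable)

end Graph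

/-- In suitable orthonormal coordinates at `p`, the sets `A` and `B` are the parts of `U` above and
below the graph of an `ε`-Lipschitz function, and `U` is a vertical strip. -/
def HasFoldChart (U A B : Set Plane) (p : Plane) (ε : NNReal) : Prop :=
  ∃ (e : Plane ≃ₗᵢ[ℝ] Plane) (g : ℝ → ℝ) (Y : Set ℝ), LipschitzWith ε g ∧ e p 1 = g (e p 0) ∧
    ∃ r > 0, ∀ x ∈ Metric.ball p r, (x ∈ U ↔ e x 0 ∈ Y) ∧
      (x ∈ U → (g (e x 0) < e x 1 → x ∈ A) ∧ (e x 1 < g (e x 0) → x ∈ B))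

/-- The vertical reflection keeps the abscissa, so it preserves the strip `Ω`; at a boundary point
this keeps the companion in `H¹₀(Ω)`. -/
theorem HasFoldChart.locallyTCoercive {Ω A B : Set Plane} {p : Plane} {ε : NNReal}
    (h : HasFoldChart Ω A B p ε) (hΩ : IsOpen Ω) {σ : Plane → ℝ} (hσ : Measurable σ)
    (hb : ∃ C : ℝ, ∀ x, |σ x| ≤ C) {a b : ℝ} (hab : a * b < 0)
    (hε : |b| * (1 + 2 * ε) ^ 2 < |a|) {r₁ : ℝ} (hr₁ : 0 < r₁)
    (hA : ∀ x ∈ Metric.ball p r₁ ∩ A, σ x = a) (hB : ∀ x ∈ Metric.ball p r₁ ∩ B, σ x = b) :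
    LocallyTCoercive hΩ hσ hb p := by
  obtain ⟨e, g, Y, hg, hp, r, hr, h⟩ := h
  have hfold := isFold_graph e hg
  have hSp : graphHeight e g p = 0 := sub_eq_zero.2 hp
  have hRp : graphReflection e g p = p := by
    rw [graphReflection, hSp, mul_zero, zero_smul, sub_zero]
  set r₂ := min r r₁ / (1 + 2 * ε) with hr₂
  have hK : (1 : ℝ) ≤ 1 + 2 * ε := le_add_of_nonneg_right (by positivity)
  have hr₂0 : 0 < r₂ := by positivity
  have hr₂r : r₂ ≤ min r r₁ := div_le_self (by positivity) hK
  have hball : ∀ x ∈ Metric.ball p r₂, x ∈ Metric.ball p r ∧ x ∈ Metric.ball p r₁ := fun x hx =>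
    ⟨Metric.ball_subset_ball (hr₂r.trans (min_le_left _ _)) hx,
      Metric.ball_subset_ball (hr₂r.trans (min_le_right _ _)) hx⟩
  refine hfold.locallyTCoercive hΩ hσ hb hab (by push_cast; exact hε) hRp hr₂0 ?_ ?_ ?_
  · intro x hx hRx
    have h1 : graphReflection e g x ∈ Metric.ball p r := by
      have h2 := hfold.lipschitz.dist_le_mul x p
      rw [hRp] at h2
      push_cast at h2
      rw [Metric.mem_ball, hr₂, lt_div_iff₀ (by positivity)] at hx
      rw [Metric.mem_ball]
      calc _ ≤ _ := h2
        _ < min r r₁ := by linarith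
        _ ≤ r := min_le_left _ _
    rw [(h _ h1).1, apply_graphReflection_zero] at hRx
    exact (h x (hball x hx).1).1.2 hRx
  · intro x hx hS
    exact hA x ⟨(hball x hx.1).2, ((h x (hball x hx.1).1).2 hx.2).1 (sub_pos.1 hS)⟩
  · intro x hx hS
    exact hB x ⟨(hball x hx.1).2, ((h x (hball x hx.1).1).2 hx.2).2 (sub_neg.1 hS)⟩

/-! ### Geometry of partitions -/

theorem IsPartition.pos_subset {U Up Um : Set Plane} (h : IsPartition U Up Um) : Up ⊆ U :=
  fun _ hx => (h.union_eq.subset (Or.inl hx)).1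

theorem IsPartition.neg_subset {U Up Um : Set Plane} (h : IsPartition U Up Um) : Um ⊆ U :=
  fun _ hx => (h.union_eq.subset (Or.inr hx)).1

theorem IsPartition.symm {U Up Um : Set Plane} (h : IsPartition U Up Um) : IsPartition U Um Up :=
  ⟨h.isOpen_neg, h.isOpen_pos, h.disjoint.symm, by rw [union_comm, inter_comm]; exact h.union_eq⟩

theorem IsPartition.exists_ball_of_notMem {U Up Um : Set Plane} (h : IsPartition U Up Um)
    {p : Plane} (hp : p ∉ closure Up ∩ closure Um) :
    ∃ r > 0, Metric.ball p r ∩ U ⊆ Up ∨ Metric.ball p r ∩ U ⊆ Um := by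
  wlog hpp : p ∉ closure Up generalizing Up Um
  · have hpm : p ∉ closure Um := fun hm => hp ⟨not_not.1 hpp, hm⟩
    obtain ⟨r, hr, h1⟩ := this h.symm (by rwa [inter_comm]) hpm
    exact ⟨r, hr, h1.symm⟩
  obtain ⟨r, hr, hb⟩ := Metric.isOpen_iff.1 isClosed_closure.isOpen_compl p hpp
  refine ⟨r, hr, Or.inr fun x hx => ?_⟩
  have hx1 : x ∉ closure Up := hb hx.1
  rcases h.union_eq.superset ⟨hx.2, fun hx2 => hx1 hx2.1⟩ with h1 | h1
  · exact absurd (subset_closure h1) hx1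
  · exact h1

/-- Reversing the ordinate axis exchanges the two sides. Folding requires the side with the larger
`|σ|` to be above the graph. -/
theorem HasFoldChart.symm {U A B : Set Plane} {p : Plane} {ε : NNReal} (h : HasFoldChart U A B p ε) :
    HasFoldChart U B A p ε := by
  obtain ⟨e, g, Y, hg, hp, r, hr, h⟩ := h
  let f : Plane ≃ₗᵢ[ℝ] Plane := LinearIsometryEquiv.piLpCongrRight 2
    (fun i : Fin 2 => if i = 1 then LinearIsometryEquiv.neg ℝ else LinearIsometryEquiv.refl ℝ ℝ)
  have hf0 : ∀ x, f x 0 = x 0 := fun x => by simp [f]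
  have hf1 : ∀ x, f x 1 = -x 1 := fun x => by simp [f]
  refine ⟨e.trans f, fun y => -g y, Y, hg.neg, ?_, r, hr, fun x hx => ?_⟩
  · simp [hf0, hf1, hp]
  · obtain ⟨h1, h2⟩ := h x hx
    simp only [LinearIsometryEquiv.trans_apply, hf0, hf1, neg_lt_neg_iff]
    exact ⟨h1, fun hU => ⟨(h2 hU).2, (h2 hU).1⟩⟩

section Chart

variable (e : Plane ≃ₗᵢ[ℝ] Plane) {g : ℝ → ℝ} {ε : NNReal} (hg : LipschitzWith ε g)
include hg

theorem isPreconnected_graphTube {J I : Set ℝ} (hJ : IsPreconnected J) (hI : IsPreconnected I) :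
    IsPreconnected {x : Plane | e x 0 ∈ J ∧ graphHeight e g x ∈ I} := by
  have h1 : Continuous fun z : ℝ × ℝ => e.symm (!₂[z.1, g z.1 + z.2] : Plane) := by
    refine e.symm.continuous.comp ((PiLp.continuous_toLp 2 _).comp (continuous_pi fun i => ?_))
    have := hg.continuous
    fin_cases i
    · exact continuous_fst
    · exact (this.comp continuous_fst).add continuous_snd
  convert (hJ.prod hI).image _ h1.continuousOn using 1
  ext x
  constructor
  · rintro ⟨hx1, hx2⟩
    refine ⟨(e x 0, graphHeight e g x), ⟨hx1, hx2⟩, ?_⟩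
    rw [e.symm_apply_eq]
    ext i
    fin_cases i
    · simp
    · simp [graphHeight]
  · rintro ⟨z, ⟨hz1, hz2⟩, rfl⟩
    simpa [graphHeight] using ⟨hz1, hz2⟩

theorem norm_sub_le_of_graphTube {p x : Plane} {d : ℝ} (hp : e p 1 = g (e p 0))
    (h0 : |e x 0 - e p 0| < d) (h1 : |graphHeight e g x| < d) : dist x p < (3 + ε) * d := by
  have h2 := hg.dist_le_mul (e x 0) (e p 0)
  rw [Real.dist_eq, Real.dist_eq] at h2
  have h3 : e x 1 - e p 1 = graphHeight e g x + (g (e x 0) - g (e p 0)) := by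
    rw [graphHeight, hp]
    ring
  have h4 : |e x 1 - e p 1| ≤ d + ε * d := by
    rw [h3]
    refine (abs_add_le _ _).trans ?_
    gcongr
    exact h2.trans (by gcongr)
  have hd : 0 < d := (abs_nonneg _).trans_lt h0
  have h5 : dist x p ≤ |e x 0 - e p 0| + |e x 1 - e p 1| := by
    rw [dist_eq_norm, ← e.norm_map, EuclideanSpace.norm_eq, Fin.sum_univ_two]
    refine Real.sqrt_le_iff.2 ⟨by positivity, ?_⟩
    rw [map_sub, PiLp.sub_apply, PiLp.sub_apply, Real.norm_eq_abs, Real.norm_eq_abs]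
    nlinarith [mul_nonneg (abs_nonneg (e x 0 - e p 0)) (abs_nonneg (e x 1 - e p 1))]
  linarith

/-- Near `p` the part of `U` strictly above the graph is a connected tube that misses the interface,
so it lies in one of the two pieces; likewise below. It is enough that the interface is contained in
the graph. -/
theorem IsPartition.hasFoldChart {U Up Um : Set Plane} (h : IsPartition U Up Um)
    {p : Plane} (hpi : p ∈ closure Up ∩ closure Um) (hp : e p 1 = g (e p 0)) {Y : Set ℝ}
    (hY : Y.OrdConnected) {r : ℝ} (hr : 0 < r) (hU : ∀ x ∈ Metric.ball p r, x ∈ U ↔ e x 0 ∈ Y)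
    (hint : ∀ x ∈ Metric.ball p r, x ∈ closure Up ∩ closure Um → e x 1 = g (e x 0)) :
    HasFoldChart U Up Um p ε := by
  set d := r / (3 + ε) with hd
  have hd0 : 0 < d := by positivity
  have hdr : (3 + ε) * d = r := by rw [hd]; field_simp
  set J := Y ∩ Ioo (e p 0 - d) (e p 0 + d) with hJ
  have hJc : IsPreconnected J := (hY.inter ordConnected_Ioo).isPreconnected
  have hsub : ∀ x, e x 0 ∈ J → |graphHeight e g x| < d → graphHeight e g x ≠ 0 →
      x ∈ U \ (closure Up ∩ closure Um) := by
    intro x hxJ hx1 hx0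
    have hb : x ∈ Metric.ball p r := by
      rw [Metric.mem_ball, ← hdr]
      exact norm_sub_le_of_graphTube e hg hp
        (abs_lt.2 ⟨by linarith [hxJ.2.1], by linarith [hxJ.2.2]⟩) hx1
    exact ⟨(hU x hb).2 hxJ.1, fun hx => hx0 (sub_eq_zero.2 (hint x hb hx))⟩
  have htube : ∀ I : Set ℝ, IsPreconnected I → I ⊆ Ioo (-d) d → (0 : ℝ) ∉ I →
      {x | e x 0 ∈ J ∧ graphHeight e g x ∈ I} ⊆ Up ∨
        {x | e x 0 ∈ J ∧ graphHeight e g x ∈ I} ⊆ Um := by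
    intro I hI hId hI0
    refine (isPreconnected_graphTube e hg hJc hI).subset_or_subset h.isOpen_pos h.isOpen_neg
      h.disjoint ?_
    rw [h.union_eq]
    exact fun x hx => hsub x hx.1 (abs_lt.2 (hId hx.2)) fun h0 => hI0 (h0 ▸ hx.2)
  have hpos := htube (Ioo 0 d) isPreconnected_Ioo (Ioo_subset_Ioo_left (by linarith)) (by simp)
  have hneg := htube (Ioo (-d) 0) isPreconnected_Ioo (Ioo_subset_Ioo_right hd0.le) (by simp)
  set r' := min r (d / (1 + ε)) with hr'
  have hr'0 : 0 < r' := by positivity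
  have hr'd : (1 + ε) * r' ≤ d := by
    have : r' ≤ d / (1 + ε) := min_le_right _ _
    rw [le_div_iff₀ (by positivity)] at this
    linarith
  have hball : ∀ x ∈ Metric.ball p r', x ∈ U → e x 0 ∈ J ∧ |graphHeight e g x| < d := by
    intro x hx hxU
    have hxr := Metric.ball_subset_ball (min_le_left _ _) hx
    have hdist : ‖x - p‖ < r' := by rw [← dist_eq_norm]; exact hx
    have h0 : |e x 0 - e p 0| ≤ ‖x - p‖ := by
      have := PiLp.norm_apply_le (e (x - p)) 0
      rwa [e.norm_map, map_sub, PiLp.sub_apply, Real.norm_eq_abs] at this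
    have h1 := abs_graphHeight_sub_le e hg x p
    rw [show graphHeight e g p = 0 from sub_eq_zero.2 hp, sub_zero] at h1
    have hε : 0 ≤ (ε : ℝ) * r' := by positivity
    have h2 := abs_lt.1 (h0.trans_lt (hdist.trans_le ((le_add_of_nonneg_right hε).trans
      (by linarith : r' + ε * r' ≤ d))))
    refine ⟨⟨(hU x hxr).1 hxU, by linarith [h2.1], by linarith [h2.2]⟩, h1.trans_lt ?_⟩
    refine lt_of_lt_of_le ?_ hr'd
    gcongr
  -- The two tubes cannot lie in the same piece. Otherwise the other piece, an open set accumulating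
  -- at `p`, would be contained in the graph near `p`, and a small vertical shift leaves the graph.
  have key : ∀ A B : Set Plane, IsOpen B → B ⊆ U → Disjoint A B → p ∈ closure B →
      {x | e x 0 ∈ J ∧ graphHeight e g x ∈ Ioo 0 d} ⊆ A →
      ¬ {x | e x 0 ∈ J ∧ graphHeight e g x ∈ Ioo (-d) 0} ⊆ A := by
    intro A B hB hBU hAB hpB h1 h2
    obtain ⟨z, hz, hzB⟩ := mem_closure_iff.1 hpB _ Metric.isOpen_ball (Metric.mem_ball_self hr'0)
    have hzero : ∀ x ∈ Metric.ball p r' ∩ B, graphHeight e g x = 0 := by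
      intro x hx
      obtain ⟨hxJ, hxd⟩ := hball x hx.1 (hBU hx.2)
      have hxd := abs_lt.1 hxd
      by_contra hne
      rcases lt_or_gt_of_ne hne with hlt | hlt
      · exact disjoint_left.1 hAB (h2 ⟨hxJ, hxd.1, hlt⟩) hx.2
      · exact disjoint_left.1 hAB (h1 ⟨hxJ, hlt, hxd.2⟩) hx.2
    have hcont : Tendsto (fun s : ℝ => z + s • graphNormal e) (𝓝[>] 0) (𝓝 z) := by
      have : Continuous fun s : ℝ => z + s • graphNormal e := by fun_prop
      simpa using (this.tendsto 0).mono_left nhdsWithin_le_nhds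
    have hev := (hcont.eventually ((Metric.isOpen_ball.inter hB).mem_nhds ⟨hz, hzB⟩)).and
      (eventually_mem_nhdsWithin (a := (0 : ℝ)) (s := Ioi 0))
    obtain ⟨s, hs1, hs2⟩ := hev.exists
    have h3 := hzero _ hs1
    have h4 := hzero _ ⟨hz, hzB⟩
    rw [graphHeight, apply_add_smul_graphNormal_zero, apply_add_smul_graphNormal_one] at h3
    rw [graphHeight] at h4
    have : (0 : ℝ) < s := hs2
    linarith
  have build : ∀ A B : Set Plane, {x | e x 0 ∈ J ∧ graphHeight e g x ∈ Ioo 0 d} ⊆ A →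
      {x | e x 0 ∈ J ∧ graphHeight e g x ∈ Ioo (-d) 0} ⊆ B → HasFoldChart U A B p ε := by
    intro A B h1 h2
    refine ⟨e, g, Y, hg, hp, r', hr'0, fun x hx =>
      ⟨hU x (Metric.ball_subset_ball (min_le_left _ _) hx), fun hxU => ?_⟩⟩
    obtain ⟨hxJ, hxd⟩ := hball x hx hxU
    have hxd := abs_lt.1 hxd
    exact ⟨fun hlt => h1 ⟨hxJ, sub_pos.2 hlt, hxd.2⟩, fun hlt => h2 ⟨hxJ, hxd.1, sub_neg.2 hlt⟩⟩
  rcases hpos with h1 | h1 <;> rcases hneg with h2 | h2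
  · exact absurd h2 (key Up Um h.isOpen_neg h.neg_subset h.disjoint hpi.2 h1)
  · exact build Up Um h1 h2
  · exact (build Um Up h1 h2).symm
  · exact absurd h2 (key Um Up h.isOpen_pos h.pos_subset h.disjoint.symm hpi.1 h1)

end Chart

/-! ### Curves as graphs -/

theorem exists_isometry_apply_eq_single (v : Plane) :
    ∃ e : Plane ≃ₗᵢ[ℝ] Plane, e v = EuclideanSpace.single 0 ‖v‖ :=
  ⟨_, Submodule.reflection_sub (by simp)⟩

theorem apply_zero_mul_norm {e : Plane ≃ₗᵢ[ℝ] Plane} {v : Plane}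
    (he : e v = EuclideanSpace.single 0 ‖v‖) (x : Plane) : e x 0 * ‖v‖ = inner ℝ x v := by
  rw [← e.inner_map_map, he, EuclideanSpace.inner_single_right]
  simp [mul_comm]

/-- Near `t₀` the velocity satisfies `|y'| < ε x'`, so `ε x + y` and `ε x - y` are monotone and
`|Δy| ≤ ε |Δx|` along the curve. Thus `y` is an `ε`-Lipschitz function of `x` on the values taken,
and it extends to `ℝ` with the same constant. -/
theorem exists_lipschitz_graph_of_curve {c : ℝ → Plane} (hc : ContDiff ℝ ∞ c) {t₀ : ℝ}
    (hd : deriv c t₀ ≠ 0) {e : Plane ≃ₗᵢ[ℝ] Plane}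
    (he : e (deriv c t₀) = EuclideanSpace.single 0 ‖deriv c t₀‖) {ε : NNReal} (hε : 0 < ε) :
    ∃ h > 0, ∃ g : ℝ → ℝ, LipschitzWith ε g ∧
      ∀ t ∈ Ioo (t₀ - h) (t₀ + h), e (c t) 1 = g (e (c t) 0) := by
  have hder : ∀ i t, HasDerivAt (fun t => e (c t) i) (e (deriv c t) i) t := by
    intro i t
    have h1 : HasDerivAt c (deriv c t) t := (hc.differentiable (by simp) t).hasDerivAt
    exact (((EuclideanSpace.proj i : Plane →L[ℝ] ℝ) ∘L
      (e.toContinuousLinearEquiv : Plane →L[ℝ] Plane)).hasFDerivAt).comp_hasDerivAt t h1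
  have hcont : ∀ i, Continuous fun t => e (deriv c t) i := by
    intro i
    have h1 : Continuous (deriv c) := hc.continuous_deriv (by simp)
    exact (EuclideanSpace.proj i : Plane →L[ℝ] ℝ).continuous.comp (e.continuous.comp h1)
  have hev : ∀ᶠ t in 𝓝 t₀, |e (deriv c t) 1| < ε * e (deriv c t) 0 := by
    refine (((hcont 1).abs).tendsto t₀).eventually_lt (((hcont 0).const_mul _).tendsto t₀) ?_
    rw [he]
    simp [hε, hd]
  obtain ⟨h, hh, hball⟩ := Metric.eventually_nhds_iff_ball.1 hev
  rw [Real.ball_eq_Ioo] at hball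
  set I := Ioo (t₀ - h) (t₀ + h) with hI
  have hmono : ∀ s : ℝ, |s| ≤ 1 → MonotoneOn (fun t => ε * e (c t) 0 + s * e (c t) 1) I := by
    intro s hs
    have h1 : ∀ t, HasDerivAt (fun t => ε * e (c t) 0 + s * e (c t) 1)
        (ε * e (deriv c t) 0 + s * e (deriv c t) 1) t := fun t =>
      ((hder 0 t).const_mul _).add ((hder 1 t).const_mul _)
    refine monotoneOn_of_deriv_nonneg (convex_Ioo _ _)
      (fun t _ => (h1 t).continuousAt.continuousWithinAt)
      (fun t _ => (h1 t).differentiableAt.differentiableWithinAt) fun t ht => ?_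
    rw [(h1 t).deriv]
    rw [interior_Ioo] at ht
    have h2 := hball t ht
    have h3 : |s * e (deriv c t) 1| ≤ |e (deriv c t) 1| := by
      rw [abs_mul]
      exact mul_le_of_le_one_left (abs_nonneg _) hs
    linarith [neg_abs_le (s * e (deriv c t) 1)]
  have hlip' : ∀ s ∈ I, ∀ t ∈ I, s ≤ t →
      |e (c s) 1 - e (c t) 1| ≤ ε * |e (c s) 0 - e (c t) 0| := by
    intro s hs t ht hst
    have h1 := hmono 1 (by simp) hs ht hst
    have h2 := hmono (-1) (by simp) hs ht hst
    simp only [one_mul, neg_mul] at h1 h2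
    have h3 : (ε : ℝ) * (e (c t) 0 - e (c s) 0) ≤ ε * |e (c s) 0 - e (c t) 0| := by
      rw [abs_sub_comm]
      gcongr
      exact le_abs_self _
    rw [abs_le]
    constructor <;> linarith
  have hlip : ∀ s ∈ I, ∀ t ∈ I, |e (c s) 1 - e (c t) 1| ≤ ε * |e (c s) 0 - e (c t) 0| := by
    intro s hs t ht
    rcases le_total s t with hst | hst
    · exact hlip' s hs t ht hst
    · rw [abs_sub_comm, abs_sub_comm (e (c s) 0)]
      exact hlip' t ht s hs hst
  let x : ℝ → ℝ := fun t => e (c t) 0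
  let g₀ : ℝ → ℝ := fun X => e (c (Function.invFunOn x I X)) 1
  have hinv : ∀ t ∈ I, Function.invFunOn x I (x t) ∈ I ∧ x (Function.invFunOn x I (x t)) = x t :=
    fun t ht => ⟨Function.invFunOn_mem ⟨t, ht, rfl⟩, Function.invFunOn_eq ⟨t, ht, rfl⟩⟩
  have hg₀ : LipschitzOnWith ε g₀ (x '' I) := by
    refine LipschitzOnWith.of_dist_le_mul ?_
    rintro _ ⟨s, hs, rfl⟩ _ ⟨t, ht, rfl⟩
    have h1 := hlip _ (hinv s hs).1 _ (hinv t ht).1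
    have h2 := (hinv s hs).2
    have h3 := (hinv t ht).2
    rw [Real.dist_eq, Real.dist_eq]
    refine h1.trans_eq ?_
    rw [← h2, ← h3]
    simp only [x, h2, h3]
  obtain ⟨g, hg, hgeq⟩ := hg₀.extend_real
  refine ⟨h, hh, g, hg, fun t ht => ?_⟩
  rw [← hgeq ⟨t, ht, rfl⟩]
  have h1 := hlip t ht _ (hinv t ht).1
  have h2 : e (c t) 0 - e (c (Function.invFunOn x I (x t))) 0 = 0 := sub_eq_zero.2 (hinv t ht).2.symm
  rw [h2, abs_zero, mul_zero] at h1
  exact sub_eq_zero.1 (abs_nonpos_iff.1 h1)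

/-- An injective curve does not return near `c t₀`: the parameters of `K` away from `t₀` have a
compact image which misses this point. -/
theorem exists_ball_inter_image_subset {c : ℝ → Plane} (hc : Continuous c) {I : Set ℝ}
    (hinj : InjOn c I) {t₀ : ℝ} (ht₀ : t₀ ∈ I) {K : Set ℝ} (hK : IsCompact K) (hKI : K ⊆ I) {h : ℝ}
    (hh : 0 < h) :
    ∃ r > 0, ∀ t ∈ K, c t ∈ Metric.ball (c t₀) r → t ∈ Ioo (t₀ - h) (t₀ + h) := by
  have hcl : IsClosed (c '' (K \ Ioo (t₀ - h) (t₀ + h))) :=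
    ((hK.diff isOpen_Ioo).image hc).isClosed
  have hn : c t₀ ∈ (c '' (K \ Ioo (t₀ - h) (t₀ + h)))ᶜ := by
    rintro ⟨t, ht, hct⟩
    rw [hinj (hKI ht.1) ht₀ hct] at ht
    exact ht.2 ⟨by linarith, by linarith⟩
  obtain ⟨r, hr, hb⟩ := Metric.isOpen_iff.1 hcl.isOpen_compl _ hn
  refine ⟨r, hr, fun t ht htb => ?_⟩
  by_contra hcon
  exact hb htb ⟨t, ⟨ht, hcon⟩, rfl⟩

theorem IsPartition.hasFoldChart_of_curve {U Up Um : Set Plane} (h : IsPartition U Up Um)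
    {c : ℝ → Plane} (hc : ContDiff ℝ ∞ c) {t₀ : ℝ} (hd : deriv c t₀ ≠ 0)
    (hp : c t₀ ∈ closure Up ∩ closure Um) {e : Plane ≃ₗᵢ[ℝ] Plane}
    (he : e (deriv c t₀) = EuclideanSpace.single 0 ‖deriv c t₀‖)
    (hloc : ∀ h > 0, ∃ r > 0, ∀ x ∈ Metric.ball (c t₀) r, x ∈ closure Up ∩ closure Um →
      ∃ t ∈ Ioo (t₀ - h) (t₀ + h), c t = x) {Y : Set ℝ} (hY : Y.OrdConnected) {r₁ : ℝ} (hr₁ : 0 < r₁)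
    (hU : ∀ x ∈ Metric.ball (c t₀) r₁, x ∈ U ↔ e x 0 ∈ Y) {ε : NNReal} (hε : 0 < ε) :
    HasFoldChart U Up Um (c t₀) ε := by
  obtain ⟨d, hd0, g, hg, hgc⟩ := exists_lipschitz_graph_of_curve hc hd he hε
  obtain ⟨r, hr, hrc⟩ := hloc d hd0
  refine h.hasFoldChart e hg hp (hgc _ ⟨by linarith, by linarith⟩) hY (lt_min hr hr₁)
    (fun x hx => hU x (Metric.ball_subset_ball (min_le_right _ _) hx)) fun x hx hxi => ?_
  obtain ⟨t, ht, rfl⟩ := hrc x (Metric.ball_subset_ball (min_le_left _ _) hx) hxi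
  exact hgc t ht

/-! ### Local structure of the interfaces -/

/-- Near `p`, either `U` is contained in `A` or in `B`, or `A` and `B` are separated by a graph. -/
def LocallyFlat (U A B : Set Plane) (p : Plane) : Prop :=
  (∃ r > 0, Metric.ball p r ∩ U ⊆ A ∨ Metric.ball p r ∩ U ⊆ B) ∨
    ∀ ε : NNReal, 0 < ε → HasFoldChart U A B p ε

theorem LocallyFlat.symm {U A B : Set Plane} {p : Plane} (h : LocallyFlat U A B p) :
    LocallyFlat U B A p :=
  h.imp (fun ⟨r, hr, h⟩ => ⟨r, hr, h.symm⟩) fun h ε hε => (h ε hε).symm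

/-- A homothety replaces `g` by `δ g(δ⁻¹ ·)` and leaves the Lipschitz constant unchanged. With `δ =
1` the statement also transfers flatness between sets which coincide near `p`. -/
theorem LocallyFlat.scale {U A B U' A' B' : Set Plane} {p : Plane} {δ : ℝ} (hδ : 0 < δ)
    (h : LocallyFlat U A B (δ⁻¹ • p)) {r₁ : ℝ} (hr₁ : 0 < r₁)
    (hU : ∀ x ∈ Metric.ball p r₁, x ∈ U' ↔ δ⁻¹ • x ∈ U)
    (hA : ∀ x ∈ Metric.ball p r₁, x ∈ A' ↔ δ⁻¹ • x ∈ A)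
    (hB : ∀ x ∈ Metric.ball p r₁, x ∈ B' ↔ δ⁻¹ • x ∈ B) : LocallyFlat U' A' B' p := by
  have hball : ∀ r, ∀ x ∈ Metric.ball p (δ * r), δ⁻¹ • x ∈ Metric.ball (δ⁻¹ • p) r := by
    intro r x hx
    rw [Metric.mem_ball, dist_smul₀, Real.norm_of_nonneg (by positivity)]
    rw [Metric.mem_ball] at hx
    rwa [inv_mul_lt_iff₀ hδ]
  rcases h with ⟨r, hr, h⟩ | h
  · refine Or.inl ⟨min (δ * r) r₁, by positivity, h.imp (fun h x hx => ?_) fun h x hx => ?_⟩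
    all_goals
      have h1 := Metric.ball_subset_ball (min_le_left _ _) hx.1
      have h2 := Metric.ball_subset_ball (min_le_right _ _) hx.1
    · exact (hA x h2).2 (h ⟨hball r x h1, (hU x h2).1 hx.2⟩)
    · exact (hB x h2).2 (h ⟨hball r x h1, (hU x h2).1 hx.2⟩)
  · refine Or.inr fun ε hε => ?_
    obtain ⟨e, g, Y, hg, hp, r, hr, h⟩ := h ε hε
    have hs : ∀ (x : Plane) i, e (δ⁻¹ • x) i = δ⁻¹ * e x i := fun x i => by simp
    refine ⟨e, fun y => δ * g (δ⁻¹ * y), {y | δ⁻¹ * y ∈ Y}, ?_, ?_, min (δ * r) r₁, by positivity,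
      fun x hx => ?_⟩
    · refine LipschitzWith.of_dist_le_mul fun y z => ?_
      have h1 := hg.dist_le_mul (δ⁻¹ * y) (δ⁻¹ * z)
      rw [Real.dist_eq, Real.dist_eq, ← mul_sub, abs_mul, abs_of_pos (inv_pos.2 hδ)] at h1
      rw [Real.dist_eq, Real.dist_eq, ← mul_sub, abs_mul, abs_of_pos hδ]
      calc δ * |g (δ⁻¹ * y) - g (δ⁻¹ * z)| ≤ δ * (ε * (δ⁻¹ * |y - z|)) := by gcongr
        _ = ε * |y - z| := by field_simp
    · rw [hs, hs] at hp
      exact ((congrArg (δ * ·) hp).symm.trans (mul_inv_cancel_left₀ hδ.ne' _)).symm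
    · have h1 := Metric.ball_subset_ball (min_le_left _ _) hx
      have h2 := Metric.ball_subset_ball (min_le_right _ _) hx
      obtain ⟨h3, h4⟩ := h _ (hball r x h1)
      rw [hs, hs] at h4
      rw [hs] at h3
      refine ⟨(hU x h2).trans h3, fun hxU => ?_⟩
      obtain ⟨h5, h6⟩ := h4 ((hU x h2).1 hxU)
      rw [hA x h2, hB x h2]
      refine ⟨fun hlt => h5 ?_, fun hlt => h6 ?_⟩
      · rwa [← div_eq_inv_mul (e x 1), lt_div_iff₀' hδ]
      · rwa [← div_eq_inv_mul (e x 1), div_lt_iff₀' hδ]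

theorem isOpen_upperHalf : IsOpen upperHalf :=
  isOpen_lt continuous_const (EuclideanSpace.proj (1 : Fin 2) : Plane →L[ℝ] ℝ).continuous

/-- In the whole conical disk, and not only in `D(O, δ)`, the rounded set is the dilated frozen set:
between the two circles both are the cone `T`, which is invariant under dilation. -/
theorem mem_rounded_iff {A X T : Set Plane} {ρ δ : ℝ} (hA : A ∩ Metric.ball 0 ρ = T ∩ Metric.ball 0 ρ)
    (hX : X \ Metric.ball 0 1 = T \ Metric.ball 0 1) (hδ : 0 < δ)
    (hT : ∀ x : Plane, δ⁻¹ • x ∈ T ↔ x ∈ T) {x : Plane} (hx : x ∈ Metric.ball 0 ρ) :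
    x ∈ (A \ Metric.ball 0 δ) ∪ {x | x ∈ Metric.ball 0 δ ∧ δ⁻¹ • x ∈ X} ↔ δ⁻¹ • x ∈ X := by
  by_cases hxδ : x ∈ Metric.ball 0 δ
  · exact ⟨fun h => h.elim (fun h => absurd hxδ h.2) fun h => h.2, fun h => Or.inr ⟨hxδ, h⟩⟩
  · have h1 : δ⁻¹ • x ∉ Metric.ball (0 : Plane) 1 := by
      rw [mem_ball_zero_iff] at hxδ ⊢
      rwa [norm_smul, Real.norm_of_nonneg (by positivity), inv_mul_lt_iff₀ hδ, mul_one]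
    have h2 : x ∈ A ↔ x ∈ T := by
      have := Set.ext_iff.1 hA x
      simpa [hx] using this
    have h3 : δ⁻¹ • x ∈ X ↔ δ⁻¹ • x ∈ T := by
      have := Set.ext_iff.1 hX (δ⁻¹ • x)
      rw [Set.mem_sdiff, Set.mem_sdiff] at this
      simpa only [h1, not_false_eq_true, and_true] using this
    rw [h3, hT, ← h2]
    exact ⟨fun h => h.elim (fun h => h.1) fun h => absurd h.1 hxδ, fun h => Or.inl ⟨h, hxδ⟩⟩

theorem IsPartition.locallyFlat_of_curve_interior {U Up Um : Set Plane} (h : IsPartition U Up Um)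
    {c : ℝ → Plane} (hc : ContDiff ℝ ∞ c) {t₀ : ℝ} (hd : deriv c t₀ ≠ 0)
    (hp : c t₀ ∈ closure Up ∩ closure Um) (hU : U ∈ 𝓝 (c t₀))
    (hloc : ∀ h > 0, ∃ r > 0, ∀ x ∈ Metric.ball (c t₀) r, x ∈ closure Up ∩ closure Um →
      ∃ t ∈ Ioo (t₀ - h) (t₀ + h), c t = x) : LocallyFlat U Up Um (c t₀) := by
  refine Or.inr fun ε hε => ?_
  obtain ⟨e, he⟩ := exists_isometry_apply_eq_single (deriv c t₀)
  obtain ⟨r₁, hr₁, hb⟩ := Metric.mem_nhds_iff.1 hU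
  exact h.hasFoldChart_of_curve hc hd hp he hloc ordConnected_univ hr₁
    (fun x hx => iff_of_true (hb hx) (mem_univ _)) hε

namespace RoundedCornerGeometry

variable (G : RoundedCornerGeometry)

/-- At the foot of `Γ` the tangent is orthogonal to the `x`-axis. With the tangent as first axis,
`Ξ` becomes `{e x 0 > 0}`, a vertical half plane in the sense of the chart. -/
theorem locallyFlat_Ξ (p : Plane) : LocallyFlat upperHalf G.Ξp G.Ξm p := by
  by_cases hp : p ∈ closure G.Ξp ∩ closure G.Ξm
  swap
  · exact Or.inl (G.partition_Ξ.exists_ball_of_notMem hp)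
  obtain ⟨t₀, ht₀, rfl⟩ := G.φΓ_image.superset hp
  have ht₀' : 0 ≤ t₀ := ht₀
  have hloc : ∀ h > 0, ∃ r > 0, ∀ x ∈ Metric.ball (G.φΓ t₀) r, x ∈ closure G.Ξp ∩ closure G.Ξm →
      ∃ t ∈ Ioo (t₀ - h) (t₀ + h), G.φΓ t = x := by
    intro h hh
    -- The parameter half line is not compact. For `t ≥ 1` the abscissa of the curve is `t`, so
    -- points of `Γ` at distance less than `1` from `φΓ t₀` have parameters at most `T`.
    set T := max 1 (G.φΓ t₀ 0 + 1)
    obtain ⟨r, hr, hb⟩ := exists_ball_inter_image_subset G.φΓ_contDiff.continuous G.φΓ_injOn ht₀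
      (isCompact_Icc (a := 0) (b := T)) Icc_subset_Ici_self hh
    refine ⟨min r 1, lt_min hr one_pos, fun x hx hxi => ?_⟩
    obtain ⟨t, ht, rfl⟩ := G.φΓ_image.superset hxi
    refine ⟨t, hb t ⟨ht, ?_⟩ (Metric.ball_subset_ball (min_le_left _ _) hx), rfl⟩
    rcases le_or_gt t 1 with h1 | h1
    · exact h1.trans (le_max_left _ _)
    · refine le_trans ?_ (le_max_right _ _)
      have h2 := Metric.ball_subset_ball (min_le_right _ _) hx
      rw [Metric.mem_ball, dist_eq_norm] at h2
      have h3 := (PiLp.norm_apply_le (G.φΓ t - G.φΓ t₀) 0).trans h2.le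
      rw [PiLp.sub_apply, (G.φΓ_diag t h1.le).1, Real.norm_eq_abs] at h3
      linarith [le_abs_self (t - G.φΓ t₀ 0)]
  rcases ht₀'.eq_or_lt with h0 | h0
  · subst h0
    refine Or.inr fun ε hε => ?_
    obtain ⟨e, he⟩ := exists_isometry_apply_eq_single (deriv G.φΓ 0)
    have hd := G.φΓ_deriv_ne 0 ht₀
    set v := deriv G.φΓ 0 with hv
    have hnorm : ‖v‖ = |v 1| := by
      rw [EuclideanSpace.norm_eq, Fin.sum_univ_two, G.φΓ_deriv_zero]
      simp [Real.sqrt_sq_eq_abs]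
    -- The curve enters the upper half plane, so its initial velocity points upward. This fixes the
    -- orientation of `e` and gives `e x 0 = x 1`.
    have hv1 : 0 ≤ v 1 := by
      have h1 : HasDerivAt (fun t => G.φΓ t 1) (v 1) 0 :=
        (EuclideanSpace.proj (1 : Fin 2) : Plane →L[ℝ] ℝ).hasFDerivAt.comp_hasDerivAt 0
          (G.φΓ_contDiff.differentiable (by simp) 0).hasDerivAt
      refine ge_of_tendsto h1.tendsto_slope_zero_right ?_
      filter_upwards [eventually_mem_nhdsWithin] with t ht
      have h2 : 0 < G.φΓ t 1 := G.φΓ_mem t ht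
      have h3 : (0 : ℝ) < t := ht
      rw [zero_add, G.φΓ_zero, sub_zero, smul_eq_mul]
      positivity
    have hn : 0 < ‖v‖ := norm_pos_iff.2 hd
    refine G.partition_Ξ.hasFoldChart_of_curve G.φΓ_contDiff hd hp he hloc (ordConnected_Ioi (a := 0))
      one_pos (fun x _ => ?_) hε
    have h1 := apply_zero_mul_norm he x
    have h2 : inner ℝ x v = x 1 * ‖v‖ := by
      rw [hnorm, abs_of_nonneg hv1, PiLp.inner_apply, Fin.sum_univ_two, G.φΓ_deriv_zero]
      simp [mul_comm]
    rw [h2] at h1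
    rw [mul_right_cancel₀ hn.ne' h1]
    exact Iff.rfl
  · exact G.partition_Ξ.locallyFlat_of_curve_interior G.φΓ_contDiff (G.φΓ_deriv_ne t₀ ht₀) hp
      (isOpen_upperHalf.mem_nhds (G.φΓ_mem t₀ h0)) hloc

theorem locallyFlat_O' (h : G.O' ∈ closure G.Ωp ∩ closure G.Ωm) :
    LocallyFlat G.Ω G.Ωp G.Ωm G.O' := by
  refine Or.inr fun ε hε => ?_
  obtain ⟨ν, r, hν, hr, h1, h2⟩ := G.straight_at_O'
  obtain ⟨e, he⟩ := exists_isometry_apply_eq_single ν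
  have he0 : ∀ x, e x 0 = inner ℝ x ν := by
    intro x
    rw [← apply_zero_mul_norm he, hν, mul_one]
  refine G.partition_Ω.hasFoldChart e (g := fun _ => e G.O' 1) (LipschitzWith.const' _)
    h rfl (ordConnected_Ioi (a := inner ℝ G.O' ν)) hr (fun x hx => ?_) fun x hx hxi => ?_
  · have := Set.ext_iff.1 h1 x
    simp only [mem_inter_iff, hx, and_true] at this
    rw [this, he0, mem_Ioi, Set.mem_ofPred_eq, inner_sub_left, sub_pos]
  · obtain ⟨⟨s, -, hs⟩, -⟩ := h2.subset ⟨hxi, hx⟩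
    rw [hs, map_add, map_smul, he]
    simp

/-- Apart from the corner, only `O'` lies both on the interface and on the boundary, and there the
interface is a straight segment normal to it. All other interface points are interior. -/
theorem locallyFlat_Ω {p : Plane} (hp0 : p ≠ 0) : LocallyFlat G.Ω G.Ωp G.Ωm p := by
  by_cases hp : p ∈ closure G.Ωp ∩ closure G.Ωm
  swap
  · exact Or.inl (G.partition_Ω.exists_ball_of_notMem hp)
  obtain ⟨t₀, ht₀, rfl⟩ := G.γ_image.superset hp
  by_cases ht1 : t₀ = 1
  · subst ht1
    rw [G.γ_one] at hp ⊢
    exact G.locallyFlat_O' hp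
  refine G.partition_Ω.locallyFlat_of_curve_interior G.γ_contDiff (G.γ_deriv_ne t₀ ht₀) hp ?_ ?_
  · refine G.isOpen_Ω.mem_nhds ?_
    by_contra hn
    have h1 : G.γ t₀ ∈ frontier G.Ω := by
      rw [G.isOpen_Ω.frontier_eq]
      exact ⟨closure_mono G.partition_Ω.pos_subset hp.1, hn⟩
    rcases G.interface_inter_frontier.subset ⟨hp, h1⟩ with h2 | h2
    · exact hp0 h2
    · rw [mem_singleton_iff, ← G.γ_one] at h2
      exact ht1 (G.γ_injOn ht₀ (right_mem_Icc.2 zero_le_one) h2)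
  · intro h hh
    obtain ⟨r, hr, hb⟩ := exists_ball_inter_image_subset G.γ_contDiff.continuous G.γ_injOn ht₀
      isCompact_Icc subset_rfl hh
    refine ⟨r, hr, fun x hx hxi => ?_⟩
    obtain ⟨t, ht, rfl⟩ := G.γ_image.superset hxi
    exact ⟨t, hb t ht hx, rfl⟩

/-- A point of `Ω` in the disk is a limit of points of the two sectors, so its ordinate is
nonnegative. As `Ω` is open, the same holds slightly below it, which excludes the value zero. -/
theorem mem_Ω_iff {x : Plane} (hx : x ∈ Metric.ball 0 (2 * G.r₀)) : x ∈ G.Ω ↔ x ∈ upperHalf := by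
  refine ⟨fun hxΩ => ?_, fun h => G.halfDisk_subset ⟨hx, h⟩⟩
  have hpos : ∀ y ∈ Metric.ball 0 (2 * G.r₀), y ∈ G.Ωp ∪ G.Ωm → 0 < y 1 := by
    rintro y hy (h1 | h1)
    · exact (G.Ωp_near_O.subset ⟨h1, hy⟩).1.1
    · exact (G.Ωm_near_O.subset ⟨h1, hy⟩).1.1
  have hcl : ∀ y ∈ Metric.ball 0 (2 * G.r₀), y ∈ G.Ω → 0 ≤ y 1 := by
    intro y hy hyΩ
    have h1 : y ∈ closure (G.Ωp ∪ G.Ωm) := by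
      by_cases hyi : y ∈ closure G.Ωp ∩ closure G.Ωm
      · exact closure_mono subset_union_left hyi.1
      · exact subset_closure (G.partition_Ω.union_eq.superset ⟨hyΩ, hyi⟩)
    have hcont : Continuous fun y : Plane => y 1 :=
      (EuclideanSpace.proj (1 : Fin 2) : Plane →L[ℝ] ℝ).continuous
    by_contra hlt
    obtain ⟨z, hz, hz'⟩ := mem_closure_iff.1 h1 _
      (Metric.isOpen_ball.inter (isOpen_lt hcont continuous_const)) ⟨hy, not_le.1 hlt⟩
    exact lt_asymm hz.2 (hpos z hz.1 hz')
  have hcont : Tendsto (fun s : ℝ => x - s • (EuclideanSpace.single 1 1 : Plane)) (𝓝[>] 0) (𝓝 x) := by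
    have : Continuous fun s : ℝ => x - s • (EuclideanSpace.single 1 1 : Plane) := by fun_prop
    simpa using (this.tendsto 0).mono_left nhdsWithin_le_nhds
  have hev := (hcont.eventually ((Metric.isOpen_ball.inter G.isOpen_Ω).mem_nhds ⟨hx, hxΩ⟩)).and
    (eventually_mem_nhdsWithin (a := (0 : ℝ)) (s := Ioi 0))
  obtain ⟨s, hs1, hs2⟩ := hev.exists
  have h1 := hcl _ hs1.1 hs1.2
  have h2 : (0 : ℝ) < s := hs2
  simp at h1
  exact h2.trans_le h1

section Rounded

variable {δ : ℝ} (hδ : 0 < δ)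
include hδ

theorem mem_Ωpδ_iff {x : Plane} (hx : x ∈ Metric.ball 0 (2 * G.r₀)) :
    x ∈ G.Ωpδ δ ↔ δ⁻¹ • x ∈ G.Ξp := by
  refine mem_rounded_iff G.Ωp_near_O G.Ξp_far hδ (fun x => ?_) hx
  simp [sectorPos, hδ]

theorem mem_Ωmδ_iff {x : Plane} (hx : x ∈ Metric.ball 0 (2 * G.r₀)) :
    x ∈ G.Ωmδ δ ↔ δ⁻¹ • x ∈ G.Ξm := by
  refine mem_rounded_iff G.Ωm_near_O G.Ξm_far hδ (fun x => ?_) hx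
  simp [sectorNeg, hδ]

omit hδ in
theorem disjoint_rounded : Disjoint (G.Ωpδ δ) (G.Ωmδ δ) := by
  refine disjoint_left.2 ?_
  rintro x (h1 | h1) (h2 | h2)
  · exact disjoint_left.1 G.partition_Ω.disjoint h1.1 h2.1
  · exact h1.2 h2.1
  · exact h2.2 h1.1
  · exact disjoint_left.1 G.partition_Ξ.disjoint h1.2 h2.2

/-- Inside `D(O, 2r₀)` the geometry is a dilation of the frozen one. Elsewhere the rounding has
changed nothing near `p`, and `p` is not the corner. As `δ < 2r₀`, these two cases cover the plane.
-/
theorem locallyFlat_rounded (hδr : δ < 2 * G.r₀) (p : Plane) :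
    LocallyFlat G.Ω (G.Ωpδ δ) (G.Ωmδ δ) p := by
  by_cases hp : p ∈ Metric.ball 0 (2 * G.r₀)
  · obtain ⟨r, hr, hb⟩ := Metric.isOpen_iff.1 Metric.isOpen_ball p hp
    refine (G.locallyFlat_Ξ (δ⁻¹ • p)).scale hδ hr (fun x hx => ?_)
      (fun x hx => G.mem_Ωpδ_iff hδ (hb hx)) (fun x hx => G.mem_Ωmδ_iff hδ (hb hx))
    rw [G.mem_Ω_iff (hb hx)]
    simp [upperHalf, hδ]
  · have hp' : δ < ‖p‖ := by
      rw [mem_ball_zero_iff, not_lt] at hp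
      exact hδr.trans_le hp
    have hout : ∀ x ∈ Metric.ball p (‖p‖ - δ), x ∉ Metric.ball (0 : Plane) δ := by
      intro x hx hx0
      rw [mem_ball_zero_iff] at hx0
      rw [Metric.mem_ball, dist_comm, dist_eq_norm] at hx
      linarith [norm_sub_norm_le p x]
    have hp0 : p ≠ 0 := norm_pos_iff.1 (hδ.trans hp')
    have := G.locallyFlat_Ω hp0
    rw [← one_smul ℝ p, ← inv_one] at this
    refine this.scale one_pos (sub_pos.2 hp') (fun x hx => by simp) (fun x hx => ?_) fun x hx => ?_
    · have := hout x hx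
      rw [mem_ball_zero_iff] at this
      simp [Ωpδ, this]
    · have := hout x hx
      rw [mem_ball_zero_iff] at this
      simp [Ωmδ, this]

end Rounded

theorem coeff_of_mem_pos {δ σp σm : ℝ} {x : Plane} (hx : x ∈ G.Ωpδ δ) : G.coeff δ σp σm x = σp :=
  if_pos hx

theorem coeff_of_mem_neg {δ σp σm : ℝ} {x : Plane} (hx : x ∈ G.Ωmδ δ) : G.coeff δ σp σm x = σm := by
  rw [coeff, if_neg fun h => disjoint_left.1 G.disjoint_rounded h hx, if_pos hx]

end RoundedCornerGeometry

/-! ### T-coercivity at every point of the cavity. -/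

theorem exists_slope_lt {a b : ℝ} (h : |b| < |a|) :
    ∃ ε : NNReal, 0 < ε ∧ |b| * (1 + 2 * (ε : ℝ)) ^ 2 < |a| := by
  have h1 : Tendsto (fun ε : NNReal => |b| * (1 + 2 * (ε : ℝ)) ^ 2) (𝓝 0) (𝓝 |b|) := by
    have : Continuous fun ε : NNReal => |b| * (1 + 2 * (ε : ℝ)) ^ 2 := by fun_prop
    simpa using this.tendsto 0
  have h2 := ((h1.mono_left (nhdsWithin_le_nhds (s := Ioi 0))).eventually_lt_const h).and
    (eventually_mem_nhdsWithin (a := (0 : NNReal)) (s := Ioi 0))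
  obtain ⟨ε, h3, h4⟩ := h2.exists
  exact ⟨ε, h4, h3⟩

theorem LocallyFlat.locallyTCoercive {Ω A B : Set Plane} {p : Plane} (h : LocallyFlat Ω A B p)
    (hΩ : IsOpen Ω) {σ : Plane → ℝ} (hσ : Measurable σ) (hb : ∃ C : ℝ, ∀ x, |σ x| ≤ C) {a b : ℝ}
    (hab : a * b < 0) (hne : |a| ≠ |b|) (hA : ∀ x ∈ A, σ x = a) (hB : ∀ x ∈ B, σ x = b) :
    LocallyTCoercive hΩ hσ hb p := by
  -- The dominant value is placed on the side onto which one folds; the strict inequality leaves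
  -- room for a positive slope `ε`.
  wlog hlt : |b| < |a| generalizing A B a b
  · exact this h.symm (by linarith) hne.symm hB hA (lt_of_le_of_ne (not_lt.1 hlt) hne)
  rcases h with ⟨r, hr, h | h⟩ | h
  · exact locallyTCoercive_of_const hΩ hσ hb (left_ne_zero_of_mul hab.ne) hr
      fun x hx => hA x (h hx)
  · exact locallyTCoercive_of_const hΩ hσ hb (right_ne_zero_of_mul hab.ne) hr
      fun x hx => hB x (h hx)
  · obtain ⟨ε, hε, hε'⟩ := exists_slope_lt hlt
    exact (h ε hε).locallyTCoercive hΩ hσ hb hab hε' one_pos (fun x hx => hA x hx.2)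
      fun x hx => hB x hx.2

theorem RoundedCornerGeometry.locallyTCoercive (G : RoundedCornerGeometry) {δ σp σm : ℝ}
    (hδ : 0 < δ) (hδr : δ < 2 * G.r₀) (hσp : 0 < σp) (hσm : σm < 0) (hκ : σm / σp ≠ -1) (p : Plane) :
    LocallyTCoercive G.isOpen_Ω (G.coeff_measurable δ σp σm) (G.coeff_bounded δ σp σm) p := by
  refine (G.locallyFlat_rounded hδ hδr p).locallyTCoercive _ _ _ (mul_neg_of_pos_of_neg hσp hσm) ?_
    (fun x hx => G.coeff_of_mem_pos hx) fun x hx => G.coeff_of_mem_neg hx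
  rw [abs_of_pos hσp, abs_of_neg hσm]
  intro h
  refine hκ ?_
  rw [div_eq_iff hσp.ne', h]
  ring

/-! ### The operator in terms of the form -/

theorem pderiv_conj (φ : Plane → ℂ) (i : Fin 2) (x : Plane) :
    pderiv i (fun x => (starRingEnd ℂ) (φ x)) x = (starRingEnd ℂ) (pderiv i φ x) := by
  simp only [pderiv]
  have h := Complex.conjCLE.comp_fderiv (f := φ) (x := x)
  exact congrArg (fun L : Plane →L[ℝ] ℂ => L (EuclideanSpace.single i (1 : ℝ))) h

theorem IsTest.conj {Ω : Set Plane} {φ : Plane → ℂ} (h : IsTest Ω φ) :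
    IsTest Ω fun x => (starRingEnd ℂ) (φ x) :=
  ⟨Complex.conjCLE.contDiff.comp h.contDiff,
    h.hasCompactSupport.comp_left (g := starRingEnd ℂ) (map_zero _), by
    refine (closure_mono ?_).trans h.tsupport_subset
    intro x hx hx0
    exact hx (by simp [hx0])⟩

theorem IsTest.pderiv {Ω : Set Plane} {φ : Plane → ℂ} (h : IsTest Ω φ) (i : Fin 2) :
    IsTest Ω (pderiv i φ) :=
  ⟨(h.contDiff.fderiv_right (m := ∞) (by simp)).clm_apply contDiff_const,
    h.hasCompactSupport.fderiv_apply ℝ _,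
    (closure_minimal (support_pderiv_subset i φ) (isClosed_tsupport φ)).trans h.tsupport_subset⟩

section Graph

variable {Ω : Set Plane} (hΩ : IsOpen Ω) {σ : Plane → ℝ} (hσ : Measurable σ)
  (hb : ∃ C : ℝ, ∀ x, |σ x| ≤ C)

theorem IsTest.inner_embL2_conj {φ : Plane → ℂ} (hφ : IsTest Ω φ) (f : L2 Ω) :
    inner ℂ (embL2 Ω (hφ.conj.isLip.toH10 hΩ)) f = ∫ x in Ω, f x * φ x :=
  (L2.integral_mul_eq_inner hφ.conj.isLip.memLp f).symm

theorem IsTest.inner_gradL2_conj {φ : Plane → ℂ} (hφ : IsTest Ω φ) (i : Fin 2) (f : L2 Ω) :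
    inner ℂ (gradL2 Ω i (hφ.conj.isLip.toH10 hΩ)) f = ∫ x in Ω, f x * _root_.pderiv i φ x := by
  rw [L2.integral_mul_eq_inner (hφ.pderiv i).conj.isLip.memLp, IsLip.gradL2_toH10]
  congr 1
  exact MemLp.toLp_congr _ _ (ae_of_all _ fun x => pderiv_conj φ i x)

theorem IsTest.inner_formOp_conj {φ : Plane → ℂ} (hφ : IsTest Ω φ) (u : H10Space Ω) :
    inner ℂ (hφ.conj.isLip.toH10 hΩ) (formOp Ω hσ hb u)
      = ∫ x in Ω, ∑ i, (σ x : ℂ) * (gradL2 Ω i u x * _root_.pderiv i φ x) := by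
  have hae : ∀ i, (fun x => mulL2 Ω hσ hb (gradL2 Ω i u) x * _root_.pderiv i φ x)
      =ᵐ[volume.restrict Ω] fun x => (σ x : ℂ) * (gradL2 Ω i u x * _root_.pderiv i φ x) := by
    intro i
    filter_upwards [mulL2_coeFn hσ hb (gradL2 Ω i u)] with x hx
    rw [hx, mul_assoc]
  rw [inner_formOp, integral_finsetSum _ fun i _ =>
    (L2.integrable_mul _ (hφ.memLp_pderiv i)).congr (hae i)]
  refine Finset.sum_congr rfl fun i _ => ?_
  rw [hφ.inner_gradL2_conj hΩ]
  exact integral_congr_ae (hae i)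

-- The distributional pairing is bilinear and the form sesquilinear, so `φ` is paired through its
-- conjugate. Density extends the identity from test functions to all of `H¹₀(Ω)`.
include hΩ in
theorem mem_divGraph_iff (x f : L2 Ω) :
    (x, f) ∈ divGraph Ω σ hσ hb ↔ ∃ u : H10Space Ω, embL2 Ω u = x ∧
      ∀ v, inner ℂ v (formOp Ω hσ hb u) = inner ℂ (embL2 Ω v) f := by
  constructor
  · rintro ⟨g, hg, h⟩
    let u : H10Space Ω := ⟨WithLp.toLp 2 fun o => o.elim x g, hg⟩
    refine ⟨u, rfl, fun v => ?_⟩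
    obtain ⟨φ, hφ, hlim⟩ := H10Space.exists_seq_test' hΩ v
    refine tendsto_nhds_unique ((hlim.inner tendsto_const_nhds) : Tendsto _ _
      (𝓝 (inner ℂ v (formOp Ω hσ hb u)))) ?_
    refine ((((embL2 Ω).continuous.tendsto v).comp hlim).inner
      (tendsto_const_nhds (x := f))).congr fun n => ?_
    have h1 := (hφ n).conj.inner_formOp_conj hΩ hσ hb u
    have h2 := (hφ n).conj.inner_embL2_conj hΩ f
    simp only [Complex.conj_conj] at h1 h2
    exact h2.trans ((h _ (hφ n).conj).symm.trans h1.symm)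
  · rintro ⟨u, rfl, h⟩
    refine ⟨fun i => gradL2 Ω i u, u.2, fun φ hφ => ?_⟩
    exact (hφ.inner_formOp_conj hΩ hσ hb u).symm.trans ((h _).trans (hφ.inner_embL2_conj hΩ f))

-- Elements of the space carry their gradient along; injectivity says that the weak gradient is
-- determined by the function.
include hΩ in
theorem embL2_injective : Function.Injective (embL2 Ω) := by
  refine (injective_iff_map_eq_zero (embL2 Ω)).2 fun u hu => ?_
  have h : ∀ i, gradL2 Ω i u = 0 := by
    intro i
    refine L2.eq_zero_of_forall_test hΩ _ fun φ hφ => ?_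
    have h1 : ∫ x in Ω, embL2 Ω u x * _root_.pderiv i φ x = - ∫ x in Ω, gradL2 Ω i u x * φ x :=
      u.2.1 φ hφ i
    have h2 := hφ.inner_gradL2_conj hΩ i (embL2 Ω u)
    rw [hu, inner_zero_right] at h2
    rw [hu, ← h2] at h1
    exact neg_eq_zero.1 h1.symm
  have h3 := norm_sq_H10Space u
  simp only [hu, h, norm_zero] at h3
  simpa using h3

theorem IsTest.inner_gradL2_right {ψ : Plane → ℂ} (hψ : IsTest Ω ψ) (i : Fin 2) (v : H10Space Ω) :
    inner ℂ (gradL2 Ω i v) (embL2 Ω (hψ.isLip.toH10 hΩ))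
      = - inner ℂ (embL2 Ω v) (gradL2 Ω i (hψ.isLip.toH10 hΩ)) := by
  have h1 : ∫ x in Ω, embL2 Ω v x * _root_.pderiv i (fun x => (starRingEnd ℂ) (ψ x)) x
      = - ∫ x in Ω, gradL2 Ω i v x * (starRingEnd ℂ) (ψ x) := v.2.1 _ hψ.conj i
  have h2 := hψ.conj.inner_gradL2_conj hΩ i (embL2 Ω v)
  have h3 := hψ.conj.inner_embL2_conj hΩ (gradL2 Ω i v)
  simp only [Complex.conj_conj] at h2 h3
  rw [← inner_conj_symm, h3, ← inner_conj_symm (embL2 Ω v), h2, h1, map_neg, neg_neg]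

end Graph

/-! ### Oscillating test functions -/

theorem exists_real_bump {c : Plane} {r : ℝ} (hr : 0 < r) : ∃ a : Plane → ℝ, ContDiff ℝ ∞ a ∧
    HasCompactSupport a ∧ tsupport a ⊆ Metric.ball c r ∧ a c ≠ 0 := by
  let b : ContDiffBump c := ⟨r / 4, r / 2, by positivity, by linarith⟩
  refine ⟨b, b.contDiff, b.hasCompactSupport, ?_, ?_⟩
  · rw [b.tsupport_eq]
    exact Metric.closedBall_subset_ball (by simp only [b]; linarith)
  · rw [b.one_of_mem_closedBall (Metric.mem_closedBall_self (by simp only [b]; positivity))]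
    exact one_ne_zero

/-- The plane wave `x ↦ exp (i n x₀)`. -/
noncomputable def planeWave (n : ℝ) (x : Plane) : ℂ := Complex.exp (((n * x 0 : ℝ) : ℂ) * Complex.I)

theorem norm_planeWave (n : ℝ) (x : Plane) : ‖planeWave n x‖ = 1 :=
  Complex.norm_exp_ofReal_mul_I _

theorem contDiff_planeWave (n : ℝ) : ContDiff ℝ ∞ (planeWave n) := by
  have h1 : ContDiff ℝ ∞ fun x : Plane => n * x 0 :=
    contDiff_const.mul (EuclideanSpace.proj (0 : Fin 2) : Plane →L[ℝ] ℝ).contDiff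
  exact ((Complex.ofRealCLM.contDiff.comp h1).mul contDiff_const).cexp

theorem pderiv_planeWave (n : ℝ) (x : Plane) :
    pderiv 0 (planeWave n) x = planeWave n x * (n * Complex.I) := by
  have h1 : HasFDerivAt (fun x : Plane => ((n * x 0 : ℝ) : ℂ) * Complex.I)
      ((Complex.I • (Complex.ofRealCLM ∘L (n • (EuclideanSpace.proj (0 : Fin 2) : Plane →L[ℝ] ℝ))) :
        Plane →L[ℝ] ℂ)) x := by
    have h2 : (fun x : Plane => ((n * x 0 : ℝ) : ℂ) * Complex.I)
        = (Complex.I • (Complex.ofRealCLM ∘L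
          (n • (EuclideanSpace.proj (0 : Fin 2) : Plane →L[ℝ] ℝ))) : Plane →L[ℝ] ℂ) := by
      funext y
      simp [mul_comm]
    rw [h2]
    exact ContinuousLinearMap.hasFDerivAt _
  have h3 := h1.cexp
  rw [pderiv]
  change fderiv ℝ (fun x : Plane => Complex.exp (((n * x 0 : ℝ) : ℂ) * Complex.I)) x _ = _
  rw [h3.fderiv]
  simp [planeWave]
  ring

/-- The derivative is `(∂₀a + i n a)` times a factor of modulus one. As `a` is real, the imaginary
part alone gives the bound, whatever `∂₀a`. -/
theorem norm_mul_le_norm_pderiv {a : Plane → ℝ} (ha : ContDiff ℝ ∞ a) (n : ℝ) (x : Plane) :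
    |n| * ‖(a x : ℂ) * planeWave n x‖ ≤ ‖pderiv 0 (fun x => (a x : ℂ) * planeWave n x) x‖ := by
  have hd : Differentiable ℝ a := ha.differentiable (by simp)
  have hd' : DifferentiableAt ℝ (fun x => (a x : ℂ)) x :=
    Complex.ofRealCLM.differentiableAt.comp x (hd x)
  rw [pderiv_mul hd' ((contDiff_planeWave n).differentiable (by simp) x), pderiv_planeWave, pderiv_ofReal (hd x)]
  have h1 : (a x : ℂ) * (planeWave n x * (n * Complex.I)) + rpderiv 0 a x * planeWave n x
      = (rpderiv 0 a x + (n * a x : ℝ) * Complex.I) * planeWave n x := by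
    push_cast
    ring
  rw [h1, norm_mul, norm_mul, norm_planeWave, mul_one, mul_one, Complex.norm_real,
    Real.norm_eq_abs, ← abs_mul]
  have h2 := Complex.abs_im_le_norm (rpderiv 0 a x + (n * a x : ℝ) * Complex.I)
  simpa using h2

section Oscillating

variable {Ω : Set Plane} (hΩ : IsOpen Ω) {σ : Plane → ℝ} (hσ : Measurable σ)
  (hb : ∃ C : ℝ, ∀ x, |σ x| ≤ C)

theorem IsTest.embL2_pderiv {ψ : Plane → ℂ} (hψ : IsTest Ω ψ) (i : Fin 2) :
    embL2 Ω ((hψ.pderiv i).isLip.toH10 hΩ) = gradL2 Ω i (hψ.isLip.toH10 hΩ) := by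
  rw [IsLip.embL2_toH10, IsLip.gradL2_toH10]

theorem IsTest.mulL2_gradL2 {w : Plane → ℂ} (hw : IsTest Ω w) {s : ℝ}
    (hs : ∀ x ∈ tsupport w, σ x = s) (i : Fin 2) :
    mulL2 Ω hσ hb (gradL2 Ω i (hw.isLip.toH10 hΩ)) = (s : ℂ) • gradL2 Ω i (hw.isLip.toH10 hΩ) := by
  refine Lp.ext ?_
  rw [IsLip.gradL2_toH10]
  filter_upwards [mulL2_coeFn hσ hb ((hw.isLip.memLp_pderiv i).toLp _),
    Lp.coeFn_smul (s : ℂ) ((hw.isLip.memLp_pderiv i).toLp _),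
    (hw.isLip.memLp_pderiv i).coeFn_toLp] with x h1 h2 h3
  rw [h1, h2, Pi.smul_apply, smul_eq_mul, h3]
  by_cases hx : x ∈ tsupport w
  · rw [hs x hx]
  · rw [pderiv_eq_zero_of_notMem_tsupport i hx, mul_zero, mul_zero]

/-- A test function supported where `σ` is the constant `s` avoids the interface, so it belongs to
the domain and `A` acts on it as `-s Δ`. -/
theorem IsTest.mem_divGraph {w : Plane → ℂ} (hw : IsTest Ω w) {s : ℝ}
    (hs : ∀ x ∈ tsupport w, σ x = s) :
    (embL2 Ω (hw.isLip.toH10 hΩ),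
      -((s : ℂ) • ∑ i, gradL2 Ω i ((hw.pderiv i).isLip.toH10 hΩ))) ∈ divGraph Ω σ hσ hb := by
  refine (mem_divGraph_iff hΩ hσ hb _ _).2 ⟨_, rfl, fun v => ?_⟩
  rw [inner_formOp, inner_neg_right, inner_smul_right, inner_sum, Finset.mul_sum,
    ← Finset.sum_neg_distrib]
  refine Finset.sum_congr rfl fun i _ => ?_
  rw [hw.mulL2_gradL2 hΩ hσ hb hs, inner_smul_right, ← mul_neg,
    ← (hw.pderiv i).inner_gradL2_right hΩ, hw.embL2_pderiv hΩ]

theorem IsTest.inner_laplacian {w : Plane → ℂ} (hw : IsTest Ω w) (s : ℝ) :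
    (inner ℂ (embL2 Ω (hw.isLip.toH10 hΩ))
      (-((s : ℂ) • ∑ i, gradL2 Ω i ((hw.pderiv i).isLip.toH10 hΩ)))).re
      = s * ∑ i, ‖gradL2 Ω i (hw.isLip.toH10 hΩ)‖ ^ 2 := by
  rw [inner_neg_right, inner_smul_right, inner_sum, Finset.mul_sum, ← Finset.sum_neg_distrib,
    Finset.mul_sum, Complex.re_sum]
  refine Finset.sum_congr rfl fun i _ => ?_
  rw [← mul_neg, ← (hw.pderiv i).inner_gradL2_right hΩ, hw.embL2_pderiv hΩ, Complex.re_ofReal_mul,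
    inner_self_eq_norm_sq_to_K]
  norm_cast

theorem IsTest.embL2_ne_zero {w : Plane → ℂ} (hw : IsTest Ω w) {c : Plane} (hc : c ∈ Ω)
    (hwc : w c ≠ 0) : embL2 Ω (hw.isLip.toH10 hΩ) ≠ 0 := by
  intro h0
  rw [IsLip.embL2_toH10] at h0
  have h1 : w =ᵐ[volume.restrict Ω] (fun _ => 0) := by
    refine hw.isLip.memLp.coeFn_toLp.symm.trans ?_
    rw [h0]
    exact Lp.coeFn_zero ..
  exact hwc (Measure.eqOn_open_of_ae_eq h1 hΩ hw.contDiff.continuous.continuousOn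
    continuousOn_const hc)

theorem IsTest.norm_gradL2_ge {w : Plane → ℂ} (hw : IsTest Ω w) {n : ℝ}
    (h : ∀ x, |n| * ‖w x‖ ≤ ‖_root_.pderiv 0 w x‖) :
    n ^ 2 * ‖embL2 Ω (hw.isLip.toH10 hΩ)‖ ^ 2 ≤ ∑ i, ‖gradL2 Ω i (hw.isLip.toH10 hΩ)‖ ^ 2 := by
  have h1 : |n| * ‖embL2 Ω (hw.isLip.toH10 hΩ)‖ ≤ ‖gradL2 Ω 0 (hw.isLip.toH10 hΩ)‖ := by
    rw [IsLip.embL2_toH10, IsLip.gradL2_toH10, ← abs_abs n, ← Real.norm_eq_abs |n|,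
      ← Complex.norm_real, ← norm_smul, ← MemLp.toLp_const_smul]
    refine Lp.norm_le_norm_of_ae_le ?_
    filter_upwards [(hw.isLip.memLp.const_smul ((|n| : ℝ) : ℂ)).coeFn_toLp,
      (hw.isLip.memLp_pderiv 0).coeFn_toLp] with x h2 h3
    rw [h2, h3, Pi.smul_apply, norm_smul, Complex.norm_real, Real.norm_eq_abs, abs_abs]
    exact h x
  rw [Fin.sum_univ_two, ← sq_abs n, ← mul_pow]
  have h2 : (|n| * ‖embL2 Ω (hw.isLip.toH10 hΩ)‖) ^ 2 ≤ ‖gradL2 Ω 0 (hw.isLip.toH10 hΩ)‖ ^ 2 := by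
    gcongr
  linarith [sq_nonneg ‖gradL2 Ω 1 (hw.isLip.toH10 hΩ)‖]

include hΩ in
/-- If `σ` equals `s` on a disk, the values of `q` in Rayleigh quotients `s q` are unbounded. -/
theorem exists_rayleigh {c : Plane} {r s : ℝ} (hr : 0 < r) (hball : Metric.ball c r ⊆ Ω)
    (hs : ∀ x ∈ Metric.ball c r, σ x = s) (n : ℝ) :
    ∃ u f : L2 Ω, (u, f) ∈ divGraph Ω σ hσ hb ∧ 0 < ‖u‖ ∧
      ∃ q : ℝ, n ^ 2 * ‖u‖ ^ 2 ≤ q ∧ (inner ℂ u f).re = s * q := by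
  obtain ⟨a, ha, hac, has, ha0⟩ := exists_real_bump (c := c) hr
  have hsupp : tsupport (fun x => (a x : ℂ) * planeWave n x) ⊆ Metric.ball c r := by
    refine (closure_mono ?_).trans has
    intro x hx hx0
    exact hx (by simp [hx0])
  have hw : IsTest Ω (fun x => (a x : ℂ) * planeWave n x) :=
    ⟨(Complex.ofRealCLM.contDiff.comp ha).mul (contDiff_planeWave n),
      (hac.comp_left (g := fun r : ℝ => (r : ℂ)) Complex.ofReal_zero).mul_right, hsupp.trans hball⟩
  refine ⟨_, _, hw.mem_divGraph hΩ hσ hb fun x hx => hs x (hsupp hx), norm_pos_iff.2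
    (hw.embL2_ne_zero hΩ (hball (Metric.mem_ball_self hr)) ?_), _,
    hw.norm_gradL2_ge hΩ fun x => norm_mul_le_norm_pderiv ha n x, hw.inner_laplacian hΩ s⟩
  rw [← norm_ne_zero_iff, norm_mul, norm_planeWave, mul_one, Complex.norm_real]
  exact norm_ne_zero_iff.2 ha0

end Oscillating

/-! ### The operator `A^δ` -/

namespace RoundedCornerGeometry

variable (G : RoundedCornerGeometry)

/-- The ball is taken between the circles of radii `δ` and `ρ`, where the rounded and the original
sets agree, around a point of a ray of the cone `T`. -/
theorem exists_ball_subset {A T : Set Plane} (hA : IsOpen A) {ρ δ : ℝ} (hδ : 0 < δ) (hδρ : δ < ρ)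
    (hAT : A ∩ Metric.ball 0 ρ = T ∩ Metric.ball 0 ρ) {d : Plane} (hd : ‖d‖ = 1)
    (hT : ∀ t : ℝ, 0 < t → t • d ∈ T) :
    ∃ c, ∃ r > 0, Metric.ball c r ⊆ A \ Metric.ball (0 : Plane) δ := by
  obtain ⟨t, h1, h2⟩ := exists_between hδρ
  have ht : ‖t • d‖ = t := by
    rw [norm_smul, hd, mul_one, Real.norm_of_nonneg (hδ.trans h1).le]
  have hmem : t • d ∈ A ∩ (Metric.closedBall (0 : Plane) δ)ᶜ := by
    refine ⟨(hAT.superset ⟨hT t (hδ.trans h1), ?_⟩).1, ?_⟩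
    · rwa [mem_ball_zero_iff, ht]
    · rwa [mem_compl_iff, mem_closedBall_zero_iff, ht, not_le]
  obtain ⟨r, hr, hb⟩ := Metric.isOpen_iff.1 (hA.inter Metric.isClosed_closedBall.isOpen_compl) _ hmem
  exact ⟨_, r, hr, fun x hx => ⟨(hb hx).1, fun hx' => (hb hx).2 (Metric.ball_subset_closedBall hx')⟩⟩

theorem exists_ball_pos {δ : ℝ} (hδ : 0 < δ) (hδr : δ < 2 * G.r₀) :
    ∃ c, ∃ r > 0, Metric.ball c r ⊆ G.Ω ∩ G.Ωpδ δ := by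
  obtain ⟨c, r, hr, hb⟩ := exists_ball_subset G.partition_Ω.isOpen_pos hδ hδr G.Ωp_near_O
    (d := !₂[3 / 5, 4 / 5]) (by rw [EuclideanSpace.norm_eq]; norm_num) fun t ht => by
      simp only [sectorPos, Set.mem_ofPred_eq]
      simp
      constructor <;> linarith
  exact ⟨c, r, hr, fun x hx => ⟨G.partition_Ω.pos_subset (hb hx).1, Or.inl (hb hx)⟩⟩

theorem exists_ball_neg {δ : ℝ} (hδ : 0 < δ) (hδr : δ < 2 * G.r₀) :
    ∃ c, ∃ r > 0, Metric.ball c r ⊆ G.Ω ∩ G.Ωmδ δ := by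
  obtain ⟨c, r, hr, hb⟩ := exists_ball_subset G.partition_Ω.isOpen_neg hδ hδr G.Ωm_near_O
    (d := !₂[4 / 5, 3 / 5]) (by rw [EuclideanSpace.norm_eq]; norm_num) fun t ht => by
      simp only [sectorNeg, Set.mem_ofPred_eq]
      simp
      constructor <;> linarith
  exact ⟨c, r, hr, fun x hx => ⟨G.partition_Ω.neg_subset (hb hx).1, Or.inl (hb hx)⟩⟩

end RoundedCornerGeometry

/-- Dividing by `s` treats both signs at once: unboundedness from above for `s > 0` and from below
for `s < 0`. -/
theorem exists_rayleigh_quotient_mem_domain {Ω : Set Plane} (hΩ : IsOpen Ω) {σ : Plane → ℝ}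
    (hσ : Measurable σ) (hb : ∃ C : ℝ, ∀ x, |σ x| ≤ C) {c : Plane} {r s : ℝ} (hr : 0 < r)
    (hball : Metric.ball c r ⊆ Ω) (hs : ∀ x ∈ Metric.ball c r, σ x = s) (hs0 : s ≠ 0) (C : ℝ) :
    ∃ u : (divOp Ω σ hσ hb).domain,
      C * ‖(u : L2 Ω)‖ ^ 2 < (inner ℂ (u : L2 Ω) (divOp Ω σ hσ hb u)).re / s := by
  -- The frequency `|C| + 1` is chosen because its square exceeds `C`.
  obtain ⟨u, f, hu, hu0, q, hq, hi⟩ := exists_rayleigh hΩ hσ hb hr hball hs (|C| + 1)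
  rw [← divOp_graph hΩ] at hu
  obtain ⟨hd, h1⟩ := LinearPMap.apply_eq_of_mem_graph hu
  refine ⟨⟨u, hd⟩, ?_⟩
  rw [h1, hi, mul_div_cancel_left₀ _ hs0]
  refine lt_of_lt_of_le ?_ hq
  have h2 : C < (|C| + 1) ^ 2 := by nlinarith [le_abs_self C, abs_nonneg C]
  gcongr

theorem EReal.sInf_sSup_of_range {S : Set ℝ} {lam : ℤ → ℝ} (hS : S = range lam)
    (hbot : Tendsto lam atBot atBot) (htop : Tendsto lam atTop atTop) :
    sInf ((fun μ : ℝ => (μ : EReal)) '' S) = ⊥ ∧ sSup ((fun μ : ℝ => (μ : EReal)) '' S) = ⊤ := by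
  subst hS
  constructor
  · rw [sInf_eq_bot]
    intro b hb
    obtain ⟨C, hC⟩ : ∃ C : ℝ, (C : EReal) < b := by
      obtain ⟨C, -, hC⟩ := EReal.lt_iff_exists_real_btwn.1 hb
      exact ⟨C, hC⟩
    obtain ⟨m, hm⟩ := (hbot.eventually (eventually_le_atBot C)).exists
    exact ⟨_, ⟨_, ⟨m, rfl⟩, rfl⟩, (EReal.coe_le_coe_iff.2 hm).trans_lt hC⟩
  · rw [sSup_eq_top]
    intro b hb
    obtain ⟨C, hC, -⟩ := EReal.lt_iff_exists_real_btwn.1 hb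
    obtain ⟨m, hm⟩ := (htop.eventually (eventually_ge_atTop C)).exists
    exact ⟨_, ⟨_, ⟨m, rfl⟩, rfl⟩, hC.trans_le (EReal.coe_le_coe_iff.2 hm)⟩

theorem proposition2p2 (G : RoundedCornerGeometry) (δ : ℝ) (hδ : 0 < δ) (hδr : δ < 2 * G.r₀)
    (σp σm : ℝ) (hσp : 0 < σp) (hσm : σm < 0) (hκ : σm / σp ≠ -1) :
    (∃ lam : ℤ → ℝ, Monotone lam ∧ lam (-1) < 0 ∧ 0 ≤ lam 0 ∧
      Tendsto lam atBot atBot ∧ Tendsto lam atTop atTop ∧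
      unboundedSpectrum (G.operatorA δ σp σm) = Set.range (fun m : ℤ => (lam m : ℂ)) ∧
      ∀ m : ℤ,
        unboundedEigenspace (G.operatorA δ σp σm) (lam m) ≠ ⊥ ∧
        FiniteDimensional ℂ (unboundedEigenspace (G.operatorA δ σp σm) (lam m)) ∧
        {j : ℤ | lam j = lam m}.Finite ∧
        Module.finrank ℂ (unboundedEigenspace (G.operatorA δ σp σm) (lam m)) =
          {j : ℤ | lam j = lam m}.ncard) ∧
    sInf ((fun μ : ℝ => (μ : EReal)) ''
      {μ : ℝ | (μ : ℂ) ∈ unboundedSpectrum (G.operatorA δ σp σm)}) = ⊥ ∧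
    sSup ((fun μ : ℝ => (μ : EReal)) ''
      {μ : ℝ | (μ : ℂ) ∈ unboundedSpectrum (G.operatorA δ σp σm)}) = ⊤ := by
  have hΩ := G.isOpen_Ω
  have hσ := G.coeff_measurable δ σp σm
  have hb := G.coeff_bounded δ σp σm
  obtain ⟨C, hest⟩ := coercive_of_locallyTCoercive hΩ G.isBounded_Ω hσ hb
    fun p _ => G.locallyTCoercive hδ hδr hσp hσm hκ p
  have hsep : TopologicalSpace.SeparableSpace (L2 G.Ω) := by
    have : Fact ((1 : ENNReal) ≤ 2) := ⟨by norm_num⟩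
    have : Fact ((2 : ENNReal) ≠ ⊤) := ⟨by norm_num⟩
    infer_instance
  obtain ⟨l0, R, hRc, hRs, hR⟩ := exists_compact_resolvent (embL2 G.Ω)
    (isCompactOperator_embL2 hΩ.measurableSet G.isBounded_Ω) (embL2_injective hΩ)
    (formOp G.Ω hσ hb) (isSymmetric_formOp hσ hb) hest
  have hA : ∀ x f, (x, f) ∈ (G.operatorA δ σp σm).graph ↔ R (f - (l0 : ℂ) • x) = x := by
    intro x f
    rw [RoundedCornerGeometry.operatorA, divOp_graph hΩ, mem_divGraph_iff hΩ, hR]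
  obtain ⟨cp, rp, hrp, hbp⟩ := G.exists_ball_pos hδ hδr
  obtain ⟨cm, rm, hrm, hbm⟩ := G.exists_ball_neg hδ hδr
  have hup : ∀ C : ℝ, ∃ u : (G.operatorA δ σp σm).domain, C * ‖(u : L2 G.Ω)‖ ^ 2
      < (inner ℂ (u : L2 G.Ω) (G.operatorA δ σp σm u)).re := by
    intro C
    obtain ⟨u, hu⟩ := exists_rayleigh_quotient_mem_domain hΩ hσ hb hrp (fun x hx => (hbp hx).1)
      (fun x hx => G.coeff_of_mem_pos (hbp hx).2) hσp.ne' (C / σp)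
    rw [lt_div_iff₀ hσp] at hu
    refine ⟨u, lt_of_eq_of_lt ?_ hu⟩
    field_simp
  have hlow : ∀ C : ℝ, ∃ u : (G.operatorA δ σp σm).domain,
      (inner ℂ (u : L2 G.Ω) (G.operatorA δ σp σm u)).re < C * ‖(u : L2 G.Ω)‖ ^ 2 := by
    intro C
    obtain ⟨u, hu⟩ := exists_rayleigh_quotient_mem_domain hΩ hσ hb hrm (fun x hx => (hbm hx).1)
      (fun x hx => G.coeff_of_mem_neg (hbm hx).2) hσm.ne (C / σm)
    rw [lt_div_iff_of_neg hσm] at hu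
    refine ⟨u, lt_of_lt_of_eq hu ?_⟩
    have := hσm.ne
    field_simp
  obtain ⟨lam, h1, h2, h3, h4, h5, h6, h7⟩ := exists_int_enumeration_spectrum hRc hRs hA hlow hup
  refine ⟨⟨lam, h1, h2, h3, h4, h5, h6, h7⟩, EReal.sInf_sSup_of_range ?_ h4 h5⟩
  ext μ
  rw [h6]
  simp
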